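/- Let $k$ be a field, $Q$ a finite quiver, and $A=kQ/I$ a string presentation: $I$ is an admissible ideal of the path algebra $kQ$ (paths are composed from left to right) generated by a set of paths; every point of $Q$ is the source of at most two arrows and the target of at most two arrows; and for every arrow $\alpha$ there is at most one arrow $\beta$ with $\alpha\beta\notin I$ and at most one arrow $\gamma$ with $\gamma\alpha\notin I$. Modules are finitely generated right $A$-modules. For a point $x$, let $P(x)=e_xA$, $I(x)=D(Ae_x)$ and $S(x)=\operatorname{top}P(x)$, where $D=\operatorname{Hom}_k(-,k)$. **Conventions.** A path is non-zero if it is not in $I$. The two maximal non-zero paths starting at $x$ are non-zero paths with no common initial subpath other than the stationary path at $x$, such that every non-zero path starting at $x$ is an initial subpath of one of them (so one or both are stationary if fewer than two arrows start at $x$); the two maximal non-zero paths ending at $x$ are defined dually. If $p$ is an initial subpath of $m$, then $m\setminus p$ is obtained by removing from $m$ all points of $p$: it does not exist if $m=p$, and it is $r$ if $m=p\alpha r$ with $\alpha$ an arrow. The path $p\alpha$ is called its connecting path. Terminal subpaths are treated dually. For a non-zero path $[x,y]$ from $x$ to $y$, let $[x,y_0],[x,y_1]$ be the two maximal non-zero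 paths starting at $x$, where $[x,y_0]$ contains $[x,y]$. The *right successors* of $[x,y]$ are $[x_0,y_0]=[x,y_0]\setminus[x,y]$ and $[x_1,y_1]=[x,y_1]\setminus\{x\}$, as far as they exist. The *right maximal sequence* of $[x_0,y_0]$ consists of the paths $[x_{0i_2\cdots i_l},y_{0i_2\cdots i_l}]$, $i_j\in\{0,1\}$, where $[x_{0i_2\cdots i_l0},y_{0i_2\cdots i_l0}]$ and $[x_{0i_2\cdots i_l1},y_{0i_2\cdots i_l1}]$ are the right successors of $[x_{0i_2\cdots i_l},y_{0i_2\cdots i_l}]$ (entries obtained from a non-existing entry do not exist). *Left successors* and *left maximal sequences* $[r_{0i_2\cdots i_l},s_{0i_2\cdots i_l}]$ are defined dually. **Lemma.** (a) The second syzygy of an indecomposable injective $A$-module is the direct sum of at most six uniserial modules. (b) The second cosyzygy of an indecomposable projective $A$-module is the direct sum of at most six uniserial modules. **Corollary.** (a) Let $c$ be a point with $\operatorname{top}I(c)\cong S(a_0)\oplus S(a_1)$. Then the following paths exist: the two maximal non-zero paths $[a_0,c],[a_1,c]$ ending at $c$; for $i=0,1$, the two maximal non-zero paths $[a_i,b'_i]=[a_i,c][c,b'_i]$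 and $[a_i,b_i]$ starting at $a_i$, the path $[d_i,b_i]=[a_i,b_i]\setminus\{a_i\}$ (if it exists), and its right successors $[d_{i0},b_{i0}],[d_{i1},b_{i1}]$ (if they exist); the two maximal non-zero paths $[c,c_0],[c,c_1]$ starting at $c$, with $[c,c_i]$ containing $[c,b'_i]$, and $[c'_i,c_i]=[c,c_i]\setminus[c,b'_i]$ (if it exists). For every choice of these paths, let $[x^j_0,y^j_0]$, $1\le j\le 6$, be the paths $[d_{00},b_{00}],[d_{01},b_{01}],[d_{10},b_{10}],[d_{11},b_{11}],[c'_0,c_0],[c'_1,c_1]$, and let $x^j_{0i_2\cdots i_l}$ be the starting points of the entries of right maximal sequences of these paths. Then $I(c)$ has the minimal projective resolution $$\cdots\to\bigoplus_{j;(0,i_2,i_3)}P(x^j_{0i_2i_3})\to\bigoplus_{j;(0,i_2)}P(x^j_{0i_2})\to\bigoplus_jP(x^j_0)\to P(d_0)\oplus P(c)\oplus P(d_1)\to P(a_0)\oplus P(a_1)\to I(c)\to0,$$ where the sums run over all points that exist, and the morphisms are induced by the paths: $e_{a_i}$ is mapped to the linear form dual to the path $[a_i,c]$; $P(d_i)\to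 P(a_i)$ is left multiplication by the arrow from $a_i$ to $d_i$; $P(c)\to P(a_0)\oplus P(a_1)$ is left multiplication by $([a_0,c],-[a_1,c])$; each of $P(d_{i0}),P(d_{i1})$ is mapped to $P(d_i)$, each $P(c'_i)$ to $P(c)$, and each $P(x^j_{0i_2\cdots i_li_{l+1}})$ to $P(x^j_{0i_2\cdots i_l})$, by left multiplication by the connecting path; all other components are zero. (b) Let $z$ be a point with $\operatorname{soc}P(z)\cong S(w_0)\oplus S(w_1)$. Then the following paths exist: the two maximal non-zero paths $[z,w_0],[z,w_1]$ starting at $z$; for $i=0,1$, the two maximal non-zero paths $[b'_i,w_i]=[b'_i,z][z,w_i]$ and $[b_i,w_i]$ ending at $w_i$, the path $[b_i,v_i]=[b_i,w_i]\setminus\{w_i\}$ (if it exists), and its two left successors (if they exist); the two maximal non-zero paths $[t_0,z],[t_1,z]$ ending at $z$, with $[t_i,z]$ containing $[b'_i,z]$, and $[t_i,z]\setminus[b'_i,z]$ (if it exists). For every choice of these paths, let $[r^j_0,s^j_0]$, $1\le j\le6$, be the left successors of $[b_0,v_0]$, the left successors of $[b_1,v_1]$, and $[t_0,z]\setminus[b'_0,z]$,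 $[t_1,z]\setminus[b'_1,z]$, and let $s^j_{0i_2\cdots i_l}$ be the end points of the entries of left maximal sequences of these paths. Then $P(z)$ has the minimal injective coresolution $$0\to P(z)\to I(w_0)\oplus I(w_1)\to I(v_0)\oplus I(z)\oplus I(v_1)\to\bigoplus_jI(s^j_0)\to\bigoplus_{j;(0,i_2)}I(s^j_{0i_2})\to\bigoplus_{j;(0,i_2,i_3)}I(s^j_{0i_2i_3})\to\cdots,$$ where the sums run over all points that exist, and the morphisms are induced by the paths, dually to (a): a path from $s'$ to $s$ induces the map $I(s)\to I(s')$, $f\mapsto(y\mapsto f(yp))$, where $p$ is the class of the path; the component $I(w_1)\to I(z)$ carries a minus sign; and $P(z)\to I(w_i)$ is $x\mapsto(y\mapsto\varphi_i(xy))$, where $\varphi_i$ is the linear form dual to the path $[z,w_i]$. -/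

import Mathlib

universe u

open Quiver

noncomputable section

namespace StringAlgebra

/-! ### Path algebras -/

/-- The type of all paths of a quiver, stationary paths included.  Paths are composed from left to
right: `α β` means first `α`, then `β`. -/
abbrev QPath (Q : Type u) [Quiver.{u} Q] : Type u := Σ a b : Q, Path a b

/-- The path algebra `kQ`: the vector space with basis the set of all paths. -/
def PathAlgebra (k : Type u) (Q : Type u) [Field k] [Quiver.{u} Q] : Type u := QPath Q →₀ k

namespace PathAlgebra

variable {k Q : Type u} [Field k] [Quiver.{u} Q]

instance : AddCommGroup (PathAlgebra k Q) := inferInstanceAs (AddCommGroup (QPath Q →₀ k))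

instance : Module k (PathAlgebra k Q) := inferInstanceAs (Module k (QPath Q →₀ k))

/-- A path, seen as an element of the path algebra. -/
def of (p : QPath Q) : PathAlgebra k Q := Finsupp.single p 1

open Classical in
/-- The product of two paths: their concatenation if they can be concatenated, and `0` if not. -/
def pathMul (p q : QPath Q) : PathAlgebra k Q :=
  if h : q.1 = p.2.1 then of ⟨p.1, q.2.1, p.2.2.comp (q.2.2.cast h rfl)⟩ else 0

theorem pathMul_comp {a b c : Q} (p : Path a b) (q : Path b c) :
    pathMul (k := k) ⟨a, b, p⟩ ⟨b, c, q⟩ = of ⟨a, c, p.comp q⟩ := by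
  simp [pathMul]

theorem pathMul_of_ne {p q : QPath Q} (h : q.1 ≠ p.2.1) : pathMul (k := k) p q = 0 := by
  simp [pathMul, h]

/-- The bilinear extension of the product of paths. -/
def mulHom : PathAlgebra k Q →ₗ[k] PathAlgebra k Q →ₗ[k] PathAlgebra k Q :=
  Finsupp.linearCombination k fun p : QPath Q =>
    (Finsupp.linearCombination k fun q : QPath Q => pathMul p q :
      (QPath Q →₀ k) →ₗ[k] PathAlgebra k Q)

instance : Mul (PathAlgebra k Q) := ⟨fun f g => mulHom f g⟩

theorem mul_def (f g : PathAlgebra k Q) : f * g = mulHom f g := rfl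

theorem of_mul_of (p q : QPath Q) : (of p * of q : PathAlgebra k Q) = pathMul p q := by
  rw [mul_def]
  unfold mulHom of
  erw [Finsupp.linearCombination_single, one_smul, Finsupp.linearCombination_single, one_smul]

@[elab_as_elim]
theorem induction_on {P : PathAlgebra k Q → Prop} (f : PathAlgebra k Q) (h0 : P 0)
    (hadd : ∀ f g, P f → P g → P (f + g)) (hof : ∀ (r : k) (p : QPath Q), P (r • of p)) : P f := by
  refine Finsupp.induction_linear (motive := P) f h0 hadd fun p r => ?_
  have := hof r p
  unfold of at this
  erw [Finsupp.smul_single, smul_eq_mul, mul_one] at this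
  exact this

theorem smul_mul' (r : k) (f g : PathAlgebra k Q) : (r • f) * g = r • (f * g) := by
  simp [mul_def]

theorem mul_smul' (r : k) (f g : PathAlgebra k Q) : f * (r • g) = r • (f * g) := by
  simp [mul_def]

theorem add_mul' (f g h : PathAlgebra k Q) : (f + g) * h = f * h + g * h := by
  simp [mul_def]

theorem mul_add' (f g h : PathAlgebra k Q) : f * (g + h) = f * g + f * h := by
  simp [mul_def]

theorem zero_mul' (f : PathAlgebra k Q) : 0 * f = 0 := by
  simp [mul_def]

theorem mul_zero' (f : PathAlgebra k Q) : f * 0 = 0 := by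
  simp [mul_def]

theorem of_assoc (p q r : QPath Q) :
    (of p * of q * of r : PathAlgebra k Q) = of p * (of q * of r) := by
  obtain ⟨a, b, p⟩ := p
  obtain ⟨b', c, q⟩ := q
  obtain ⟨c', d, r⟩ := r
  by_cases h1 : b' = b
  · subst h1
    by_cases h2 : c' = c
    · subst h2
      simp only [of_mul_of, pathMul_comp, Path.comp_assoc]
    · rw [of_mul_of ⟨b', c, q⟩, pathMul_of_ne h2, mul_zero', of_mul_of, pathMul_comp, of_mul_of,
        pathMul_of_ne h2]
  · rw [of_mul_of, pathMul_of_ne h1, zero_mul']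
    by_cases h2 : c' = c
    · subst h2
      rw [of_mul_of, pathMul_comp, of_mul_of, pathMul_of_ne h1]
    · rw [of_mul_of, pathMul_of_ne h2, mul_zero']

theorem mul_assoc' (f g h : PathAlgebra k Q) : f * g * h = f * (g * h) := by
  induction f using induction_on with
  | h0 => simp only [zero_mul']
  | hadd f₁ f₂ h₁ h₂ => simp only [add_mul', h₁, h₂]
  | hof r p =>
    induction g using induction_on with
    | h0 => simp only [zero_mul', mul_zero']
    | hadd f₁ f₂ h₁ h₂ => simp only [add_mul', mul_add', h₁, h₂]
    | hof s q =>
      induction h using induction_on with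
      | h0 => simp only [mul_zero']
      | hadd f₁ f₂ h₁ h₂ => simp only [mul_add', h₁, h₂]
      | hof t w => simp only [smul_mul', mul_smul', of_assoc]

variable [Fintype Q]

/-- The identity of `kQ` is the sum of the stationary paths. -/
instance : One (PathAlgebra k Q) := ⟨∑ x : Q, of ⟨x, x, Path.nil⟩⟩

theorem one_def : (1 : PathAlgebra k Q) = ∑ x : Q, of ⟨x, x, Path.nil⟩ := rfl

theorem one_mul' (f : PathAlgebra k Q) : 1 * f = f := by
  induction f using induction_on with
  | h0 => simp only [mul_zero']
  | hadd f₁ f₂ h₁ h₂ => simp only [mul_add', h₁, h₂]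
  | hof r p =>
    obtain ⟨a, b, p⟩ := p
    rw [mul_smul', one_def, mul_def, map_sum, LinearMap.sum_apply, Finset.sum_eq_single a]
    · rw [← mul_def, of_mul_of, pathMul_comp, Path.nil_comp]
    · intro x _ hx
      rw [← mul_def, of_mul_of, pathMul_of_ne (Ne.symm hx)]
    · simp

theorem mul_one' (f : PathAlgebra k Q) : f * 1 = f := by
  induction f using induction_on with
  | h0 => simp only [zero_mul']
  | hadd f₁ f₂ h₁ h₂ => simp only [add_mul', h₁, h₂]
  | hof r p =>
    obtain ⟨a, b, p⟩ := p
    rw [smul_mul', one_def, mul_def, map_sum, Finset.sum_eq_single b]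
    · rw [← mul_def, of_mul_of, pathMul_comp, Path.comp_nil]
    · intro x _ hx
      rw [← mul_def, of_mul_of, pathMul_of_ne hx]
    · simp

instance : Ring (PathAlgebra k Q) :=
  { (inferInstance : AddCommGroup (PathAlgebra k Q)) with
    mul := (· * ·)
    one := 1
    left_distrib := mul_add'
    right_distrib := add_mul'
    zero_mul := zero_mul'
    mul_zero := mul_zero'
    mul_assoc := mul_assoc'
    one_mul := one_mul'
    mul_one := mul_one' }

instance : Algebra k (PathAlgebra k Q) := Algebra.ofModule smul_mul' mul_smul'

end PathAlgebra

/-! ### String presentations -/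

section Algebra

variable {k Q : Type u} [Field k] [Fintype Q] [Quiver.{u} Q]

/-- `I` is an admissible ideal of `kQ` such that `A = kQ / I` is a string presentation.  The first
two fields say that `I` is admissible: `R ^ N ⊆ I ⊆ R ^ 2` for the ideal `R` generated by the
arrows and some `N`, where `R ^ n` is spanned by the paths of length at least `n`. -/
structure IsStringPresentation (I : TwoSidedIdeal (PathAlgebra k Q)) : Prop where
  le_sq : ∀ f ∈ I, f ∈ Submodule.span k
    {g : PathAlgebra k Q | ∃ p : QPath Q, 2 ≤ p.2.2.length ∧ g = PathAlgebra.of p}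
  pow_le : ∃ N : ℕ, ∀ p : QPath Q, N ≤ p.2.2.length → (PathAlgebra.of p : PathAlgebra k Q) ∈ I
  /-- `I` is generated by a set of paths. -/
  monomial : ∃ ρ : Set (QPath Q),
    I = TwoSidedIdeal.span ((PathAlgebra.of : QPath Q → PathAlgebra k Q) '' ρ)
  /-- Each point is the source of at most two arrows ... -/
  source_le_two : ∀ x : Q, ENat.card (Σ y : Q, x ⟶ y) ≤ 2
  /-- ... and the target of at most two arrows. -/
  target_le_two : ∀ x : Q, ENat.card (Σ y : Q, y ⟶ x) ≤ 2
  /-- For an arrow `α` there is at most one arrow `β` with `α β ∉ I` ... -/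
  unique_right : ∀ {x y : Q} (α : x ⟶ y) (β β' : Σ z : Q, y ⟶ z),
    (PathAlgebra.of ⟨x, β.1, α.toPath.comp β.2.toPath⟩ : PathAlgebra k Q) ∉ I →
    (PathAlgebra.of ⟨x, β'.1, α.toPath.comp β'.2.toPath⟩ : PathAlgebra k Q) ∉ I → β = β'
  /-- ... and at most one arrow `γ` with `γ α ∉ I`. -/
  unique_left : ∀ {x y : Q} (α : x ⟶ y) (γ γ' : Σ z : Q, z ⟶ x),
    (PathAlgebra.of ⟨γ.1, y, γ.2.toPath.comp α.toPath⟩ : PathAlgebra k Q) ∉ I →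
    (PathAlgebra.of ⟨γ'.1, y, γ'.2.toPath.comp α.toPath⟩ : PathAlgebra k Q) ∉ I → γ = γ'

variable (I : TwoSidedIdeal (PathAlgebra k Q))

/-- The algebra `A = kQ / I`.  Right `A`-modules are modules over `(BoundAlgebra I)ᵐᵒᵖ`. -/
abbrev BoundAlgebra : Type u := PathAlgebra k Q ⧸ I.asIdeal

/-- The class of a path in `A = kQ / I`. -/
def cls {x y : Q} (p : Path x y) : BoundAlgebra I :=
  Ideal.Quotient.mk I.asIdeal (PathAlgebra.of ⟨x, y, p⟩)

/-- The primitive idempotent `e_x`. -/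
def idem (x : Q) : BoundAlgebra I := cls I (Path.nil : Path x x)

/-- The indecomposable projective right module `P(x) = e_x A`. -/
abbrev Proj (x : Q) : Submodule (BoundAlgebra I)ᵐᵒᵖ (BoundAlgebra I) :=
  Submodule.span (BoundAlgebra I)ᵐᵒᵖ {idem I x}

/-- The left module `A e_x`. -/
abbrev LeftProj (x : Q) : Submodule (BoundAlgebra I) (BoundAlgebra I) :=
  Submodule.span (BoundAlgebra I) {idem I x}

/-- The indecomposable injective right module `I(x) = D(A e_x)`, where `D = Hom_k(-, k)`. -/
def Inj (x : Q) : Type u := Module.Dual k (LeftProj I x)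

namespace Inj

variable {I}
variable {x : Q}

instance : AddCommGroup (Inj I x) := inferInstanceAs (AddCommGroup (Module.Dual k (LeftProj I x)))

/-- An element of `I(x)` as a linear form on `A e_x`. -/
def form (f : Inj I x) : LeftProj I x →ₗ[k] k := f

/-- `A` acts on `D(A e_x)` from the right by `(f a)(b) = f (a b)`. -/
instance : Module (BoundAlgebra I)ᵐᵒᵖ (Inj I x) where
  smul a f := (form f).comp (Algebra.lsmul k k (LeftProj I x) a.unop)
  one_smul f := LinearMap.ext fun b => congrArg (form f) (one_smul (BoundAlgebra I) b)
  mul_smul a a' f := LinearMap.ext fun b => congrArg (form f) (mul_smul a'.unop a.unop b)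
  smul_zero a := LinearMap.ext fun b => rfl
  smul_add a f g := LinearMap.ext fun b => rfl
  add_smul a a' f := LinearMap.ext fun b =>
    (congrArg (form f) (add_smul a.unop a'.unop b)).trans (map_add (form f) _ _)
  zero_smul f := LinearMap.ext fun b =>
    (congrArg (form f) (zero_smul (BoundAlgebra I) b)).trans (map_zero (form f))

/-- The value of `f ∈ D(A e_x)` at `a e_x`; this is just the value of `f` at `a` if `a ∈ A e_x`. -/
def eval (f : Inj I x) (a : BoundAlgebra I) : k :=
  form f ⟨a * idem I x, Submodule.mem_span_singleton.2 ⟨a, rfl⟩⟩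

end Inj

end Algebra

/-! ### General module theory -/

section Modules

variable (R : Type u) [Ring R]

/-- `top M = M / rad M`. -/
abbrev ModTop (M : Type u) [AddCommGroup M] [Module R M] : Type u := M ⧸ Module.jacobson R M

/-- The socle of `M`: the sum of all simple submodules. -/
def Soc (M : Type u) [AddCommGroup M] [Module R M] : Submodule R M :=
  sSup {N : Submodule R M | IsSimpleModule R N}

/-- A module is indecomposable if it is non-zero and not the direct sum of two non-zero
submodules. -/
def IsIndecomposable (M : Type u) [AddCommGroup M] [Module R M] : Prop :=
  Nontrivial M ∧ ∀ N N' : Submodule R M, IsCompl N N' → N = ⊥ ∨ N' = ⊥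

/-- A non-zero module is uniserial if its submodules form a chain. -/
def IsUniserial (M : Type u) [AddCommGroup M] [Module R M] : Prop :=
  Nontrivial M ∧ ∀ N N' : Submodule R M, N ≤ N' ∨ N' ≤ N

/-- `M` is the direct sum of at most `n` uniserial modules. -/
def IsSumOfUniserials (n : ℕ) (M : Type u) [AddCommGroup M] [Module R M] : Prop :=
  ∃ m ≤ n, ∃ U : Fin m → Submodule R M, DirectSum.IsInternal U ∧ ∀ i, IsUniserial R (U i)

variable {R}
variable {M N P : Type u} [AddCommGroup M] [Module R M] [AddCommGroup N] [Module R N]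
  [AddCommGroup P] [Module R P]

/-- A submodule is superfluous if it has no proper supplement. -/
def IsSuperfluous (K : Submodule R M) : Prop := ∀ L : Submodule R M, K ⊔ L = ⊤ → L = ⊤

/-- A submodule is essential if it meets every non-zero submodule. -/
def IsEssential (K : Submodule R M) : Prop := ∀ L : Submodule R M, K ⊓ L = ⊥ → L = ⊥

/-- Projective covers. -/
structure IsProjectiveCover (f : P →ₗ[R] M) : Prop where
  projective : Module.Projective R P
  surjective : Function.Surjective f
  superfluous : IsSuperfluous (LinearMap.ker f)

/-- Injective envelopes. -/
structure IsInjectiveEnvelope (f : M →ₗ[R] P) : Prop where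
  injective_module : Module.Injective R P
  injective : Function.Injective f
  essential : IsEssential (LinearMap.range f)

variable (R M N)

/-- `N` is the (first) syzygy of `M`: the kernel of a projective cover of `M`. -/
def IsSyzygy : Prop :=
  ∃ (P : Type u) (_ : AddCommGroup P) (_ : Module R P) (f : P →ₗ[R] M),
    IsProjectiveCover f ∧ Nonempty (N ≃ₗ[R] LinearMap.ker f)

/-- `N` is the (first) cosyzygy of `M`: the cokernel of an injective envelope of `M`. -/
def IsCosyzygy : Prop :=
  ∃ (E : Type u) (_ : AddCommGroup E) (_ : Module R E) (f : M →ₗ[R] E),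
    IsInjectiveEnvelope f ∧ Nonempty (N ≃ₗ[R] E ⧸ LinearMap.range f)

/-- `N` is the second syzygy of `M`. -/
def IsSecondSyzygy : Prop :=
  ∃ (K : Type u) (_ : AddCommGroup K) (_ : Module R K), IsSyzygy R M K ∧ IsSyzygy R K N

/-- `N` is the second cosyzygy of `M`. -/
def IsSecondCosyzygy : Prop :=
  ∃ (K : Type u) (_ : AddCommGroup K) (_ : Module R K), IsCosyzygy R M K ∧ IsCosyzygy R K N

variable {R M}
variable {C : ℕ → Type u} [∀ n, AddCommGroup (C n)] [∀ n, Module R (C n)]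

/-- `⋯ → C 2 → C 1 → C 0 → M → 0` is a minimal projective resolution: an exact sequence in which
`C 0 → M`, and each `C (n + 1)` onto its image in `C n`, is a projective cover. -/
structure IsMinimalProjectiveResolution (ε : C 0 →ₗ[R] M) (d : ∀ n, C (n + 1) →ₗ[R] C n) :
    Prop where
  projective : ∀ n, Module.Projective R (C n)
  surjective : Function.Surjective ε
  exact_zero : Function.Exact (d 0) ε
  exact_succ : ∀ n, Function.Exact (d (n + 1)) (d n)
  minimal_zero : IsSuperfluous (LinearMap.ker ε)
  minimal_succ : ∀ n, IsSuperfluous (LinearMap.ker (d n))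

/-- `0 → M → C 0 → C 1 → C 2 → ⋯` is a minimal injective coresolution: an exact sequence in which
`M → C 0`, and the inclusion of the image of `C n` into each `C (n + 1)`, is an injective
envelope. -/
structure IsMinimalInjectiveCoresolution (η : M →ₗ[R] C 0) (d : ∀ n, C n →ₗ[R] C (n + 1)) :
    Prop where
  injective_module : ∀ n, Module.Injective R (C n)
  injective : Function.Injective η
  exact_zero : Function.Exact η (d 0)
  exact_succ : ∀ n, Function.Exact (d n) (d (n + 1))
  minimal_zero : IsEssential (LinearMap.range η)
  minimal_succ : ∀ n, IsEssential (LinearMap.range (d n))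

end Modules

/-! ### Maximal paths and maximal sequences -/

section Sequences

variable {k Q : Type u} [Field k] [Fintype Q] [Quiver.{u} Q]

/-- A path is non-zero if it does not lie in `I`. -/
def IsNonzero (I : TwoSidedIdeal (PathAlgebra k Q)) {x y : Q} (p : Path x y) : Prop :=
  (PathAlgebra.of ⟨x, y, p⟩ : PathAlgebra k Q) ∉ I

/-- `p` is an initial subpath of `m`. -/
def IsInitial {x y z : Q} (p : Path x y) (m : Path x z) : Prop := ∃ r : Path y z, m = p.comp r

/-- `p` is a terminal subpath of `m`. -/
def IsTerminal {x y z : Q} (p : Path y x) (m : Path z x) : Prop := ∃ r : Path z y, m = r.comp p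

/-- `m₀` and `m₁` are the two maximal non-zero paths starting at `x`: they start with different
arrows and every non-zero path starting at `x` is contained in one of them.  If only one arrow
(or none) starts at `x`, then one of them (or both) is the stationary path. -/
structure MaximalPairFrom (I : TwoSidedIdeal (PathAlgebra k Q)) {x y₀ y₁ : Q}
    (m₀ : Path x y₀) (m₁ : Path x y₁) : Prop where
  nonzero_left : IsNonzero I m₀
  nonzero_right : IsNonzero I m₁
  cover : ∀ {z : Q} (q : Path x z), IsNonzero I q → IsInitial q m₀ ∨ IsInitial q m₁
  disjoint : ∀ {z : Q} (q : Path x z), IsInitial q m₀ → IsInitial q m₁ → q.length = 0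

/-- `m₀` and `m₁` are the two maximal non-zero paths ending at `x` (with the same conventions). -/
structure MaximalPairTo (I : TwoSidedIdeal (PathAlgebra k Q)) {x y₀ y₁ : Q}
    (m₀ : Path y₀ x) (m₁ : Path y₁ x) : Prop where
  nonzero_left : IsNonzero I m₀
  nonzero_right : IsNonzero I m₁
  cover : ∀ {z : Q} (q : Path z x), IsNonzero I q → IsTerminal q m₀ ∨ IsTerminal q m₁
  disjoint : ∀ {z : Q} (q : Path z x), IsTerminal q m₀ → IsTerminal q m₁ → q.length = 0

variable (Q) in
/-- An entry `[src, tgt]` of a right maximal sequence, with the path `seg` it stands for, and the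
path `conn` from the point `base` it was obtained from to `src`. -/
structure RSegment where
  {base src tgt : Q}
  conn : Path base src
  seg : Path src tgt

variable (Q) in
/-- An entry `[src, tgt]` of a left maximal sequence, with the path `seg` it stands for, and the
path `conn` from `tgt` to the point `base` it was obtained from. -/
structure LSegment where
  {base src tgt : Q}
  seg : Path src tgt
  conn : Path tgt base

/-- `IsRightRemainder p m o` says that `p` is an initial subpath of `m` and that `o` is the path
`m \ p` that is left when all the points of `p` are removed: it does not exist if `m = p`, and
it is `r` if `m = p α r` with an arrow `α`. -/
inductive IsRightRemainder {x : Q} :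
    {y z : Q} → Path x y → Path x z → Option (RSegment Q) → Prop
  | none {y : Q} (p : Path x y) : IsRightRemainder p p none
  | some {y s z : Q} (p : Path x y) (α : y ⟶ s) (r : Path s z) :
      IsRightRemainder p ((p.comp α.toPath).comp r) (some ⟨p.comp α.toPath, r⟩)

/-- `IsLeftRemainder p m o` says that `p` is a terminal subpath of `m` and that `o` is the path
`m \ p` that is left when all the points of `p` are removed: it does not exist if `m = p`, and
it is `r` if `m = r α p` with an arrow `α`. -/
inductive IsLeftRemainder {x : Q} :
    {y z : Q} → Path y x → Path z x → Option (LSegment Q) → Prop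
  | none {y : Q} (p : Path y x) : IsLeftRemainder p p none
  | some {y s z : Q} (p : Path y x) (α : s ⟶ y) (r : Path z s) :
      IsLeftRemainder p (r.comp (α.toPath.comp p)) (some ⟨r, α.toPath.comp p⟩)

variable (I : TwoSidedIdeal (PathAlgebra k Q))

/-- One step of a right maximal sequence, from `[x, y]` to `[x₀, y₀] = [x, y₀] \ [x, y]` and
`[x₁, y₁] = [x, y₁] \ {x}`, where `[x, y₀]`, `[x, y₁]` are the two maximal non-zero paths starting
at `x`, and `[x, y₀]` contains `[x, y]`. -/
def RightStep : Option (RSegment Q) → Option (RSegment Q) → Option (RSegment Q) → Prop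
  | none, o₀, o₁ => o₀ = none ∧ o₁ = none
  | some T, o₀, o₁ => ∃ (y₀ y₁ : Q) (m₀ : Path T.src y₀) (m₁ : Path T.src y₁),
      MaximalPairFrom I m₀ m₁ ∧ IsRightRemainder T.seg m₀ o₀ ∧
        IsRightRemainder (Path.nil : Path T.src T.src) m₁ o₁

/-- One step of a left maximal sequence. -/
def LeftStep : Option (LSegment Q) → Option (LSegment Q) → Option (LSegment Q) → Prop
  | none, o₀, o₁ => o₀ = none ∧ o₁ = none
  | some T, o₀, o₁ => ∃ (y₀ y₁ : Q) (m₀ : Path y₀ T.tgt) (m₁ : Path y₁ T.tgt),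
      MaximalPairTo I m₀ m₁ ∧ IsLeftRemainder T.seg m₀ o₀ ∧
        IsLeftRemainder (Path.nil : Path T.tgt T.tgt) m₁ o₁

/-- `X` is the right maximal sequence of the path `X 0 ![]`.  Its entry at the multi-index
`(0, i₂, …, i_{n+1})` is `X n ![i₂, …, i_{n+1}]`, and `none` stands for an entry that does not
exist. -/
def IsRightMaximalSequence (X : (n : ℕ) → (Fin n → Fin 2) → Option (RSegment Q)) : Prop :=
  ∀ (n : ℕ) (w : Fin n → Fin 2), RightStep I (X n w)
    (X (n + 1) (Fin.snoc (α := fun _ => Fin 2) w 0))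
    (X (n + 1) (Fin.snoc (α := fun _ => Fin 2) w 1))

/-- `X` is the left maximal sequence of the path `X 0 ![]`. -/
def IsLeftMaximalSequence (X : (n : ℕ) → (Fin n → Fin 2) → Option (LSegment Q)) : Prop :=
  ∀ (n : ℕ) (w : Fin n → Fin 2), LeftStep I (X n w)
    (X (n + 1) (Fin.snoc (α := fun _ => Fin 2) w 0))
    (X (n + 1) (Fin.snoc (α := fun _ => Fin 2) w 1))

end Sequences

/-! ### The explicit (co)resolutions -/

/-- The labels of the possible summands in each degree of the (co)resolution: `0, 1` in degree `0`,
then three labels, then the labels `(j, (i₂, …, i_{n+1}))` with `j` one of six. -/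
def Label : ℕ → Type
  | 0 => Fin 2
  | 1 => Fin 3
  | n + 2 => Fin 6 × (Fin n → Fin 2)

instance : (n : ℕ) → Fintype (Label n)
  | 0 => inferInstanceAs (Fintype (Fin 2))
  | 1 => inferInstanceAs (Fintype (Fin 3))
  | n + 2 => inferInstanceAs (Fintype (Fin 6 × (Fin n → Fin 2)))

/-- The index, in degree one, of the summand from which the `j`-th of the six starting points is
obtained. -/
def parent : Fin 6 → Fin 3 := ![0, 0, 2, 2, 1, 1]

section Resolutions

variable {k Q : Type u} [Field k] [Fintype Q] [Quiver.{u} Q]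
variable (I : TwoSidedIdeal (PathAlgebra k Q))

open Classical in
/-- `φ` is the linear form on `A` that takes the value `1` at the (non-zero) path `p` and `0` at
every other path. -/
def IsDualOfPath {x y : Q} (p : Path x y) (φ : BoundAlgebra I →ₗ[k] k) : Prop :=
  ∀ q : QPath Q, φ (cls I q.2.2) = if q = ⟨x, y, p⟩ then 1 else 0

/-- The paths from which the projective resolution of `I(c)` is built, where
`top I(c) = S(a 0) ⊕ S(a 1)`:
* `u i = [a_i, c]`, the two maximal non-zero paths ending at `c`;
* `(u i) (w i) = [a_i, b'_i]` and `m i = [a_i, b_i]`, the two maximal non-zero paths starting at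
  `a_i`; so `w i = [c, b'_i]`;
* `D i = [d_i, b_i] = [a_i, b_i] \ {a_i}`;
* `v i = [c, c_i]`, the two maximal non-zero paths starting at `c`, where `v i` contains `w i`;
* `X j` for `j = 0, …, 5`: the right maximal sequences of the paths `[d_00, b_00]`,
  `[d_01, b_01]`, `[d_10, b_10]`, `[d_11, b_11]`, `[c'_0, c_0]`, `[c'_1, c_1]`, where `[d_i0, b_i0]`
  and `[d_i1, b_i1]` are obtained from `[d_i, b_i]` as in a right maximal sequence, and
  `[c'_i, c_i] = [c, c_i] \ [c, b'_i]`. -/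
structure ProjResData (c : Q) (a : Fin 2 → Q) where
  u : (i : Fin 2) → Path (a i) c
  b' : Fin 2 → Q
  w : (i : Fin 2) → Path c (b' i)
  b : Fin 2 → Q
  m : (i : Fin 2) → Path (a i) (b i)
  D : Fin 2 → Option (RSegment Q)
  t : Fin 2 → Q
  v : (i : Fin 2) → Path c (t i)
  X : Fin 6 → (n : ℕ) → (Fin n → Fin 2) → Option (RSegment Q)
  pair_c : MaximalPairTo I (u 0) (u 1)
  pair_a : ∀ i, MaximalPairFrom I ((u i).comp (w i)) (m i)
  rem_a : ∀ i, IsRightRemainder (Path.nil : Path (a i) (a i)) (m i) (D i)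
  step_zero : RightStep I (D 0) (X 0 0 ![]) (X 1 0 ![])
  step_one : RightStep I (D 1) (X 2 0 ![]) (X 3 0 ![])
  pair_top : MaximalPairFrom I (v 0) (v 1)
  rem_zero : IsRightRemainder (w 0) (v 0) (X 4 0 ![])
  rem_one : IsRightRemainder (w 1) (v 1) (X 5 0 ![])
  sequence : ∀ j, IsRightMaximalSequence I (X j)

/-- The class in `A` of the connecting path of an entry, if it exists. -/
def RSegment.connCls : Option (RSegment Q) → BoundAlgebra I
  | none => 0
  | some T => cls I T.conn

/-- The class in `A` of the connecting path of an entry, if it exists. -/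
def LSegment.connCls : Option (LSegment Q) → BoundAlgebra I
  | none => 0
  | some T => cls I T.conn

namespace ProjResData

variable {I}
variable {c : Q} {a : Fin 2 → Q} (R : ProjResData I c a)

/-- The points: `a_0, a_1`; then `d_0, c, d_1`; then `x^j_{0 i₂ … i_{n+1}}`. -/
def point : (n : ℕ) → Label n → Option Q
  | 0, i => some (a i)
  | 1, i => ![(R.D 0).map RSegment.src, some c, (R.D 1).map RSegment.src] i
  | n + 2, (j, w) => (R.X j n w).map RSegment.src

/-- The labels for which the point exists. -/
abbrev Index (n : ℕ) : Type := {t : Label n // (R.point n t).isSome}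

/-- The `n`-th term `⨁ P(x)`, over the points `x` that exist. -/
abbrev Term (n : ℕ) : Type u := (t : R.Index n) → Proj I ((R.point n t.1).get t.2)

open Classical in
/-- The matrix of paths inducing the map from the term of degree `n + 1` to the term of degree `n`:
each `P(x_{w i})` is mapped to `P(x_w)` by the connecting path from `x_w` to `x_{w i}`; each of the
six starting points is mapped likewise to the one of `P(d_0), P(c), P(d_1)` it comes from;
`P(d_i)` is mapped to `P(a_i)` by the arrow from `a_i` to `d_i`, and `P(c)` is mapped to
`P(a_0) ⊕ P(a_1)` by the paths from `a_0` and `a_1` to `c`, with opposite signs. -/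
def matrix : (n : ℕ) → Label n → Label (n + 1) → BoundAlgebra I
  | 0, i, l => (![![RSegment.connCls I (R.D 0), cls I (R.u 0), 0],
      ![0, -cls I (R.u 1), RSegment.connCls I (R.D 1)]] : Fin 2 → Fin 3 → BoundAlgebra I) i l
  | 1, l, (j, w) => if l = parent j then RSegment.connCls I (R.X j 0 w) else 0
  | n + 2, (j, w), (j', w') =>
      if j = j' ∧ w = Fin.init (α := fun _ => Fin 2) w' then RSegment.connCls I (R.X j' (n + 1) w')
      else 0

/-- The maps `d n` are induced by the paths of `R.matrix n` (acting from the left), and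
`ε : P(a_0) ⊕ P(a_1) → I(c) = D(A e_c)` maps `e_{a_i}` to the linear form dual to the path
`[a_i, c]`. -/
structure IsInducedByPaths (ε : R.Term 0 →ₗ[(BoundAlgebra I)ᵐᵒᵖ] Inj I c)
    (d : ∀ n, R.Term (n + 1) →ₗ[(BoundAlgebra I)ᵐᵒᵖ] R.Term n) : Prop where
  augmentation : ∃ φ : Fin 2 → (BoundAlgebra I →ₗ[k] k), (∀ i, IsDualOfPath I (R.u i) (φ i)) ∧
    ∀ (x : R.Term 0) (y : BoundAlgebra I),
      (ε x).eval y = ∑ i : Fin 2, φ i ((x ⟨i, rfl⟩ : BoundAlgebra I) * y)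
  differential : ∀ (n : ℕ) (x : R.Term (n + 1)) (s : R.Index n),
    (d n x s : BoundAlgebra I) = ∑ t : R.Index (n + 1), R.matrix n s.1 t.1 * (x t : BoundAlgebra I)

/-- The explicit complex is a minimal projective resolution of `I(c)`. -/
def GivesResolution : Prop :=
  ∃ (ε : R.Term 0 →ₗ[(BoundAlgebra I)ᵐᵒᵖ] Inj I c)
    (d : ∀ n, R.Term (n + 1) →ₗ[(BoundAlgebra I)ᵐᵒᵖ] R.Term n),
    R.IsInducedByPaths ε d ∧ IsMinimalProjectiveResolution ε d

end ProjResData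

/-- The paths from which the injective coresolution of `P(z)` is built, where
`soc P(z) = S(e 0) ⊕ S(e 1)`; this is dual to `ProjResData`:
* `u i = [z, e_i]`, the two maximal non-zero paths starting at `z`;
* `(w i) (u i) = [b'_i, e_i]` and `m i = [b_i, e_i]`, the two maximal non-zero paths ending at
  `e_i`; so `w i = [b'_i, z]`;
* `D i = [b_i, d_i] = [b_i, e_i] \ {e_i}`, so that `d_i` is the direct predecessor of `e_i` on
  `[b_i, e_i]`;
* `v i = [t_i, z]`, the two maximal non-zero paths ending at `z`, where `v i` contains `w i`;
* `X j` for `j = 0, …, 5`: the left maximal sequences of the two paths obtained from `D 0`, the two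
  paths obtained from `D 1`, and the paths `[t_0, z] \ [b'_0, z]` and `[t_1, z] \ [b'_1, z]`. -/
structure InjResData (z : Q) (e : Fin 2 → Q) where
  u : (i : Fin 2) → Path z (e i)
  b' : Fin 2 → Q
  w : (i : Fin 2) → Path (b' i) z
  b : Fin 2 → Q
  m : (i : Fin 2) → Path (b i) (e i)
  D : Fin 2 → Option (LSegment Q)
  t : Fin 2 → Q
  v : (i : Fin 2) → Path (t i) z
  X : Fin 6 → (n : ℕ) → (Fin n → Fin 2) → Option (LSegment Q)
  pair_z : MaximalPairFrom I (u 0) (u 1)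
  pair_e : ∀ i, MaximalPairTo I ((w i).comp (u i)) (m i)
  rem_e : ∀ i, IsLeftRemainder (Path.nil : Path (e i) (e i)) (m i) (D i)
  step_zero : LeftStep I (D 0) (X 0 0 ![]) (X 1 0 ![])
  step_one : LeftStep I (D 1) (X 2 0 ![]) (X 3 0 ![])
  pair_soc : MaximalPairTo I (v 0) (v 1)
  rem_zero : IsLeftRemainder (w 0) (v 0) (X 4 0 ![])
  rem_one : IsLeftRemainder (w 1) (v 1) (X 5 0 ![])
  sequence : ∀ j, IsLeftMaximalSequence I (X j)

namespace InjResData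

variable {I}
variable {z : Q} {e : Fin 2 → Q} (R : InjResData I z e)

/-- The points: `e_0, e_1`; then `d_0, z, d_1`; then `s^j_{0 i₂ … i_{n+1}}`. -/
def point : (n : ℕ) → Label n → Option Q
  | 0, i => some (e i)
  | 1, i => ![(R.D 0).map LSegment.tgt, some z, (R.D 1).map LSegment.tgt] i
  | n + 2, (j, w) => (R.X j n w).map LSegment.tgt

/-- The labels for which the point exists. -/
abbrev Index (n : ℕ) : Type := {t : Label n // (R.point n t).isSome}

/-- The `n`-th term `⨁ I(s)`, over the points `s` that exist. -/
abbrev Term (n : ℕ) : Type u := (t : R.Index n) → Inj I ((R.point n t.1).get t.2)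

open Classical in
/-- The matrix of paths inducing the map from the term of degree `n` to the term of degree `n + 1`:
each `I(s_w)` is mapped to `I(s_{w i})` by the connecting path from `s_{w i}` to `s_w`, and so on,
dually to the projective case. -/
def matrix : (n : ℕ) → Label n → Label (n + 1) → BoundAlgebra I
  | 0, i, l => (![![LSegment.connCls I (R.D 0), cls I (R.u 0), 0],
      ![0, -cls I (R.u 1), LSegment.connCls I (R.D 1)]] : Fin 2 → Fin 3 → BoundAlgebra I) i l
  | 1, l, (j, w) => if l = parent j then LSegment.connCls I (R.X j 0 w) else 0
  | n + 2, (j, w), (j', w') =>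
      if j = j' ∧ w = Fin.init (α := fun _ => Fin 2) w' then LSegment.connCls I (R.X j' (n + 1) w')
      else 0

/-- The maps `d n` are induced by the paths of `R.matrix n`, where a path `p` from `s'` to `s`
induces the map `I(s) = D(A e_s) → D(A e_{s'}) = I(s')`, `f ↦ (y ↦ f (y p))`; and
`η : P(z) → I(e_0) ⊕ I(e_1)` maps `x ∈ e_z A` to the linear forms `y ↦ φ_i (x y)` on `A e_{e_i}`,
where `φ_i` is dual to the path `[z, e_i]`. -/
structure IsInducedByPaths (η : Proj I z →ₗ[(BoundAlgebra I)ᵐᵒᵖ] R.Term 0)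
    (d : ∀ n, R.Term n →ₗ[(BoundAlgebra I)ᵐᵒᵖ] R.Term (n + 1)) : Prop where
  coaugmentation : ∃ φ : Fin 2 → (BoundAlgebra I →ₗ[k] k), (∀ i, IsDualOfPath I (R.u i) (φ i)) ∧
    ∀ (x : Proj I z) (i : Fin 2), ∀ y ∈ LeftProj I (e i),
      (η x ⟨i, rfl⟩).eval y = φ i ((x : BoundAlgebra I) * y)
  differential : ∀ (n : ℕ) (f : R.Term n) (t : R.Index (n + 1)),
    ∀ y ∈ LeftProj I ((R.point (n + 1) t.1).get t.2),
      (d n f t).eval y = ∑ s : R.Index n, (f s).eval (y * R.matrix n s.1 t.1)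

/-- The explicit complex is a minimal injective coresolution of `P(z)`. -/
def GivesCoresolution : Prop :=
  ∃ (η : Proj I z →ₗ[(BoundAlgebra I)ᵐᵒᵖ] R.Term 0)
    (d : ∀ n, R.Term n →ₗ[(BoundAlgebra I)ᵐᵒᵖ] R.Term (n + 1)),
    R.IsInducedByPaths η d ∧ IsMinimalInjectiveCoresolution η d

end InjResData

/-- The simple module `S(x) = top P(x)`. -/
abbrev Simp (x : Q) : Type u := ModTop (BoundAlgebra I)ᵐᵒᵖ (Proj I x)

end Resolutions

end StringAlgebra

end

open StringAlgebra

/-! Since `I` is generated by paths, the classes of the non-zero paths form a basis of `A = kQ / I`,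
and multiplication by a path sends each basis element to a basis element or to zero. Exactness thus
becomes a question about supports.

Let `m = c g` be one of the two maximal non-zero paths from some point, with `c` non-stationary. A
path `q` has `c q` non-zero exactly if `q` is an initial subpath of `g` (`PathSys.MaxPair.good`), so
an element is annihilated by `c` iff it has no coefficients at initial subpaths of `g`
(`PathAlg.mul_eq_zero_iff`). Any other non-zero path from the start of `g` lies in one of the two
maximal paths there and begins with the connecting path of exactly one right successor of `g`. Hence
the annihilator of `c` is the direct sum of the right ideals generated by the two connecting paths
(`PathAlg.exact_step`, `PathAlg.indep_step`), which is the exactness of the tail of the resolution.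
Moreover `c A` is uniserial, because its submodules are generated by the `c q` with `q` initial in
`g` (`isUniserialOrZero_of_path`).

In low degrees, an element of `P(a_0) ⊕ P(a_1)` dies in `I(c)` iff it vanishes on the proper initial
subpaths of `[a_i, c]` and its coefficients at `[a_0, c]` and `[a_1, c]` add up to zero
(`ResData.exact_pairing`). An element of `P(c)` annihilated by both paths vanishes on the initial
subpaths of `[c, b'_0]` and `[c, b'_1]`, and the remainders `[c'_i, c_i]` generate those elements
(`ResData.locKer_iff`). All matrix entries are non-stationary paths up to sign, or zero, so images
lie in the radical, which gives minimality.

For the coresolution, the axioms of `PathSys` and `PathAlg` are self-dual, so the same combinatorics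
holds for the opposite system, and vector space duality turns it into exactness between sums of
modules `I(x)` (`injMap_exact`, `coformMap_exact`).

For the lemma, uniqueness of covers and envelopes identifies the second syzygy or cosyzygy with the
image of the differential `d 1`, a sum of at most six uniserials. If one of the two maximal paths is
stationary, a shorter complex yields at most four (`ResData₁`). Finally, indecomposable projectives
and injectives are the `P(x)` and `I(x)`, and a two-point top or socle forces both maximal paths to
be non-stationary (`MaximalPairTo.of_top`, `MaximalPairFrom.of_soc`). -/

noncomputable section

namespace StringAlgebra

set_option linter.unusedSectionVars false

/-! ### Path systems -/

/-- The formal properties of the paths of a quiver with a set of non-zero paths.  `C p q r` means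
that `r` is the concatenation of `p` and `q`.  This notion is self-dual, see `PathSys.op`. -/
structure PathSys (Q B : Type u) where
  s : B → Q
  t : B → Q
  len : B → ℕ
  e : Q → B
  C : B → B → B → Prop
  nz : B → Prop
  C_left : ∀ {p q q' r}, C p q r → C p q' r → q = q'
  C_right : ∀ {p p' q r}, C p q r → C p' q r → p = p'
  C_fun : ∀ {p q r r'}, C p q r → C p q r' → r = r'
  C_s : ∀ {p q r}, C p q r → s r = s p
  C_t : ∀ {p q r}, C p q r → t r = t q
  C_mid : ∀ {p q r}, C p q r → t p = s q
  C_len : ∀ {p q r}, C p q r → len r = len p + len q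
  C_assoc : ∀ {p q r a v}, C p q r → C r a v → ∃ w, C q a w ∧ C p w v
  C_assoc' : ∀ {p q w a v}, C q a w → C p w v → ∃ r, C p q r ∧ C r a v
  C_prefix : ∀ {p q p' q' m}, C p q m → C p' q' m → len p ≤ len p' → ∃ r, C p r p' ∧ C r q' q
  e_C : ∀ p, C (e (s p)) p p
  C_e : ∀ p, C p (e (t p)) p
  s_e : ∀ x, s (e x) = x
  t_e : ∀ x, t (e x) = x
  len_e : ∀ x, len (e x) = 0
  eq_e : ∀ {p}, len p = 0 → p = e (s p)
  nz_left : ∀ {p q r}, C p q r → nz r → nz p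
  nz_right : ∀ {p q r}, C p q r → nz r → nz q

namespace PathSys

variable {Q B : Type u} (S : PathSys Q B)

theorem eq_e' {p : B} (h : S.len p = 0) : p = S.e (S.t p) := by
  have h1 := S.eq_e h
  have h2 : S.t p = S.s p := by
    conv_lhs => rw [h1]
    exact S.t_e _
  rw [h2]; exact h1

/-- The opposite path system. -/
def op : PathSys Q B where
  s := S.t
  t := S.s
  len := S.len
  e := S.e
  C p q r := S.C q p r
  nz := S.nz
  C_left := S.C_right
  C_right := S.C_left
  C_fun := S.C_fun
  C_s := S.C_t
  C_t := S.C_s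
  C_mid h := (S.C_mid h).symm
  C_len h := (S.C_len h).trans (Nat.add_comm _ _)
  C_assoc h h' := (S.C_assoc' h h')
  C_assoc' h h' := (S.C_assoc h h')
  C_prefix {p q p' q' m} h h' hl := by
    have h1 := S.C_len h
    have h2 := S.C_len h'
    obtain ⟨r, hr, hr'⟩ := S.C_prefix h' h (by omega)
    exact ⟨r, hr', hr⟩
  e_C := S.C_e
  C_e := S.e_C
  s_e := S.t_e
  t_e := S.s_e
  len_e := S.len_e
  eq_e h := S.eq_e' h
  nz_left := S.nz_right
  nz_right := S.nz_left

/-- `p` is an initial subpath of `m`. -/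
def Init (p m : B) : Prop := ∃ r, S.C p r m

variable {S}

theorem Init.refl (p : B) : S.Init p p := ⟨_, S.C_e p⟩

theorem Init.trans {p q r : B} (h : S.Init p q) (h' : S.Init q r) : S.Init p r := by
  obtain ⟨a, ha⟩ := h
  obtain ⟨b, hb⟩ := h'
  obtain ⟨w, -, hw⟩ := S.C_assoc ha hb
  exact ⟨w, hw⟩

theorem Init.len_le {p q : B} (h : S.Init p q) : S.len p ≤ S.len q := by
  obtain ⟨a, ha⟩ := h
  have := S.C_len ha
  omega

theorem Init.s_eq {p q : B} (h : S.Init p q) : S.s q = S.s p := by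
  obtain ⟨a, ha⟩ := h
  exact S.C_s ha

theorem Init.nz {p q : B} (h : S.Init p q) (hq : S.nz q) : S.nz p := by
  obtain ⟨a, ha⟩ := h
  exact S.nz_left ha hq

theorem Init.total {p q m : B} (h : S.Init p m) (h' : S.Init q m) (hl : S.len p ≤ S.len q) :
    S.Init p q := by
  obtain ⟨a, ha⟩ := h
  obtain ⟨b, hb⟩ := h'
  obtain ⟨r, hr, -⟩ := S.C_prefix ha hb hl
  exact ⟨r, hr⟩

theorem init_e {x : Q} {q : B} (h : S.Init q (S.e x)) : q = S.e x := by
  have h1 := h.len_le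
  rw [S.len_e] at h1
  have h2 := h.s_eq
  rw [S.s_e] at h2
  rw [h2]
  exact S.eq_e (by omega)

theorem e_init (q : B) : S.Init (S.e (S.s q)) q := ⟨_, S.e_C q⟩

variable (S)

/-- The two maximal non-zero paths with a given source. -/
structure MaxPair (m₀ m₁ : B) : Prop where
  nz_left : S.nz m₀
  nz_right : S.nz m₁
  src : S.s m₁ = S.s m₀
  cover : ∀ q, S.nz q → S.s q = S.s m₀ → S.Init q m₀ ∨ S.Init q m₁
  disjoint : ∀ q, S.Init q m₀ → S.Init q m₁ → S.len q = 0

/-- The remainder of `m` after an initial subpath `p`: its connecting path and the path left. -/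
def Rem (p m : B) : Option (B × B) → Prop
  | none => m = p
  | some T => (∃ α, S.len α = 1 ∧ S.C p α T.1) ∧ S.C T.1 T.2 m

/-- One step of a maximal sequence. -/
def Step : Option (B × B) → Option (B × B) → Option (B × B) → Prop
  | none, o₀, o₁ => o₀ = none ∧ o₁ = none
  | some T, o₀, o₁ => ∃ m₀ m₁, S.MaxPair m₀ m₁ ∧ S.s m₀ = S.s T.2 ∧ S.Rem T.2 m₀ o₀ ∧
      S.Rem (S.e (S.s T.2)) m₁ o₁

/-- The second path is the longest path that the first one does not annihilate, and all other such
paths are contained in it. -/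
structure Good (c g : B) : Prop where
  comp : ∃ m, S.C c g m ∧ S.nz m
  init : ∀ q r, S.C c q r → S.nz r → S.Init q g

/-- The connecting path of `o` is non-stationary and contained in `m`. -/
def Branch (o : Option (B × B)) (m : B) : Prop :=
  ∀ T ∈ o, S.len T.1 ≠ 0 ∧ S.C T.1 T.2 m

/-- `q` starts with the connecting path of `o`. -/
def Covers (o : Option (B × B)) (q : B) : Prop := ∃ T ∈ o, S.Init T.1 q

/-- The starting point of the path in `o`. -/
def pt (o : Option (B × B)) : Option Q := o.map fun T => S.s T.2

variable {S}

theorem MaxPair.symm {m₀ m₁ : B} (h : S.MaxPair m₀ m₁) : S.MaxPair m₁ m₀ :=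
  ⟨h.nz_right, h.nz_left, h.src.symm, fun q hq hs => (h.cover q hq (hs.trans h.src)).symm,
    fun q h0 h1 => h.disjoint q h1 h0⟩

theorem Rem.branch {p m : B} {o : Option (B × B)} (h : S.Rem p m o) : S.Branch o m := by
  rintro T hT
  cases hT
  obtain ⟨⟨α, hα, h1⟩, h2⟩ := h
  refine ⟨?_, h2⟩
  have := S.C_len h1
  omega

theorem Good.nz {c g : B} (h : S.Good c g) : S.nz g := by
  obtain ⟨m, hm, hnz⟩ := h.comp
  exact S.nz_right hm hnz

/-- A non-zero path through `c` cannot lie in `m₁`, since `c` would then be a non-stationary path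
common to both maximal paths. So it lies in `m₀`, and cancelling `c` leaves an initial subpath of
`g`. -/
theorem MaxPair.good {m₀ m₁ c g : B} (h : S.MaxPair m₀ m₁) (hc : S.C c g m₀) (hl : S.len c ≠ 0) :
    S.Good c g := by
  refine ⟨⟨m₀, hc, h.nz_left⟩, fun q r hr hnz => ?_⟩
  have hs : S.s r = S.s m₀ := by rw [S.C_s hr, S.C_s hc]
  rcases h.cover r hnz hs with h0 | h1
  · obtain ⟨r', hr'⟩ := h0
    obtain ⟨w, hw, hw'⟩ := S.C_assoc hr hr'
    rw [S.C_left hc hw']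
    exact ⟨_, hw⟩
  · exact absurd (h.disjoint c ⟨_, hc⟩ (Init.trans ⟨_, hr⟩ h1)) hl

theorem MaxPair.good_of_branch {m₀ m₁ : B} {o : Option (B × B)} (h : S.MaxPair m₀ m₁)
    (ho : S.Branch o m₀) : ∀ T ∈ o, S.Good T.1 T.2 :=
  fun T hT => h.good (ho T hT).2 (ho T hT).1

/-- Nothing is required of `T`: goodness of a successor comes only from the pair of maximal paths
that produced it. -/
theorem Step.good {T o₀ o₁ : Option (B × B)} (h : S.Step T o₀ o₁) :
    (∀ T ∈ o₀, S.Good T.1 T.2) ∧ (∀ T ∈ o₁, S.Good T.1 T.2) := by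
  cases T with
  | none => obtain ⟨rfl, rfl⟩ := h; simp
  | some T =>
    obtain ⟨m₀, m₁, hm, -, h0, h1⟩ := h
    exact ⟨hm.good_of_branch h0.branch, hm.symm.good_of_branch h1.branch⟩

/-- Whichever maximal path contains `q` also contains both connecting paths, and one of these would
then be common to the two maximal paths. -/
theorem MaxPair.not_covers {m₀ m₁ q : B} {o₀ o₁ : Option (B × B)} (h : S.MaxPair m₀ m₁)
    (h₀ : S.Branch o₀ m₀) (h₁ : S.Branch o₁ m₁) (hq : S.nz q) (hc : S.Covers o₀ q) :
    ¬ S.Covers o₁ q := by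
  rintro ⟨T', hT', hi'⟩
  obtain ⟨T, hT, hi⟩ := hc
  have hT0 := h₀ T hT
  have hT1 := h₁ T' hT'
  have hs : S.s q = S.s m₀ := by rw [hi.s_eq, S.C_s hT0.2]
  rcases h.cover q hq hs with h0 | h1
  · exact hT1.1 (h.disjoint _ (hi'.trans h0) ⟨_, hT1.2⟩)
  · exact hT0.1 (h.disjoint _ ⟨_, hT0.2⟩ (hi.trans h1))

/-- Initial subpaths of `m` are ordered by length, and the connecting path is only one arrow longer
than `p`, so nothing lies strictly between them. -/
theorem Rem.init_or_covers {p m q : B} {o : Option (B × B)} (h : S.Rem p m o) (hq : S.Init q m) :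
    S.Init q p ∨ S.Covers o q := by
  cases o with
  | none => cases h; exact Or.inl hq
  | some T =>
    obtain ⟨⟨α, hα, h1⟩, h2⟩ := h
    have := S.C_len h1
    have h3 : S.Init p m := Init.trans ⟨_, h1⟩ ⟨_, h2⟩
    rcases le_or_gt (S.len q) (S.len p) with hl | hl
    · exact Or.inl (hq.total h3 hl)
    · exact Or.inr ⟨T, rfl, Init.total ⟨_, h2⟩ hq (by omega)⟩

theorem Rem.init {p m : B} {o : Option (B × B)} (h : S.Rem p m o) : S.Init p m := by
  cases o with
  | none => cases h; exact Init.refl _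
  | some T =>
    obtain ⟨⟨α, hα, h1⟩, h2⟩ := h
    exact Init.trans ⟨_, h1⟩ ⟨_, h2⟩

theorem Rem.not_covers {p m q : B} {o : Option (B × B)} (h : S.Rem p m o) (hq : S.Init q p) :
    ¬ S.Covers o q := by
  rintro ⟨T, hT, hi⟩
  cases hT
  obtain ⟨⟨α, hα, h1⟩, h2⟩ := h
  have := S.C_len h1
  have := hi.len_le
  have := hq.len_le
  omega

theorem MaxPair.init_not_covers {m₀ m₁ q : B} {o : Option (B × B)} (h : S.MaxPair m₀ m₁)
    (h₁ : S.Branch o m₁) (hq : S.Init q m₀) : ¬ S.Covers o q := by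
  rintro ⟨T, hT, hi⟩
  exact (h₁ T hT).1 (h.disjoint _ (hi.trans hq) ⟨_, (h₁ T hT).2⟩)

end PathSys

/-! ### Algebras with a basis of paths -/

/-- An algebra `V` with the non-zero paths of a path system as a basis. -/
structure PathAlg {Q B : Type u} (S : PathSys Q B) (k V : Type u) [Field k] [AddCommGroup V]
    [Module k V] where
  cf : V →ₗ[k] (B → k)
  mul : V →ₗ[k] V →ₗ[k] V
  cl : B → V
  cf_inj : ∀ {v v'}, (∀ b, S.nz b → cf v b = cf v' b) → v = v'
  cf_surj : ∀ F : B → k, ∃ v, ∀ b, S.nz b → cf v b = F b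
  mul_assoc : ∀ a b c, mul (mul a b) c = mul a (mul b c)
  cf_cl_self : ∀ {p}, S.nz p → cf (cl p) p = 1
  cf_cl_ne : ∀ {p b}, b ≠ p → cf (cl p) b = 0
  cf_mul : ∀ {p q r} (v : V), S.C p q r → S.nz r → cf (mul (cl p) v) r = cf v q
  cf_mul_zero : ∀ {p r} (v : V), ¬ S.Init p r → cf (mul (cl p) v) r = 0
  cf_mul' : ∀ {p q r} (v : V), S.C p q r → S.nz r → cf (mul v (cl q)) r = cf v p
  cf_mul_zero' : ∀ {p r} (v : V), ¬ S.op.Init p r → cf (mul v (cl p)) r = 0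

namespace PathAlg

open PathSys

variable {Q B k V : Type u} [Field k] [AddCommGroup V] [Module k V] {S : PathSys Q B}

/-- The opposite algebra. -/
def op (P : PathAlg S k V) : PathAlg S.op k V where
  cf := P.cf
  mul := P.mul.flip
  cl := P.cl
  cf_inj := P.cf_inj
  cf_surj := P.cf_surj
  mul_assoc a b c := by simp [P.mul_assoc]
  cf_cl_self := P.cf_cl_self
  cf_cl_ne := P.cf_cl_ne
  cf_mul v h h' := P.cf_mul' v h h'
  cf_mul_zero v h := P.cf_mul_zero' v h
  cf_mul' v h h' := P.cf_mul v h h'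
  cf_mul_zero' v h := P.cf_mul_zero v h

variable (P : PathAlg S k V)

/-- The span of the paths with source `x`. -/
def E (o : Option Q) : Submodule k V where
  carrier := {v | ∀ b, S.nz b → o ≠ some (S.s b) → P.cf v b = 0}
  add_mem' {v w} hv hw b hb hx := by simp [hv b hb hx, hw b hb hx]
  zero_mem' _ _ _ := by simp
  smul_mem' r v hv b hb hx := by simp [hv b hb hx]

theorem E_none {v : V} (h : v ∈ P.E none) : v = 0 :=
  P.cf_inj fun b hb => by rw [h b hb (by simp)]; simp

/-- The connecting path of an entry, as an element of the algebra. -/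
def co (o : Option (B × B)) : V := o.elim 0 fun T => P.cl T.1

@[simp] theorem co_none : P.co none = 0 := rfl
@[simp] theorem co_some (T : B × B) : P.co (some T) = P.cl T.1 := rfl

theorem cl_mem_E {p : B} {o : Option Q} (h : o = some (S.s p)) : P.cl p ∈ P.E o := fun b _ hx =>
  P.cf_cl_ne (by rintro rfl; exact hx h)

theorem cl_mul_mem_E {p : B} (v : V) : P.mul (P.cl p) v ∈ P.E (some (S.s p)) := fun _ _ hx =>
  P.cf_mul_zero v fun h => hx (congrArg some h.s_eq.symm)

theorem cf_co_zero {o : Option (B × B)} {q : B} (v : V) (h : ¬ S.Covers o q) :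
    P.cf (P.mul (P.co o) v) q = 0 := by
  cases o with
  | none => simp
  | some T => exact P.cf_mul_zero v fun h' => h ⟨T, rfl, h'⟩

/-- The two products have disjoint supports, because no non-zero path begins with both connecting
paths; hence nothing cancels. -/
theorem indep {m₀ m₁ : B} {o₀ o₁ : Option (B × B)} (h : S.MaxPair m₀ m₁)
    (h₀ : S.Branch o₀ m₀) (h₁ : S.Branch o₁ m₁) {y₀ y₁ : V}
    (hy : P.mul (P.co o₀) y₀ + P.mul (P.co o₁) y₁ = 0) :
    P.mul (P.co o₀) y₀ = 0 ∧ P.mul (P.co o₁) y₁ = 0 := by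
  have key : P.mul (P.co o₀) y₀ = 0 := by
    refine P.cf_inj fun q hq => ?_
    by_cases hc : S.Covers o₀ q
    · have h1 := congrArg (fun v => P.cf v q) hy
      simp only [map_add, Pi.add_apply, P.cf_co_zero y₁ (h.not_covers h₀ h₁ hq hc)] at h1
      simpa using h1
    · rw [P.cf_co_zero _ hc]; simp
  rw [key, zero_add] at hy
  exact ⟨key, hy⟩

/-- Division by the connecting path of `o`. -/
theorem exists_div (o : Option (B × B)) (hg : ∀ T ∈ o, S.t T.1 = S.s T.2) (x : V) :
    ∃ y ∈ P.E (S.pt o), ∀ q, S.nz q → S.Covers o q → P.cf (P.mul (P.co o) y) q = P.cf x q := by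
  classical
  cases o with
  | none => exact ⟨0, Submodule.zero_mem _, fun q _ h => by obtain ⟨T, hT, -⟩ := h; cases hT⟩
  | some T =>
    -- The coefficient of `y` at `r` is that of `x` at the path obtained by putting the connecting
    -- path in front of `r`. The default zero, used when there is no such non-zero path, keeps `y`
    -- supported at the right source.
    obtain ⟨y, hy⟩ := P.cf_surj fun r => if h : ∃ q, S.C T.1 r q ∧ S.nz q
      then P.cf x h.choose else 0
    refine ⟨y, fun b hb hx => ?_, fun q hq hc => ?_⟩
    · rw [hy b hb, dif_neg]
      rintro ⟨q, hq, -⟩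
      exact hx (by simp [pt, ← hg T rfl, S.C_mid hq])
    · obtain ⟨_, ⟨⟩, r, hr⟩ := hc
      have hex : ∃ q, S.C T.1 r q ∧ S.nz q := ⟨q, hr, hq⟩
      rw [co_some, P.cf_mul y hr hq, hy r (S.nz_right hr hq), dif_pos hex,
        S.C_fun hex.choose_spec.1 hr]

/-- A non-zero path from the common source lies in `m₀` or `m₁`, and there it is either initial in
`p₀` or `p₁`, or begins with the connecting path of `o₀` or `o₁`. Vanishing on the former leaves
exactly what is divisible by the connecting paths. -/
theorem exact_pair {m₀ m₁ p₀ p₁ : B} {o₀ o₁ : Option (B × B)} (h : S.MaxPair m₀ m₁)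
    (h₀ : S.Rem p₀ m₀ o₀) (h₁ : S.Rem p₁ m₁ o₁) {x : V} (hx : x ∈ P.E (some (S.s m₀))) :
    (∀ q, S.nz q → S.Init q p₀ ∨ S.Init q p₁ → P.cf x q = 0) ↔
      ∃ y₀ ∈ P.E (S.pt o₀), ∃ y₁ ∈ P.E (S.pt o₁),
        P.mul (P.co o₀) y₀ + P.mul (P.co o₁) y₁ = x := by
  constructor
  · intro hv
    obtain ⟨y₀, hy₀, hy₀'⟩ := P.exists_div o₀ (fun T hT => S.C_mid (h₀.branch T hT).2) x
    obtain ⟨y₁, hy₁, hy₁'⟩ := P.exists_div o₁ (fun T hT => S.C_mid (h₁.branch T hT).2) x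
    refine ⟨y₀, hy₀, y₁, hy₁, P.cf_inj fun q hq => ?_⟩
    rw [map_add, Pi.add_apply]
    by_cases hc₀ : S.Covers o₀ q
    · rw [hy₀' q hq hc₀, P.cf_co_zero y₁ (h.not_covers h₀.branch h₁.branch hq hc₀), add_zero]
    by_cases hc₁ : S.Covers o₁ q
    · rw [hy₁' q hq hc₁, P.cf_co_zero y₀ hc₀, zero_add]
    rw [P.cf_co_zero y₀ hc₀, P.cf_co_zero y₁ hc₁, add_zero]
    by_cases hs : S.s q = S.s m₀
    · refine (hv q hq ?_).symm
      rcases h.cover q hq hs with h' | h'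
      · exact Or.inl ((h₀.init_or_covers h').resolve_right hc₀)
      · exact Or.inr ((h₁.init_or_covers h').resolve_right hc₁)
    · exact (hx q hq fun h => hs (by simpa using h.symm)).symm
  · rintro ⟨y₀, -, y₁, -, rfl⟩ q hq hi
    rw [map_add, Pi.add_apply]
    rcases hi with hi | hi
    · rw [P.cf_co_zero y₀ (h₀.not_covers hi),
        P.cf_co_zero y₁ (h.init_not_covers h₁.branch (hi.trans h₀.init)), add_zero]
    · rw [P.cf_co_zero y₁ (h₁.not_covers hi),
        P.cf_co_zero y₀ (h.symm.init_not_covers h₀.branch (hi.trans h₁.init)), add_zero]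

/-- Left multiplication by `c` carries the basis paths `q` with `c q` non-zero injectively to basis
paths and kills all others; goodness identifies the former as the initial subpaths of `g`. -/
theorem mul_eq_zero_iff {c g : B} (h : S.Good c g) {x : V} :
    P.mul (P.cl c) x = 0 ↔ ∀ q, S.Init q g → P.cf x q = 0 := by
  constructor
  · rintro hx q ⟨r, hr⟩
    obtain ⟨m, hm, hnz⟩ := h.comp
    obtain ⟨r', h1, h2⟩ := S.C_assoc' hr hm
    rw [← P.cf_mul x h1 (S.nz_left h2 hnz), hx]
    simp
  · refine fun hx => P.cf_inj fun r hr => ?_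
    by_cases hi : S.Init c r
    · obtain ⟨q, hq⟩ := hi
      rw [P.cf_mul x hq hr, hx q (h.init q r hq hr)]
      simp
    · rw [P.cf_mul_zero x hi]; simp

/-- The local exactness behind the whole tail of the resolution: the annihilator of a connecting
path is generated by the connecting paths of the two successors. -/
theorem exact_step {T o₀ o₁ : Option (B × B)} (h : S.Step T o₀ o₁)
    (hT : ∀ T' ∈ T, S.Good T'.1 T'.2) {x : V} (hx : x ∈ P.E (S.pt T)) :
    P.mul (P.co T) x = 0 ↔ ∃ y₀ ∈ P.E (S.pt o₀), ∃ y₁ ∈ P.E (S.pt o₁),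
        P.mul (P.co o₀) y₀ + P.mul (P.co o₁) y₁ = x := by
  cases T with
  | none =>
    obtain ⟨rfl, rfl⟩ := h
    have := P.E_none hx
    subst this
    simp only [map_zero, true_iff]
    exact ⟨0, Submodule.zero_mem _, 0, Submodule.zero_mem _, by simp⟩
  | some T =>
    obtain ⟨m₀, m₁, hm, hs, h0, h1⟩ := h
    have hg := hT T rfl
    rw [co_some, P.mul_eq_zero_iff hg, ← P.exact_pair hm h0 h1 (by rw [hs]; exact hx)]
    constructor
    · rintro hx q hq (hi | hi)
      · exact hx q hi
      -- The second maximal path only contributes the condition at the stationary path, which is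
      -- already initial in the segment.
      · rw [init_e hi]; exact hx _ (e_init _)
    · exact fun hx q hi => hx q (hi.nz (hg.nz)) (Or.inl hi)

theorem indep_step {T o₀ o₁ : Option (B × B)} (h : S.Step T o₀ o₁) {y₀ y₁ : V}
    (hy : P.mul (P.co o₀) y₀ + P.mul (P.co o₁) y₁ = 0) :
    P.mul (P.co o₀) y₀ = 0 ∧ P.mul (P.co o₁) y₁ = 0 := by
  cases T with
  | none => obtain ⟨rfl, rfl⟩ := h; simp
  | some T =>
    obtain ⟨m₀, m₁, hm, hs, h0, h1⟩ := h
    exact P.indep hm h0.branch h1.branch hy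

/-- `v` is zero or, up to sign, a non-stationary path with source `o`. -/
def Entry (o : Option Q) (v : V) : Prop :=
  v = 0 ∨ ∃ c, S.len c ≠ 0 ∧ o = some (S.s c) ∧ (v = P.cl c ∨ v = -P.cl c)

theorem Entry.mul_mem {o : Option Q} {v : V} (h : P.Entry o v) (x : V) : P.mul v x ∈ P.E o := by
  rcases h with rfl | ⟨c, -, rfl, rfl | rfl⟩
  · simp
  · exact P.cl_mul_mem_E x
  · rw [map_neg, LinearMap.neg_apply]
    exact Submodule.neg_mem _ (P.cl_mul_mem_E x)

theorem entry_rem {p m : B} {o : Option (B × B)} (h : S.Rem p m o) :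
    P.Entry (some (S.s p)) (P.co o) := by
  cases o with
  | none => exact Or.inl rfl
  | some T =>
    obtain ⟨⟨α, hα, h1⟩, -⟩ := h
    have := S.C_len h1
    exact Or.inr ⟨T.1, by omega, congrArg some (S.C_s h1).symm, Or.inl rfl⟩

theorem entry_step {T o₀ o₁ : Option (B × B)} (h : S.Step T o₀ o₁) :
    P.Entry (S.pt T) (P.co o₀) ∧ P.Entry (S.pt T) (P.co o₁) := by
  cases T with
  | none => obtain ⟨rfl, rfl⟩ := h; exact ⟨Or.inl rfl, Or.inl rfl⟩
  | some T =>
    obtain ⟨m₀, m₁, -, -, h0, h1⟩ := h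
    have := P.entry_rem h1
    rw [S.s_e] at this
    exact ⟨P.entry_rem h0, this⟩

end PathAlg

section AbstractComplex

open PathSys

/-! ### The abstract complex -/

/-- The paths from which the resolution is built, in a path system. -/
structure ResData {Q B : Type u} (S : PathSys Q B) where
  u : Fin 2 → B
  w : Fin 2 → B
  uw : Fin 2 → B
  m : Fin 2 → B
  v : Fin 2 → B
  D : Fin 2 → Option (B × B)
  X : Fin 6 → (n : ℕ) → (Fin n → Fin 2) → Option (B × B)
  pair_c : S.op.MaxPair (u 0) (u 1)
  len_u : ∀ i, S.len (u i) ≠ 0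
  comp : ∀ i, S.C (u i) (w i) (uw i)
  pair_a : ∀ i, S.MaxPair (uw i) (m i)
  rem_a : ∀ i, S.Rem (S.e (S.s (m i))) (m i) (D i)
  step_zero : S.Step (D 0) (X 0 0 ![]) (X 1 0 ![])
  step_one : S.Step (D 1) (X 2 0 ![]) (X 3 0 ![])
  pair_top : S.MaxPair (v 0) (v 1)
  rem_zero : S.Rem (w 0) (v 0) (X 4 0 ![])
  rem_one : S.Rem (w 1) (v 1) (X 5 0 ![])
  sequence : ∀ j (n : ℕ) (w : Fin n → Fin 2), S.Step (X j n w)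
    (X j (n + 1) (Fin.snoc (α := fun _ => Fin 2) w 0))
    (X j (n + 1) (Fin.snoc (α := fun _ => Fin 2) w 1))

/-- The two labels obtained from a label of positive degree. -/
def child : (n : ℕ) → Label (n + 1) → Fin 2 → Label (n + 2)
  | 0, l, i => ((![![0, 1], ![4, 5], ![2, 3]] : Fin 3 → Fin 2 → Fin 6) l i, ![])
  | _ + 1, (j, w), i => (j, Fin.snoc (α := fun _ => Fin 2) w i)

/-- Each label of degree at least two has exactly one parent. Sums and choices over such labels can
therefore be made parent by parent. -/
theorem child_bijective (n : ℕ) :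
    Function.Bijective fun p : Label (n + 1) × Fin 2 => child n p.1 p.2 := by
  cases n with
  | zero =>
    have h : Function.Bijective fun p : Fin 3 × Fin 2 =>
        (![![0, 1], ![4, 5], ![2, 3]] : Fin 3 → Fin 2 → Fin 6) p.1 p.2 := by decide
    constructor
    · intro p q hpq
      exact h.1 (congrArg Prod.fst hpq :)
    · rintro ⟨j, w⟩
      obtain ⟨p, hp⟩ := h.2 j
      exact ⟨p, Prod.ext hp (Subsingleton.elim _ _)⟩
  | succ n =>
    constructor
    · rintro ⟨⟨j, w⟩, i⟩ ⟨⟨j', w'⟩, i'⟩ h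
      obtain ⟨rfl, h2⟩ := Prod.mk.inj h
      have h3 := congrArg Fin.init h2
      have h4 := congrFun h2 (Fin.last n)
      simp only [Fin.init_snoc, Fin.snoc_last] at h3 h4
      subst h3 h4
      rfl
    · rintro ⟨j, w⟩
      exact ⟨((j, Fin.init w), w (Fin.last n)), Prod.ext rfl (Fin.snoc_init_self w)⟩

theorem sum_label {M : Type*} [AddCommMonoid M] (n : ℕ) (f : Label (n + 2) → M) :
    ∑ l, f l = ∑ l, ∑ i, f (child n l i) := by
  rw [← Fintype.sum_prod_type', ← (child_bijective n).sum_comp]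

theorem parent_child (l : Fin 3) (i : Fin 2) :
    parent ((![![0, 1], ![4, 5], ![2, 3]] : Fin 3 → Fin 2 → Fin 6) l i) = l := by
  revert l i; decide

namespace ResData

variable {Q B k V : Type u} [Field k] [AddCommGroup V] [Module k V] {S : PathSys Q B}
  (R : ResData S)

/-- The points of the complex. -/
def point : (n : ℕ) → Label n → Option Q
  | 0, i => some (S.s (R.u i))
  | 1, i => ![S.pt (R.D 0), some (S.t (R.u 0)), S.pt (R.D 1)] i
  | n + 2, (j, w) => S.pt (R.X j n w)

variable (P : PathAlg S k V)

open Classical in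
/-- The matrices of the complex. -/
def matrix : (n : ℕ) → Label n → Label (n + 1) → V
  | 0, i, l => (![![P.co (R.D 0), P.cl (R.u 0), 0],
      ![0, -P.cl (R.u 1), P.co (R.D 1)]] : Fin 2 → Fin 3 → V) i l
  | 1, l, (j, w) => if l = parent j then P.co (R.X j 0 w) else 0
  | n + 2, (j, w), (j', w') =>
      if j = j' ∧ w = Fin.init (α := fun _ => Fin 2) w' then P.co (R.X j' (n + 1) w')
      else 0

-- Every summand maps to its parent only, so the matrices from degree one on are block diagonal with
-- one block per parent.
open Classical in
theorem matrix_child (n : ℕ) (l l' : Label (n + 1)) (i : Fin 2) :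
    R.matrix P (n + 1) l (child n l' i) =
      if l = l' then P.co (R.X (child n l' i).1 n (child n l' i).2) else 0 := by
  cases n with
  | zero =>
    refine if_congr ?_ rfl rfl
    exact Eq.congr rfl (parent_child l' i)
  | succ n =>
    refine if_congr ?_ rfl rfl
    obtain ⟨j, w⟩ := l
    obtain ⟨j', w'⟩ := l'
    simp only [Fin.init_snoc]
    exact Prod.mk_inj.symm

/-- The differential of the complex. -/
def dif (n : ℕ) (x : Label (n + 1) → V) (l : Label n) : V :=
  ∑ l', P.mul (R.matrix P n l l') (x l')

theorem dif_succ (n : ℕ) (x : Label (n + 2) → V) (l : Label (n + 1)) :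
    R.dif P (n + 1) x l =
      ∑ i, P.mul (P.co (R.X (child n l i).1 n (child n l i).2)) (x (child n l i)) := by
  unfold dif
  rw [sum_label, Finset.sum_eq_single l]
  · simp only [matrix_child, if_pos]
  · intro l' _ h
    refine Finset.sum_eq_zero fun i _ => ?_
    rw [matrix_child, if_neg (Ne.symm h)]
    simp
  · simp

theorem dif_zero (x : Label 1 → V) (i : Label 0) :
    R.dif P 0 x i = (![P.mul (P.co (R.D 0)) (x (0 : Fin 3)) + P.mul (P.cl (R.u 0)) (x (1 : Fin 3)),
      -P.mul (P.cl (R.u 1)) (x (1 : Fin 3)) + P.mul (P.co (R.D 1)) (x (2 : Fin 3))] :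
        Fin 2 → V) i := by
  unfold dif
  change ∑ l' : Fin 3, _ = _
  rw [Fin.sum_univ_three]
  revert i
  change ∀ i : Fin 2, _
  intro i
  fin_cases i <;> simp [matrix]

theorem good_D (i : Fin 2) : ∀ T ∈ R.D i, S.Good T.1 T.2 :=
  (R.pair_a i).symm.good_of_branch (R.rem_a i).branch

theorem good_u (i : Fin 2) : S.Good (R.u i) (R.w i) :=
  (R.pair_a i).good (R.comp i) (R.len_u i)

/-- No induction is needed: an entry of any degree arises from some pair of maximal paths, and that
alone makes it good. -/
theorem good_X (j : Fin 6) (n : ℕ) (w : Fin n → Fin 2) : ∀ T ∈ R.X j n w, S.Good T.1 T.2 := by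
  cases n with
  | zero =>
    obtain rfl : w = ![] := Subsingleton.elim _ _
    fin_cases j
    · exact R.step_zero.good.1
    · exact R.step_zero.good.2
    · exact R.step_one.good.1
    · exact R.step_one.good.2
    · exact R.pair_top.good_of_branch R.rem_zero.branch
    · exact R.pair_top.symm.good_of_branch R.rem_one.branch
  | succ n =>
    rw [← Fin.snoc_init_self w]
    have h := (R.sequence j n (Fin.init w)).good
    generalize w (Fin.last n) = i
    fin_cases i
    · exact h.1
    · exact h.2

theorem t_u (i : Fin 2) : S.t (R.u i) = S.t (R.u 0) := by
  fin_cases i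
  · rfl
  · exact R.pair_c.src

theorem s_v (i : Fin 2) : S.s (R.v i) = S.t (R.u 0) := by
  have h : S.s (R.v 0) = S.t (R.u 0) := by rw [R.rem_zero.init.s_eq, S.C_mid (R.comp 0)]
  fin_cases i
  · exact h
  · exact R.pair_top.src.trans h

/-- The kernel of the components of the differential that start at a given label. -/
def LocKer : (n : ℕ) → Label (n + 1) → V → Prop
  | 0, l, x => (![P.mul (P.co (R.D 0)) x = 0, ∀ i, P.mul (P.cl (R.u i)) x = 0,
      P.mul (P.co (R.D 1)) x = 0] : Fin 3 → Prop) l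
  | n + 1, (j, w), x => P.mul (P.co (R.X j n w)) x = 0

/-- For the label of `P(c)`, being annihilated by both `u 0` and `u 1` means vanishing on the
initial subpaths of `w 0` and of `w 1`. These lie in the two maximal paths `v 0`, `v 1` from `c`, so
`PathAlg.exact_pair` yields the two remainders. All other labels are instances of
`PathAlg.exact_step`. -/
theorem locKer_iff (n : ℕ) (l : Label (n + 1)) {x : V} (hx : x ∈ P.E (R.point (n + 1) l)) :
    R.LocKer P n l x ↔ ∃ y : Fin 2 → V, (∀ i, y i ∈ P.E (R.point (n + 2) (child n l i))) ∧
      ∑ i, P.mul (P.co (R.X (child n l i).1 n (child n l i).2)) (y i) = x := by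
  have fin2 : ∀ (E : Fin 2 → Submodule k V) (c : Fin 2 → V),
      (∃ y : Fin 2 → V, (∀ i, y i ∈ E i) ∧ ∑ i, P.mul (c i) (y i) = x) ↔
        ∃ y₀ ∈ E 0, ∃ y₁ ∈ E 1, P.mul (c 0) y₀ + P.mul (c 1) y₁ = x := by
    intro E c
    simp only [Fin.sum_univ_two, Fin.forall_fin_two]
    constructor
    · rintro ⟨y, ⟨h0, h1⟩, h⟩
      exact ⟨_, h0, _, h1, h⟩
    · rintro ⟨y₀, h0, y₁, h1, h⟩
      exact ⟨![y₀, y₁], ⟨h0, h1⟩, h⟩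
  rw [fin2 (fun i => P.E (R.point (n + 2) (child n l i)))
    (fun i => P.co (R.X (child n l i).1 n (child n l i).2))]
  cases n with
  | zero =>
    revert l
    change ∀ l : Fin 3, _
    intro l hx
    fin_cases l
    · exact P.exact_step R.step_zero (R.good_D 0) hx
    · have h := P.exact_pair R.pair_top R.rem_zero R.rem_one (x := x)
        (by rw [R.s_v]; exact hx)
      refine Iff.trans ?_ h
      change (∀ i, P.mul (P.cl (R.u i)) x = 0) ↔ _
      rw [Fin.forall_fin_two, P.mul_eq_zero_iff (R.good_u 0), P.mul_eq_zero_iff (R.good_u 1)]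
      constructor
      · rintro ⟨h0, h1⟩ q - (hq | hq)
        · exact h0 q hq
        · exact h1 q hq
      · exact fun h => ⟨fun q hq => h q (hq.nz (R.good_u 0).nz) (Or.inl hq),
          fun q hq => h q (hq.nz (R.good_u 1).nz) (Or.inr hq)⟩
    · exact P.exact_step R.step_one (R.good_D 1) hx
  | succ n =>
    obtain ⟨j, w⟩ := l
    exact P.exact_step (R.sequence j n w) (R.good_X j n w) hx

theorem branch_u (i : Fin 2) : S.Branch (some (R.u i, R.w i)) (R.uw i) := by
  rintro T ⟨⟩
  exact ⟨R.len_u i, R.comp i⟩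

/-- Components arriving at the same summand come from connecting paths in different maximal paths,
so they vanish separately and the kernel splits over the labels of the source. -/
theorem dif_eq_zero_iff (n : ℕ) (x : Label (n + 1) → V) :
    (∀ l, R.dif P n x l = 0) ↔ ∀ l, R.LocKer P n l (x l) := by
  cases n with
  | zero =>
    simp only [dif_zero]
    change (∀ l : Fin 2, _) ↔ ∀ l : Fin 3, _
    rw [Fin.forall_fin_two, Fin.forall_fin_succ, Fin.forall_fin_two]
    simp only [LocKer, Fin.forall_fin_two]
    constructor
    · rintro ⟨h0, h1⟩
      obtain ⟨h2, h3⟩ := P.indep (R.pair_a 0).symm (R.rem_a 0).branch (R.branch_u 0) h0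
      -- The sign in front of `u 1` is moved into the vector so that independence of the two paths
      -- from `a_1` applies.
      have h1' : P.mul (P.co (some (R.u 1, R.w 1))) (-x (1 : Fin 3)) +
          P.mul (P.co (R.D 1)) (x (2 : Fin 3)) = 0 := by
        rw [map_neg]; exact h1
      obtain ⟨h4, h5⟩ := P.indep (R.pair_a 1) (R.branch_u 1) (R.rem_a 1).branch h1'
      rw [map_neg, neg_eq_zero] at h4
      exact ⟨h2, ⟨h3, h4⟩, h5⟩
    · rintro ⟨h0, ⟨h1, h2⟩, h3⟩
      change P.mul (P.co (R.D 0)) (x (0 : Fin 3)) = 0 at h0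
      change P.mul (P.cl (R.u 0)) (x (1 : Fin 3)) = 0 at h1
      change P.mul (P.cl (R.u 1)) (x (1 : Fin 3)) = 0 at h2
      change P.mul (P.co (R.D 1)) (x (2 : Fin 3)) = 0 at h3
      simp [h0, h1, h2, h3]
  | succ n =>
    simp only [dif_succ]
    have key : ∀ l : Label (n + 1),
        (∑ i, P.mul (P.co (R.X (child n l i).1 n (child n l i).2)) (x (child n l i)) = 0 ↔
          ∀ i, P.mul (P.co (R.X (child n l i).1 n (child n l i).2)) (x (child n l i)) = 0) := by
      intro l
      rw [Fin.sum_univ_two, Fin.forall_fin_two]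
      refine ⟨fun h => ?_, fun h => by rw [h.1, h.2, add_zero]⟩
      cases n with
      | zero =>
        revert l
        change ∀ l : Fin 3, _
        intro l h
        fin_cases l
        · exact P.indep_step R.step_zero h
        · exact P.indep R.pair_top R.rem_zero.branch R.rem_one.branch h
        · exact P.indep_step R.step_one h
      | succ n =>
        obtain ⟨j, w⟩ := l
        exact P.indep_step (R.sequence j n w) h
    simp only [key]
    constructor
    · intro h l
      obtain ⟨⟨l', i⟩, rfl⟩ := (child_bijective n).2 l
      exact h l' i
    · exact fun h l i => h (child n l i)

/-- The kernel splits into local kernels, each the image of the two children of its label. As every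
label has a single parent, the local preimages fit together. -/
theorem exact (n : ℕ) (x : Label (n + 1) → V) (hx : ∀ l, x l ∈ P.E (R.point (n + 1) l)) :
    (∀ l, R.dif P n x l = 0) ↔
      ∃ y : Label (n + 2) → V, (∀ l, y l ∈ P.E (R.point (n + 2) l)) ∧
        ∀ l, R.dif P (n + 1) y l = x l := by
  rw [dif_eq_zero_iff]
  have key := fun l => R.locKer_iff P n l (hx l)
  constructor
  · intro h
    choose y hy hy' using fun l => (key l).1 (h l)
    let f := Equiv.ofBijective _ (child_bijective n)
    have hf : ∀ l i, f.symm (child n l i) = (l, i) := fun l i => f.symm_apply_apply (l, i)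
    refine ⟨fun l => y (f.symm l).1 (f.symm l).2, fun l => ?_, fun l => ?_⟩
    · obtain ⟨⟨l', i⟩, rfl⟩ := (child_bijective n).2 l
      simp only [hf]
      exact hy l' i
    · rw [dif_succ]
      simp only [hf]
      exact hy' l
  · rintro ⟨y, hy, hy'⟩ l
    refine (key l).2 ⟨fun i => y (child n l i), fun i => hy _, ?_⟩
    rw [← hy' l, dif_succ]

/-- The pairing that defines the augmentation. -/
def pairing (x : Fin 2 → V) (y : V) : k := ∑ i, P.cf (P.mul (x i) y) (R.u i)

theorem nz_u (i : Fin 2) : S.nz (R.u i) := by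
  fin_cases i
  · exact R.pair_c.nz_left
  · exact R.pair_c.nz_right

theorem s_uw (i : Fin 2) : S.s (R.uw i) = S.s (R.u i) := S.C_s (R.comp i)

/-- The components of a vector in the kernel of the augmentation. -/
theorem exists_of_vanish (i : Fin 2) {x : V} (hx : x ∈ P.E (some (S.s (R.u i))))
    (h : ∀ q, S.Init q (R.u i) → q ≠ R.u i → P.cf x q = 0) :
    ∃ y ∈ P.E (some (S.t (R.u 0))), ∃ z ∈ P.E (S.pt (R.D i)),
      P.mul (P.cl (R.u i)) y + P.mul (P.co (R.D i)) z = x := by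
  obtain ⟨y, hy, hy'⟩ := P.exists_div (some (R.u i, R.w i))
    (by rintro T ⟨⟩; exact S.C_mid (R.comp i)) x
  obtain ⟨z, hz, hz'⟩ := P.exists_div (R.D i)
    (fun T hT => S.C_mid ((R.rem_a i).branch T hT).2) x
  have hb := R.branch_u i
  have hb' := (R.rem_a i).branch
  have hp : S.pt (some (R.u i, R.w i)) = some (S.t (R.u 0)) := by
    rw [← R.t_u i, S.C_mid (R.comp i)]; rfl
  rw [hp] at hy
  refine ⟨y, hy, z, hz, P.cf_inj fun q hq => ?_⟩
  rw [map_add, Pi.add_apply]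
  change P.cf (P.mul (P.co (some (R.u i, R.w i))) y) q + _ = _
  by_cases hc₀ : S.Covers (some (R.u i, R.w i)) q
  · rw [hy' q hq hc₀, P.cf_co_zero z ((R.pair_a i).not_covers hb hb' hq hc₀), add_zero]
  by_cases hc₁ : S.Covers (R.D i) q
  · rw [hz' q hq hc₁, P.cf_co_zero y hc₀, zero_add]
  rw [P.cf_co_zero y hc₀, P.cf_co_zero z hc₁, add_zero]
  -- A path from `a_i` that begins neither with `u i` nor with the first arrow of `m i` is a proper
  -- initial subpath of `u i`, where `x` vanishes by hypothesis.
  by_cases hs : S.s q = S.s (R.uw i)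
  · have hu : S.Init (R.u i) (R.uw i) := ⟨_, R.comp i⟩
    have hne : q ≠ R.u i := by
      rintro rfl
      exact hc₀ ⟨_, rfl, Init.refl _⟩
    refine (h q ?_ hne).symm
    rcases (R.pair_a i).cover q hq hs with h' | h'
    · rcases le_total (S.len q) (S.len (R.u i)) with hl | hl
      · exact h'.total hu hl
      · exact absurd ⟨_, rfl, hu.total h' hl⟩ hc₀
    · have := init_e (((R.rem_a i).init_or_covers h').resolve_right hc₁)
      rw [this, (R.pair_a i).src, R.s_uw]
      exact e_init _
  · exact (hx q hq fun h => hs (by rw [R.s_uw]; simpa using h.symm)).symm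

/-- Testing against terminal subpaths of `u 0` and `u 1` shows that the kernel of the augmentation
is cut out by vanishing on proper initial subpaths, plus one relation coming from the stationary
path at `c`. That relation is what allows the two components to share one element of `P(c)`. -/
theorem exact_pairing (x : Fin 2 → V) (hx : ∀ i, x i ∈ P.E (some (S.s (R.u i)))) :
    (∀ y ∈ P.op.E (some (S.t (R.u 0))), R.pairing P x y = 0) ↔
      ∃ y : Label 1 → V, (∀ l, y l ∈ P.E (R.point 1 l)) ∧ ∀ l : Fin 2, R.dif P 0 y l = x l := by
  constructor
  · intro h
    -- If `u i` is `q` followed by `y`, pairing with `y` isolates the coefficient of `x i` at `q`,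
    -- because a non-stationary `y` is not terminal in the other maximal path.
    have hlen : ∀ i q, S.Init q (R.u i) → q ≠ R.u i → P.cf (x i) q = 0 := by
      rintro i q ⟨y, hy⟩ hne
      have hly : S.len y ≠ 0 := by
        intro h0
        have h1 := S.C_e q
        rw [S.C_mid hy, ← S.eq_e h0] at h1
        exact hne (S.C_fun h1 hy)
      have h1 := h (P.cl y) (P.op.cl_mem_E (congrArg some (by
        rw [← R.t_u i]; exact S.C_t hy)))
      rw [pairing, Finset.sum_eq_single i, P.cf_mul' (x i) hy (R.nz_u i)] at h1
      · exact h1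
      · intro j _ hj
        refine P.cf_mul_zero' _ fun hi => hly ?_
        have hi' : S.op.Init y (R.u i) := ⟨q, hy⟩
        fin_cases i <;> fin_cases j
        · exact absurd rfl hj
        · exact R.pair_c.disjoint y hi' hi
        · exact R.pair_c.disjoint y hi hi'
        · exact absurd rfl hj
      · simp
    -- The stationary path at `c` is terminal in both `u 0` and `u 1`; pairing with it gives the
    -- single relation between the components.
    have hsum : P.cf (x 0) (R.u 0) + P.cf (x 1) (R.u 1) = 0 := by
      have h1 := h (P.cl (S.e (S.t (R.u 0)))) (P.op.cl_mem_E (congrArg some (S.t_e _).symm))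
      have h2 : ∀ i, P.cf (P.mul (x i) (P.cl (S.e (S.t (R.u 0))))) (R.u i) =
          P.cf (x i) (R.u i) := by
        intro i
        rw [P.cf_mul' (x i) (p := R.u i) _ (R.nz_u i)]
        rw [← R.t_u i]
        exact S.C_e _
      rwa [pairing, Fin.sum_univ_two, h2, h2] at h1
    choose y hy z hz hyz using fun i => R.exists_of_vanish P i (hx i) (hlen i)
    have hcf : ∀ i, P.cf (x i) (R.u i) = P.cf (y i) (S.e (S.t (R.u 0))) := by
      intro i
      rw [← hyz i, map_add, Pi.add_apply, P.cf_co_zero (z i)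
        ((R.pair_a i).init_not_covers (R.rem_a i).branch ⟨_, R.comp i⟩), add_zero,
        P.cf_mul (y i) (q := S.e (S.t (R.u 0))) _ (R.nz_u i)]
      rw [← R.t_u i]
      exact S.C_e _
    classical
    -- One element of `P(c)` must act like `y 0` after `u 0` and like `-y 1` after `u 1`. Only its
    -- coefficients at the initial subpaths of `w 0` and of `w 1` matter for this.
    obtain ⟨c, hc⟩ := P.cf_surj fun r =>
      if S.Init r (R.w 0) then P.cf (y 0) r else -P.cf (y 1) r
    have hc₀ : P.mul (P.cl (R.u 0)) c = P.mul (P.cl (R.u 0)) (y 0) := by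
      rw [← sub_eq_zero, ← map_sub, P.mul_eq_zero_iff (R.good_u 0)]
      intro q hq
      rw [map_sub, Pi.sub_apply, hc q (hq.nz (R.good_u 0).nz), if_pos hq, sub_self]
    have hc₁ : P.mul (P.cl (R.u 1)) c = -P.mul (P.cl (R.u 1)) (y 1) := by
      rw [← add_eq_zero_iff_eq_neg, ← map_add, P.mul_eq_zero_iff (R.good_u 1)]
      intro q hq
      rw [map_add, Pi.add_apply, hc q (hq.nz (R.good_u 1).nz)]
      split_ifs with hq'
      -- The two prescriptions overlap only at the stationary path, since `w 0` and `w 1` lie in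
      -- different maximal paths; there they agree by `hsum`.
      · have h0 := S.eq_e (R.pair_top.disjoint q (hq'.trans R.rem_zero.init)
          (hq.trans R.rem_one.init))
        have hs : S.s q = S.t (R.u 0) := by rw [← hq'.s_eq, S.C_mid (R.comp 0)]
        rw [h0, hs, ← hcf, ← hcf, hsum]
      · exact neg_add_cancel _
    refine ⟨(![z 0, c, z 1] : Fin 3 → V), ?_, ?_⟩
    · change ∀ l : Fin 3, _
      intro l
      fin_cases l
      · exact hz 0
      · intro b hb hxb
        change P.cf c b = 0
        rw [hc b hb, hy 0 b hb hxb, hy 1 b hb hxb]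
        simp
      · exact hz 1
    · intro l
      refine (R.dif_zero P _ l).trans ?_
      fin_cases l
      · change P.mul (P.co (R.D 0)) (z 0) + P.mul (P.cl (R.u 0)) c = x 0
        rw [hc₀, add_comm, hyz 0]
      · change -P.mul (P.cl (R.u 1)) c + P.mul (P.co (R.D 1)) (z 1) = x 1
        rw [hc₁, neg_neg, hyz 1]
  · rintro ⟨y, -, hy⟩ z -
    have hD : ∀ i v, P.cf (P.mul (P.mul (P.co (R.D i)) v) z) (R.u i) = 0 := by
      intro i v
      rw [P.mul_assoc]
      exact P.cf_co_zero _
        ((R.pair_a i).init_not_covers (R.rem_a i).branch ⟨_, R.comp i⟩)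
    -- The component in `P(c)` contributes the same scalar for both values of `i`, so the opposite
    -- signs in the matrix cancel it.
    have hu : ∀ i v, P.cf (P.mul (P.mul (P.cl (R.u i)) v) z) (R.u i) =
        P.cf (P.mul v z) (S.e (S.t (R.u 0))) := by
      intro i v
      rw [P.mul_assoc, P.cf_mul _ (q := S.e (S.t (R.u 0))) _ (R.nz_u i)]
      rw [← R.t_u i]
      exact S.C_e _
    have h0 := (R.dif_zero P y (0 : Fin 2)).symm.trans (hy 0)
    have h1 := (R.dif_zero P y (1 : Fin 2)).symm.trans (hy 1)
    rw [pairing, Fin.sum_univ_two, ← h0, ← h1]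
    simp [hD, hu]

/-- A non-zero path `b` ending at `c` is terminal in some `u i`; pairing with the part of `u i`
before `b` reads off the coefficient of `y` at `b`. -/
theorem pairing_nondegenerate {y : V} (hy : y ∈ P.op.E (some (S.t (R.u 0))))
    (h : ∀ x : Fin 2 → V, (∀ i, x i ∈ P.E (some (S.s (R.u i)))) → R.pairing P x y = 0) : y = 0 := by
  classical
  refine P.cf_inj fun b hb => ?_
  rw [map_zero, Pi.zero_apply]
  by_cases hs : S.t b = S.t (R.u 0)
  · have key : ∀ i, S.op.Init b (R.u i) → P.cf y b = 0 := by
      rintro i ⟨q, hq⟩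
      have h1 := h (Pi.single i (P.cl q)) (fun j => by
        by_cases hj : j = i
        · subst hj
          rw [Pi.single_eq_same]
          exact P.cl_mem_E (congrArg some (S.C_s hq))
        · rw [Pi.single_eq_of_ne hj]
          exact Submodule.zero_mem _)
      rw [pairing, Finset.sum_eq_single i, Pi.single_eq_same, P.cf_mul y hq (R.nz_u i)] at h1
      · exact h1
      · intro j _ hj
        rw [Pi.single_eq_of_ne hj]
        simp
      · simp
    exact (R.pair_c.cover b hb hs).elim (key 0) (key 1)
  · exact hy b hb fun h => hs (Option.some.inj h).symm

/-- The entries of the matrices are non-stationary paths, up to sign. -/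
theorem entry_matrix (n : ℕ) (l : Label n) (l' : Label (n + 1)) :
    P.Entry (R.point n l) (R.matrix P n l l') := by
  have hmid : ∀ i, some (S.s (R.w i)) = some (S.t (R.u 0)) := by
    intro i
    rw [← S.C_mid (R.comp i), R.t_u]
  have hchild : ∀ (n : ℕ) (l : Label (n + 1)) (i : Fin 2),
      P.Entry (R.point (n + 1) l) (P.co (R.X (child n l i).1 n (child n l i).2)) := by
    intro n l i
    cases n with
    | zero =>
      revert l
      change ∀ l : Fin 3, _
      intro l
      fin_cases l <;> fin_cases i
      · exact (P.entry_step R.step_zero).1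
      · exact (P.entry_step R.step_zero).2
      · have := P.entry_rem R.rem_zero
        rw [hmid] at this
        exact this
      · have := P.entry_rem R.rem_one
        rw [hmid] at this
        exact this
      · exact (P.entry_step R.step_one).1
      · exact (P.entry_step R.step_one).2
    | succ n =>
      obtain ⟨j, w⟩ := l
      fin_cases i
      · exact (P.entry_step (R.sequence j n w)).1
      · exact (P.entry_step (R.sequence j n w)).2
  cases n with
  | zero =>
    have hD : ∀ i, P.Entry (some (S.s (R.u i))) (P.co (R.D i)) := by
      intro i
      have := P.entry_rem (R.rem_a i)
      rwa [S.s_e, (R.pair_a i).src, R.s_uw] at this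
    revert l l'
    change ∀ (l : Fin 2) (l' : Fin 3), _
    intro l l'
    fin_cases l <;> fin_cases l'
    · exact hD 0
    · exact Or.inr ⟨_, R.len_u 0, rfl, Or.inl rfl⟩
    · exact Or.inl rfl
    · exact Or.inl rfl
    · exact Or.inr ⟨_, R.len_u 1, rfl, Or.inr rfl⟩
    · exact hD 1
  | succ n =>
    obtain ⟨⟨l₁, i⟩, rfl⟩ := (child_bijective n).2 l'
    dsimp only
    rw [matrix_child]
    split_ifs with h
    · rw [h]; exact hchild n l₁ i
    · exact Or.inl rfl

end ResData

/-- The paths from which the first three terms of the resolution are built if only one maximal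
path `u` ends at the given point. -/
structure ResData₁ {Q B : Type u} (S : PathSys Q B) where
  u : B
  m₀ : B
  m₁ : B
  o : Fin 2 → Option (B × B)
  X : Fin 2 → Fin 2 → Option (B × B)
  nz_u : S.nz u
  cover : ∀ q, S.nz q → S.t q = S.t u → S.op.Init q u
  pair : S.MaxPair m₀ m₁
  rem_zero : S.Rem u m₀ (o 0)
  rem_one : S.Rem (S.e (S.s m₁)) m₁ (o 1)
  step : ∀ i, S.Step (o i) (X i 0) (X i 1)

namespace ResData₁

variable {Q B k V : Type u} [Field k] [AddCommGroup V] [Module k V] {S : PathSys Q B}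
  (R : ResData₁ S) (P : PathAlg S k V)

theorem s_m : S.s R.m₀ = S.s R.u := R.rem_zero.init.s_eq

/-- With a single maximal path `u` ending at the point, the injective module is the quotient of one
projective by the elements vanishing on the initial subpaths of `u`. These are generated by what
follows `u` in `m₀` and by the first arrow of `m₁`. -/
theorem exact_pairing {x : V} (hx : x ∈ P.E (some (S.s R.u))) :
    (∀ y ∈ P.op.E (some (S.t R.u)), P.cf (P.mul x y) R.u = 0) ↔
      ∃ y₀ ∈ P.E (S.pt (R.o 0)), ∃ y₁ ∈ P.E (S.pt (R.o 1)),
        P.mul (P.co (R.o 0)) y₀ + P.mul (P.co (R.o 1)) y₁ = x := by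
  rw [← P.exact_pair R.pair R.rem_zero R.rem_one (by rwa [R.s_m])]
  constructor
  · intro h
    have key : ∀ q, S.Init q R.u → P.cf x q = 0 := by
      rintro q ⟨y, hy⟩
      rw [← P.cf_mul' x hy R.nz_u]
      exact h _ (P.op.cl_mem_E (congrArg some (S.C_t hy)))
    rintro q - (hq | hq)
    · exact key q hq
    · rw [init_e hq, R.pair.src, R.s_m]
      exact key _ (e_init _)
  · intro h y hy
    obtain ⟨y₀, -, y₁, -, rfl⟩ := (P.exact_pair R.pair R.rem_zero R.rem_one
      (by rwa [R.s_m])).1 h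
    rw [map_add, LinearMap.add_apply, P.mul_assoc, P.mul_assoc, map_add, Pi.add_apply,
      P.cf_co_zero _ (R.rem_zero.not_covers (Init.refl _)),
      P.cf_co_zero _ (R.pair.init_not_covers R.rem_one.branch R.rem_zero.init), add_zero]

theorem pairing_nondegenerate {y : V} (hy : y ∈ P.op.E (some (S.t R.u)))
    (h : ∀ x ∈ P.E (some (S.s R.u)), P.cf (P.mul x y) R.u = 0) : y = 0 := by
  refine P.cf_inj fun b hb => ?_
  rw [map_zero, Pi.zero_apply]
  by_cases hs : S.t b = S.t R.u
  · obtain ⟨q, hq⟩ := R.cover b hb hs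
    rw [← P.cf_mul y hq R.nz_u]
    exact h _ (P.cl_mem_E (congrArg some (S.C_s hq)))
  · exact hy b hb fun h => hs (Option.some.inj h).symm

theorem good_o (i : Fin 2) : ∀ T ∈ R.o i, S.Good T.1 T.2 := by
  fin_cases i
  · exact R.pair.good_of_branch R.rem_zero.branch
  · exact R.pair.symm.good_of_branch R.rem_one.branch

theorem good_X (i j : Fin 2) : ∀ T ∈ R.X i j, S.Good T.1 T.2 := by
  fin_cases j
  · exact (R.step i).good.1
  · exact (R.step i).good.2

/-- The second matrix of the resolution. -/
def matrix (i : Fin 2) (j : Fin 2 × Fin 2) : V := if i = j.1 then P.co (R.X j.1 j.2) else 0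

theorem sum_matrix (y : Fin 2 × Fin 2 → V) (i : Fin 2) :
    ∑ j, P.mul (R.matrix P i j) (y j) = ∑ j, P.mul (P.co (R.X i j)) (y (i, j)) := by
  rw [Fintype.sum_prod_type, Finset.sum_eq_single i]
  · simp [matrix]
  · intro i' _ h
    simp [matrix, Ne.symm h]
  · simp

theorem sum_o_eq_zero_iff (x : Fin 2 → V) :
    ∑ i, P.mul (P.co (R.o i)) (x i) = 0 ↔ ∀ i, P.mul (P.co (R.o i)) (x i) = 0 := by
  rw [Fin.sum_univ_two, Fin.forall_fin_two]
  refine ⟨P.indep R.pair R.rem_zero.branch R.rem_one.branch, fun h => by rw [h.1, h.2, add_zero]⟩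

theorem exact_o (x : Fin 2 → V) (hx : ∀ i, x i ∈ P.E (S.pt (R.o i))) :
    ∑ i, P.mul (P.co (R.o i)) (x i) = 0 ↔ ∃ y : Fin 2 × Fin 2 → V,
      (∀ j, y j ∈ P.E (S.pt (R.X j.1 j.2))) ∧ ∀ i, ∑ j, P.mul (R.matrix P i j) (y j) = x i := by
  rw [sum_o_eq_zero_iff]
  simp only [sum_matrix, Fin.sum_univ_two]
  have key := fun i => P.exact_step (R.step i) (R.good_o i) (hx i)
  constructor
  · intro h
    choose y₀ h₀ y₁ h₁ hy using fun i => (key i).1 (h i)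
    refine ⟨fun j => ![y₀ j.1, y₁ j.1] j.2, ?_, hy⟩
    rintro ⟨i, j⟩
    fin_cases j
    · exact h₀ i
    · exact h₁ i
  · rintro ⟨y, hy, hy'⟩ i
    exact (key i).2 ⟨y (i, 0), hy (i, 0), y (i, 1), hy (i, 1), hy' i⟩

theorem indep_matrix (y : Fin 2 × Fin 2 → V) (h : ∀ i, ∑ j, P.mul (R.matrix P i j) (y j) = 0)
    (i : Fin 2) (j : Fin 2 × Fin 2) : P.mul (R.matrix P i j) (y j) = 0 := by
  obtain ⟨i', j⟩ := j
  by_cases hi : i = i'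
  · subst hi
    have h1 := h i
    rw [sum_matrix, Fin.sum_univ_two] at h1
    have h2 := P.indep_step (R.step i) h1
    fin_cases j
    · simpa [matrix] using h2.1
    · simpa [matrix] using h2.2
  · simp [matrix, hi]

theorem entry_o (i : Fin 2) : P.Entry (some (S.s R.u)) (P.co (R.o i)) := by
  fin_cases i
  · exact P.entry_rem R.rem_zero
  · have := P.entry_rem R.rem_one
    rwa [S.s_e, R.pair.src, R.s_m] at this

theorem entry_matrix (i : Fin 2) (j : Fin 2 × Fin 2) :
    P.Entry (S.pt (R.o i)) (R.matrix P i j) := by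
  unfold matrix
  split_ifs with h
  · subst h
    obtain ⟨i, j⟩ := j
    fin_cases j
    · exact (P.entry_step (R.step i)).1
    · exact (P.entry_step (R.step i)).2
  · exact Or.inl rfl

end ResData₁

end AbstractComplex

/-! ### The path system of a quiver -/

section Quiver

variable {Q : Type u} [Quiver.{u} Q]

/-- Concatenation of paths as a relation. -/
inductive QComp : QPath Q → QPath Q → QPath Q → Prop
  | mk {a b c : Q} (f : Path a b) (g : Path b c) : QComp ⟨a, b, f⟩ ⟨b, c, g⟩ ⟨a, c, f.comp g⟩

theorem QComp.eq {a b c : Q} {f : Path a b} {g : Path b c} {r : QPath Q}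
    (h : QComp ⟨a, b, f⟩ ⟨b, c, g⟩ r) : r = ⟨a, c, f.comp g⟩ := by
  cases h; rfl

theorem QComp.exists_right {a b : Q} {f : Path a b} {q r : QPath Q}
    (h : QComp ⟨a, b, f⟩ q r) : ∃ (c : Q) (g : Path b c), q = ⟨b, c, g⟩ ∧ r = ⟨a, c, f.comp g⟩ := by
  cases h; exact ⟨_, _, rfl, rfl⟩

theorem QComp.exists_left {b c : Q} {g : Path b c} {p r : QPath Q}
    (h : QComp p ⟨b, c, g⟩ r) : ∃ (a : Q) (f : Path a b), p = ⟨a, b, f⟩ ∧ r = ⟨a, c, f.comp g⟩ := by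
  cases h; exact ⟨_, _, rfl, rfl⟩

theorem QComp.exists_factor {a c : Q} {m : Path a c} {p q : QPath Q}
    (h : QComp p q ⟨a, c, m⟩) :
    ∃ (b : Q) (f : Path a b) (g : Path b c), p = ⟨a, b, f⟩ ∧ q = ⟨b, c, g⟩ ∧ m = f.comp g := by
  cases h; exact ⟨_, _, _, rfl, rfl, rfl⟩

theorem sigma_path_inj {a c : Q} {f g : Path a c}
    (h : (⟨a, c, f⟩ : QPath Q) = ⟨a, c, g⟩) : f = g := by
  have h1 := eq_of_heq (Sigma.mk.inj h).2
  exact eq_of_heq (Sigma.mk.inj h1).2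

/-- The last arrows of the two factorisations are removed together; the length hypothesis prevents
`g` from being exhausted before `g'`. -/
theorem path_prefix {a b c b' : Q} (f : Path a b) (g : Path b c) (f' : Path a b') (g' : Path b' c)
    (h : f.comp g = f'.comp g') (hl : f.length ≤ f'.length) :
    ∃ r : Path b b', f' = f.comp r ∧ g = r.comp g' := by
  induction g' with
  | nil => exact ⟨g, h.symm, rfl⟩
  | @cons c₁ c₂ g' e ih =>
    cases g with
    | nil =>
      have := congrArg Path.length h
      simp at this
      omega
    | @cons c₃ _ g e' =>
      rw [Path.comp_cons, Path.comp_cons] at h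
      obtain rfl := Path.obj_eq_of_cons_eq_cons h
      have h1 := eq_of_heq (Path.heq_of_cons_eq_cons h)
      have h2 := eq_of_heq (Path.hom_heq_of_cons_eq_cons h)
      obtain ⟨r, hr, hr'⟩ := ih g h1
      exact ⟨r, hr, by rw [hr', h2]; rfl⟩

end Quiver

/-! ### The basis of non-zero paths of the algebra -/

section Algebra

variable {k Q : Type u} [Field k] [Quiver.{u} Q]

namespace PathAlgebra

theorem of_comp {a b c : Q} (f : Path a b) (g : Path b c) :
    (of ⟨a, b, f⟩ * of ⟨b, c, g⟩ : PathAlgebra k Q) = of ⟨a, c, f.comp g⟩ := by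
  rw [of_mul_of, pathMul_comp]

end PathAlgebra

theorem exists_comp {p q : QPath Q} (h : q.1 = p.2.1) : ∃ r, QComp p q r := by
  obtain ⟨a, b, f⟩ := p
  obtain ⟨b', c, g⟩ := q
  obtain rfl : b' = b := h
  exact ⟨_, ⟨f, g⟩⟩

open PathAlgebra

variable [Fintype Q] (I : TwoSidedIdeal (PathAlgebra k Q))

theorem IsNonzero.left {I : TwoSidedIdeal (PathAlgebra k Q)} {a b c : Q} {f : Path a b}
    {g : Path b c} (h : IsNonzero I (f.comp g)) : IsNonzero I f := fun hf =>
  h (by rw [← of_comp]; exact I.mul_mem_right _ _ hf)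

theorem IsNonzero.right {I : TwoSidedIdeal (PathAlgebra k Q)} {a b c : Q} {f : Path a b}
    {g : Path b c} (h : IsNonzero I (f.comp g)) : IsNonzero I g := fun hg =>
  h (by rw [← of_comp]; exact I.mul_mem_left _ _ hg)

/-- The path system of a quiver with relations. -/
def quiverSys : PathSys Q (QPath Q) where
  s q := q.1
  t q := q.2.1
  len q := q.2.2.length
  e x := ⟨x, x, Path.nil⟩
  C := QComp
  nz q := IsNonzero I q.2.2
  C_left := by
    rintro ⟨a, b, f⟩ q q' r h h'
    obtain ⟨c, g, rfl, rfl⟩ := h.exists_right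
    obtain ⟨c', g', rfl, h2⟩ := h'.exists_right
    obtain rfl : c = c' := congrArg (fun q : QPath Q => q.2.1) h2
    rw [Path.comp_inj_right.1 (sigma_path_inj h2)]
  C_right := by
    rintro p p' ⟨b, c, g⟩ r h h'
    obtain ⟨a, f, rfl, rfl⟩ := h.exists_left
    obtain ⟨a', f', rfl, h2⟩ := h'.exists_left
    obtain rfl : a = a' := congrArg (fun q : QPath Q => q.1) h2
    rw [Path.comp_inj_left.1 (sigma_path_inj h2)]
  C_fun := by
    rintro p q r r' ⟨f, g⟩ h'
    exact h'.eq.symm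
  C_s := by rintro _ _ _ ⟨f, g⟩; rfl
  C_t := by rintro _ _ _ ⟨f, g⟩; rfl
  C_mid := by rintro _ _ _ ⟨f, g⟩; rfl
  C_len := by rintro _ _ _ ⟨f, g⟩; exact Path.length_comp _ _
  C_assoc := by
    rintro p q r a v ⟨f, g⟩ h
    obtain ⟨c, g', rfl, rfl⟩ := h.exists_right
    refine ⟨_, ⟨g, g'⟩, ?_⟩
    rw [Path.comp_assoc]
    exact ⟨_, _⟩
  C_assoc' := by
    rintro p q w a v ⟨g, g'⟩ h
    obtain ⟨c, f, rfl, rfl⟩ := h.exists_left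
    refine ⟨_, ⟨f, g⟩, ?_⟩
    rw [← Path.comp_assoc]
    exact ⟨_, _⟩
  C_prefix := by
    rintro p q p' q' ⟨a, c, m⟩ h h' hl
    obtain ⟨b, f, g, rfl, rfl, rfl⟩ := h.exists_factor
    obtain ⟨b', f', g', rfl, rfl, h2⟩ := h'.exists_factor
    obtain ⟨r, rfl, rfl⟩ := path_prefix f g f' g' h2 hl
    exact ⟨⟨_, _, r⟩, ⟨_, _⟩, ⟨_, _⟩⟩
  e_C := by
    rintro ⟨a, b, f⟩
    have := QComp.mk (Path.nil : Path a a) f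
    rwa [Path.nil_comp] at this
  C_e := by
    rintro ⟨a, b, f⟩
    exact QComp.mk f (Path.nil : Path b b)
  s_e _ := rfl
  t_e _ := rfl
  len_e _ := rfl
  eq_e := by
    rintro ⟨a, b, f⟩ h
    obtain rfl := Path.eq_of_length_zero f h
    rw [Path.eq_nil_of_length_zero f h]
  nz_left := by rintro _ _ _ ⟨f, g⟩ h; exact IsNonzero.left h
  nz_right := by rintro _ _ _ ⟨f, g⟩ h; exact IsNonzero.right h

/-- The class of a path. -/
def qcls (q : QPath Q) : BoundAlgebra I := cls I q.2.2

theorem cls_mul_cls {a b c : Q} (f : Path a b) (g : Path b c) :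
    cls I f * cls I g = cls I (f.comp g) := by
  unfold cls
  rw [← map_mul, of_comp]

theorem qcls_mul {p q r : QPath Q} (h : QComp p q r) : qcls I p * qcls I q = qcls I r := by
  obtain ⟨f, g⟩ := h
  exact (map_mul (Ideal.Quotient.mk I.asIdeal) _ _).symm.trans (congrArg _ (of_comp f g))

theorem qcls_mul_of_ne {p q : QPath Q} (h : q.1 ≠ p.2.1) : qcls I p * qcls I q = 0 := by
  have h1 : (of p * of q : PathAlgebra k Q) = 0 := by rw [of_mul_of, pathMul_of_ne h]
  exact (map_mul (Ideal.Quotient.mk I.asIdeal) (of p) (of q)).symm.trans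
    ((congrArg _ h1).trans (map_zero _))

@[elab_as_elim]
theorem qcls_induction {I : TwoSidedIdeal (PathAlgebra k Q)} {C : BoundAlgebra I → Prop}
    (a : BoundAlgebra I) (zero : C 0)
    (add : ∀ a b, C a → C b → C (a + b)) (cls : ∀ (r : k) q, C (r • qcls I q)) : C a := by
  obtain ⟨f, rfl⟩ := Ideal.Quotient.mk_surjective a
  induction f using PathAlgebra.induction_on with
  | h0 => rw [map_zero]; exact zero
  | hadd f g hf hg => rw [map_add]; exact add _ _ hf hg
  | hof r p => exact cls r p

theorem qcls_ext {I : TwoSidedIdeal (PathAlgebra k Q)} {M : Type*} [AddCommGroup M] [Module k M]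
    {f g : BoundAlgebra I →ₗ[k] M} (h : ∀ q, f (qcls I q) = g (qcls I q)) : f = g := by
  refine LinearMap.ext fun a => ?_
  induction a using qcls_induction with
  | zero => simp
  | add a b ha hb => simp [ha, hb]
  | cls r q => simp [h]

/-- The span of the paths that are zero. -/
def zeroPaths : Submodule k (PathAlgebra k Q) := Submodule.span k {f | ∃ q, f = of q ∧ of q ∈ I}

variable {I}

theorem mul_mem_zeroPaths (p : QPath Q) {f : PathAlgebra k Q} (h : f ∈ zeroPaths I) :
    of p * f ∈ zeroPaths I ∧ f * of p ∈ zeroPaths I := by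
  induction h using Submodule.span_induction with
  | mem f hf =>
    obtain ⟨q, rfl, hq⟩ := hf
    constructor
    · by_cases hc : q.1 = p.2.1
      · obtain ⟨r, f, g⟩ := exists_comp hc
        rw [of_comp]
        exact Submodule.subset_span ⟨_, rfl, by rw [← of_comp]; exact I.mul_mem_left _ _ hq⟩
      · rw [of_mul_of, pathMul_of_ne hc]; exact Submodule.zero_mem _
    · by_cases hc : p.1 = q.2.1
      · obtain ⟨r, f, g⟩ := exists_comp hc
        rw [of_comp]
        exact Submodule.subset_span ⟨_, rfl, by rw [← of_comp]; exact I.mul_mem_right _ _ hq⟩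
      · rw [of_mul_of, pathMul_of_ne hc]; exact Submodule.zero_mem _
  | zero => simp
  | add f g _ _ hf hg =>
    rw [mul_add, add_mul]
    exact ⟨Submodule.add_mem _ hf.1 hg.1, Submodule.add_mem _ hf.2 hg.2⟩
  | smul r f _ hf =>
    rw [mul_smul', PathAlgebra.smul_mul']
    exact ⟨Submodule.smul_mem _ _ hf.1, Submodule.smul_mem _ _ hf.2⟩

/-- The span of the paths in `I` is itself a two-sided ideal and contains the generators of `I`.
This is where monomiality is used, and it makes the non-zero paths linearly independent modulo `I`.
-/
theorem mem_zeroPaths (hI : IsStringPresentation I) {f : PathAlgebra k Q} (hf : f ∈ I) :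
    f ∈ zeroPaths I := by
  obtain ⟨ρ, hρ⟩ := hI.monomial
  let J : TwoSidedIdeal (PathAlgebra k Q) := TwoSidedIdeal.mk' (zeroPaths I : Set _)
    (Submodule.zero_mem _) (Submodule.add_mem _) (Submodule.neg_mem _)
    (fun {x y} hy => by
      induction x using PathAlgebra.induction_on with
      | h0 => rw [zero_mul]; exact Submodule.zero_mem _
      | hadd f g hf hg => rw [add_mul]; exact Submodule.add_mem _ hf hg
      | hof r p => rw [PathAlgebra.smul_mul']; exact Submodule.smul_mem _ _ (mul_mem_zeroPaths p hy).1)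
    (fun {x y} hx => by
      induction y using PathAlgebra.induction_on with
      | h0 => rw [mul_zero]; exact Submodule.zero_mem _
      | hadd f g hf hg => rw [mul_add]; exact Submodule.add_mem _ hf hg
      | hof r p => rw [mul_smul']; exact Submodule.smul_mem _ _ (mul_mem_zeroPaths p hx).2)
  have hJ : ∀ x, x ∈ J ↔ x ∈ zeroPaths I := fun x => TwoSidedIdeal.mem_mk' ..
  have h1 : I ≤ J := by
    have h2 : TwoSidedIdeal.span (of '' ρ) ≤ J := by
      rw [TwoSidedIdeal.span_le]
      rintro _ ⟨q, hq, rfl⟩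
      refine (hJ _).2 (Submodule.subset_span ⟨q, rfl, ?_⟩)
      rw [hρ]
      exact TwoSidedIdeal.subset_span ⟨q, hq, rfl⟩
    rwa [← hρ] at h2
  exact (hJ f).1 (h1 hf)

/-- An element of the path algebra as a function on the paths. -/
def toFinsupp : PathAlgebra k Q ≃ₗ[k] (QPath Q →₀ k) := LinearEquiv.refl k _

theorem toFinsupp_of (q : QPath Q) : toFinsupp (k := k) (of q) = Finsupp.single q 1 := rfl

open Classical in
variable (I) in
/-- The coefficients of the non-zero paths. -/
def pathCf : PathAlgebra k Q →ₗ[k] (QPath Q → k) :=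
  LinearMap.pi fun q => if IsNonzero I q.2.2 then Finsupp.lapply q ∘ₗ toFinsupp.toLinearMap else 0

open Classical in
theorem pathCf_of (p q : QPath Q) :
    pathCf I (of p) q = if IsNonzero I q.2.2 ∧ q = p then 1 else 0 := by
  unfold pathCf
  by_cases h : IsNonzero I q.2.2
  · simp [h, toFinsupp_of, Finsupp.single_apply, eq_comm]
  · simp [h]

theorem pathCf_eq_zero (hI : IsStringPresentation I) :
    I.asIdeal.restrictScalars k ≤ LinearMap.ker (pathCf I) := by
  refine le_trans (fun f hf => mem_zeroPaths hI (TwoSidedIdeal.mem_asIdeal.1 hf)) ?_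
  refine Submodule.span_le.2 ?_
  rintro _ ⟨q, rfl, hq⟩
  refine funext fun b => ?_
  classical
  rw [pathCf_of, if_neg]
  · rfl
  · rintro ⟨hb, rfl⟩
    exact hb hq

/-- The coefficients of an element of `A` with respect to the non-zero paths. -/
def coeffs (hI : IsStringPresentation I) : BoundAlgebra I →ₗ[k] (QPath Q → k) :=
  (Submodule.liftQ (I.asIdeal.restrictScalars k) (pathCf I) (pathCf_eq_zero hI)) ∘ₗ
    (Submodule.Quotient.restrictScalarsEquiv k I.asIdeal).symm.toLinearMap

theorem coeffs_mk (hI : IsStringPresentation I) (f : PathAlgebra k Q) :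
    coeffs hI (Ideal.Quotient.mk I.asIdeal f) = pathCf I f := rfl

open Classical in
theorem coeffs_qcls (hI : IsStringPresentation I) (p q : QPath Q) :
    coeffs hI (qcls I p) q = if IsNonzero I q.2.2 ∧ q = p then 1 else 0 := pathCf_of p q

theorem coeffs_of_not_isNonzero (hI : IsStringPresentation I) (a : BoundAlgebra I) {q : QPath Q}
    (h : ¬ IsNonzero I q.2.2) : coeffs hI a q = 0 := by
  classical
  induction a using qcls_induction with
  | zero => simp
  | add a b ha hb => simp [ha, hb]
  | cls r p => simp [coeffs_qcls, h]

/-- An element of the path algebra without coefficients at non-zero paths is a combination of paths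
in `I`, so its class vanishes. -/
theorem coeffs_inj (hI : IsStringPresentation I) {a b : BoundAlgebra I}
    (h : ∀ q : QPath Q, IsNonzero I q.2.2 → coeffs hI a q = coeffs hI b q) : a = b := by
  obtain ⟨f, rfl⟩ := Ideal.Quotient.mk_surjective a
  obtain ⟨g, rfl⟩ := Ideal.Quotient.mk_surjective b
  rw [Ideal.Quotient.eq]
  have h1 : ∀ q : QPath Q, IsNonzero I q.2.2 → toFinsupp (f - g) q = 0 := by
    intro q hq
    have h2 := h q hq
    rw [coeffs_mk, coeffs_mk, ← sub_eq_zero, ← Pi.sub_apply, ← map_sub] at h2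
    simpa [pathCf, hq] using h2
  have h2 : f - g = (toFinsupp (f - g)).sum fun q r => r • of q := by
    have h3 := (Finsupp.sum_single (toFinsupp (f - g))).symm
    have h4 := congrArg toFinsupp.symm h3
    rw [LinearEquiv.symm_apply_apply, Finsupp.sum, map_sum] at h4
    refine h4.trans (Finset.sum_congr rfl fun q _ => ?_)
    rw [LinearEquiv.symm_apply_eq, map_smul, toFinsupp_of, Finsupp.smul_single, smul_eq_mul,
      mul_one]
  rw [h2]
  refine Submodule.sum_mem (I.asIdeal.restrictScalars k) fun q hq => ?_
  by_cases hn : IsNonzero I q.2.2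
  · simp only [h1 q hn, zero_smul]
    exact Submodule.zero_mem _
  · exact Submodule.smul_mem _ _ (TwoSidedIdeal.mem_asIdeal.2 (not_not.1 hn))

theorem finite_arrows_from (hI : IsStringPresentation I) (x : Q) : Finite (Σ y : Q, x ⟶ y) := by
  have h := hI.source_le_two x
  exact ENat.card_lt_top.1 (lt_of_le_of_lt h (by decide))

theorem finite_paths (hI : IsStringPresentation I) (n : ℕ) :
    Finite {q : QPath Q // q.2.2.length = n} := by
  induction n with
  | zero =>
    refine Finite.of_injective (β := Q) (fun q => q.1.1) ?_
    rintro ⟨⟨a, b, f⟩, hf⟩ ⟨⟨a', b', f'⟩, hf'⟩ h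
    obtain rfl : a = a' := h
    obtain rfl := Path.eq_of_length_zero f hf
    obtain rfl := Path.eq_of_length_zero f' hf'
    rw [Subtype.mk.injEq, Path.eq_nil_of_length_zero f hf, Path.eq_nil_of_length_zero f' hf']
  | succ n ih =>
    have := fun x => finite_arrows_from hI x
    refine Finite.of_surjective
      (α := Σ q : {q : QPath Q // q.2.2.length = n}, Σ y : Q, q.1.2.1 ⟶ y)
      (fun p => ⟨⟨p.1.1.1, p.2.1, p.1.1.2.2.cons p.2.2⟩, by
        rw [Path.length_cons, p.1.2]⟩) ?_
    rintro ⟨⟨a, b, f⟩, hf⟩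
    cases f with
    | nil => simp at hf
    | cons f e => exact ⟨⟨⟨⟨_, _, f⟩, by simpa using hf⟩, _, e⟩, rfl⟩

/-- Admissibility bounds the length of non-zero paths, and for each length there are finitely many
paths because at most two arrows start at each of the finitely many points. -/
theorem finite_nonzero (hI : IsStringPresentation I) :
    {q : QPath Q | IsNonzero I q.2.2}.Finite := by
  obtain ⟨N, hN⟩ := hI.pow_le
  have : {q : QPath Q | IsNonzero I q.2.2} ⊆
      ⋃ n ∈ Finset.range N, {q : QPath Q | q.2.2.length = n} := by
    intro q hq
    simp only [Set.mem_iUnion, Finset.mem_range]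
    refine ⟨q.2.2.length, ?_, rfl⟩
    by_contra h
    exact hq (hN q (not_lt.1 h))
  refine Set.Finite.subset (Set.Finite.biUnion (Finset.finite_toSet _) fun n _ => ?_) this
  exact Set.finite_coe_iff.1 (finite_paths hI n)

variable (I) in
/-- The algebra `A` with its basis of non-zero paths. -/
def quiverAlg (hI : IsStringPresentation I) : PathAlg (quiverSys I) k (BoundAlgebra I) where
  cf := coeffs hI
  mul := LinearMap.mul k _
  cl := qcls I
  cf_inj := coeffs_inj hI
  cf_surj F := by
    classical
    refine ⟨∑ q ∈ (finite_nonzero hI).toFinset, F q • qcls I q, fun b hb => ?_⟩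
    rw [map_sum, Finset.sum_apply, Finset.sum_eq_single b]
    · rw [map_smul, Pi.smul_apply, coeffs_qcls, if_pos ⟨hb, rfl⟩, smul_eq_mul, mul_one]
    · intro q _ hq
      rw [map_smul, Pi.smul_apply, coeffs_qcls, if_neg fun h => hq h.2.symm, smul_zero]
    · intro h
      exact absurd ((Set.Finite.mem_toFinset _).2 hb) h
  mul_assoc := mul_assoc
  cf_cl_self h := by classical exact (coeffs_qcls hI _ _).trans (if_pos ⟨h, rfl⟩)
  cf_cl_ne h := by classical exact (coeffs_qcls hI _ _).trans (if_neg fun h' => h h'.2)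
  cf_mul {p q r} v h hr := by
    classical
    induction v using qcls_induction with
    | zero => simp
    | add a b ha hb => simp only [map_add, Pi.add_apply, ha, hb]
    | cls c q' =>
      simp only [map_smul, Pi.smul_apply, LinearMap.mul_apply']
      congr 1
      by_cases hc : q'.1 = p.2.1
      · obtain ⟨r', hr'⟩ := exists_comp hc
        rw [qcls_mul I hr', coeffs_qcls, coeffs_qcls]
        refine if_congr (and_congr (iff_of_true hr ((quiverSys I).nz_right h hr)) ?_) rfl rfl
        constructor
        · rintro rfl; exact (quiverSys I).C_left h hr'
        · rintro rfl; exact (quiverSys I).C_fun h hr'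
      · rw [qcls_mul_of_ne I hc, coeffs_qcls, if_neg, map_zero, Pi.zero_apply]
        rintro ⟨-, rfl⟩
        exact hc ((quiverSys I).C_mid h).symm
  cf_mul_zero {p r} v h := by
    classical
    induction v using qcls_induction with
    | zero => simp
    | add a b ha hb => simp only [map_add, Pi.add_apply, ha, hb, add_zero]
    | cls c q' =>
      simp only [map_smul, Pi.smul_apply, LinearMap.mul_apply']
      by_cases hc : q'.1 = p.2.1
      · obtain ⟨r', hr'⟩ := exists_comp hc
        rw [qcls_mul I hr', coeffs_qcls, if_neg, smul_zero]
        rintro ⟨-, rfl⟩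
        exact h ⟨_, hr'⟩
      · rw [qcls_mul_of_ne I hc, map_zero, Pi.zero_apply, smul_zero]
  cf_mul' {p q r} v h hr := by
    classical
    induction v using qcls_induction with
    | zero => simp
    | add a b ha hb => simp only [map_add, LinearMap.add_apply, Pi.add_apply, ha, hb]
    | cls c p' =>
      simp only [map_smul, LinearMap.smul_apply, Pi.smul_apply, LinearMap.mul_apply']
      congr 1
      by_cases hc : q.1 = p'.2.1
      · obtain ⟨r', hr'⟩ := exists_comp hc
        rw [qcls_mul I hr', coeffs_qcls, coeffs_qcls]
        refine if_congr (and_congr (iff_of_true hr ((quiverSys I).nz_left h hr)) ?_) rfl rfl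
        constructor
        · rintro rfl; exact (quiverSys I).C_right h hr'
        · rintro rfl; exact (quiverSys I).C_fun h hr'
      · rw [qcls_mul_of_ne I hc, coeffs_qcls, if_neg, map_zero, Pi.zero_apply]
        rintro ⟨-, rfl⟩
        exact hc ((quiverSys I).C_mid h).symm
  cf_mul_zero' {p r} v h := by
    classical
    induction v using qcls_induction with
    | zero => simp
    | add a b ha hb => simp only [map_add, LinearMap.add_apply, Pi.add_apply, ha, hb, add_zero]
    | cls c p' =>
      simp only [map_smul, LinearMap.smul_apply, Pi.smul_apply, LinearMap.mul_apply']
      by_cases hc : p.1 = p'.2.1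
      · obtain ⟨r', hr'⟩ := exists_comp hc
        rw [qcls_mul I hr', coeffs_qcls, if_neg, smul_zero]
        rintro ⟨-, rfl⟩
        exact h ⟨_, hr'⟩
      · rw [qcls_mul_of_ne I hc, map_zero, Pi.zero_apply, smul_zero]

end Algebra

/-! ### Translation of typed paths into the path system -/

section Conversion

variable {k Q : Type u} [Field k] [Fintype Q] [Quiver.{u} Q]
  {I : TwoSidedIdeal (PathAlgebra k Q)}

open PathAlgebra

/-- A typed path as an element of the type of all paths. -/
abbrev toQ {a b : Q} (f : Path a b) : QPath Q := ⟨a, b, f⟩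

/-- An entry of a right maximal sequence, as a pair of paths. -/
def RSegment.toPair (T : RSegment Q) : QPath Q × QPath Q := (toQ T.conn, toQ T.seg)

/-- An entry of a left maximal sequence, as a pair of paths. -/
def LSegment.toPair (T : LSegment Q) : QPath Q × QPath Q := (toQ T.conn, toQ T.seg)

theorem IsInitial.init {x y z : Q} {p : Path x y} {m : Path x z} (h : IsInitial p m) :
    (quiverSys I).Init (toQ p) (toQ m) := by
  obtain ⟨r, rfl⟩ := h
  exact ⟨_, ⟨p, r⟩⟩

theorem IsTerminal.init {x y z : Q} {p : Path y x} {m : Path z x} (h : IsTerminal p m) :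
    (quiverSys I).op.Init (toQ p) (toQ m) := by
  obtain ⟨r, rfl⟩ := h
  exact ⟨_, ⟨r, p⟩⟩

theorem init_isInitial {x z : Q} {q : QPath Q} {m : Path x z}
    (h : (quiverSys I).Init q (toQ m)) : ∃ (y : Q) (p : Path x y), q = toQ p ∧ IsInitial p m := by
  obtain ⟨r, hr⟩ := h
  obtain ⟨b, f, g, rfl, rfl, rfl⟩ := QComp.exists_factor hr
  exact ⟨b, f, rfl, g, rfl⟩

theorem init_isTerminal {x z : Q} {q : QPath Q} {m : Path z x}
    (h : (quiverSys I).op.Init q (toQ m)) :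
    ∃ (y : Q) (p : Path y x), q = toQ p ∧ IsTerminal p m := by
  obtain ⟨r, hr⟩ := h
  obtain ⟨b, f, g, rfl, rfl, rfl⟩ := QComp.exists_factor hr
  exact ⟨b, g, rfl, f, rfl⟩

theorem MaximalPairFrom.maxPair {x y₀ y₁ : Q} {m₀ : Path x y₀} {m₁ : Path x y₁}
    (h : MaximalPairFrom I m₀ m₁) : (quiverSys I).MaxPair (toQ m₀) (toQ m₁) where
  nz_left := h.nonzero_left
  nz_right := h.nonzero_right
  src := rfl
  cover := by
    rintro ⟨x', z, q⟩ hq hs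
    obtain rfl : x' = x := hs
    exact (h.cover q hq).imp IsInitial.init IsInitial.init
  disjoint := by
    rintro q h0 h1
    obtain ⟨y, p, rfl, hp⟩ := init_isInitial h0
    obtain ⟨y', p', h2, hp'⟩ := init_isInitial h1
    obtain rfl : y = y' := congrArg (fun q : QPath Q => q.2.1) h2
    obtain rfl := sigma_path_inj h2
    exact h.disjoint p hp hp'

theorem MaximalPairTo.maxPair {x y₀ y₁ : Q} {m₀ : Path y₀ x} {m₁ : Path y₁ x}
    (h : MaximalPairTo I m₀ m₁) : (quiverSys I).op.MaxPair (toQ m₀) (toQ m₁) where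
  nz_left := h.nonzero_left
  nz_right := h.nonzero_right
  src := rfl
  cover := by
    rintro ⟨z, x', q⟩ hq hs
    obtain rfl : x' = x := hs
    exact (h.cover q hq).imp IsTerminal.init IsTerminal.init
  disjoint := by
    rintro q h0 h1
    obtain ⟨y, p, rfl, hp⟩ := init_isTerminal h0
    obtain ⟨y', p', h2, hp'⟩ := init_isTerminal h1
    obtain rfl : y = y' := congrArg (fun q : QPath Q => q.1) h2
    obtain rfl := sigma_path_inj h2
    exact h.disjoint p hp hp'

theorem IsRightRemainder.rem {x y z : Q} {p : Path x y} {m : Path x z} {o : Option (RSegment Q)}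
    (h : IsRightRemainder p m o) :
    (quiverSys I).Rem (toQ p) (toQ m) (o.map RSegment.toPair) := by
  cases h with
  | none => rfl
  | some _ α r => exact ⟨⟨toQ α.toPath, rfl, ⟨_, _⟩⟩, ⟨_, _⟩⟩

theorem IsLeftRemainder.rem {x y z : Q} {p : Path y x} {m : Path z x} {o : Option (LSegment Q)}
    (h : IsLeftRemainder p m o) :
    (quiverSys I).op.Rem (toQ p) (toQ m) (o.map LSegment.toPair) := by
  cases h with
  | none => rfl
  | some _ α r => exact ⟨⟨toQ α.toPath, rfl, ⟨_, _⟩⟩, ⟨_, _⟩⟩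

theorem RightStep.step {T o₀ o₁ : Option (RSegment Q)} (h : RightStep I T o₀ o₁) :
    (quiverSys I).Step (T.map RSegment.toPair) (o₀.map RSegment.toPair)
      (o₁.map RSegment.toPair) := by
  cases T with
  | none => obtain ⟨rfl, rfl⟩ := h; exact ⟨rfl, rfl⟩
  | some T =>
    obtain ⟨y₀, y₁, m₀, m₁, hm, h0, h1⟩ := h
    exact ⟨_, _, hm.maxPair, rfl, h0.rem, h1.rem⟩

theorem LeftStep.step {T o₀ o₁ : Option (LSegment Q)} (h : LeftStep I T o₀ o₁) :
    (quiverSys I).op.Step (T.map LSegment.toPair) (o₀.map LSegment.toPair)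
      (o₁.map LSegment.toPair) := by
  cases T with
  | none => obtain ⟨rfl, rfl⟩ := h; exact ⟨rfl, rfl⟩
  | some T =>
    obtain ⟨y₀, y₁, m₀, m₁, hm, h0, h1⟩ := h
    exact ⟨_, _, hm.maxPair, rfl, h0.rem, h1.rem⟩

/-- The data of the projective resolution, in the path system of the quiver. -/
def ProjResData.toRes {c : Q} {a : Fin 2 → Q} (R : ProjResData I c a)
    (hu : ∀ i, (R.u i).length ≠ 0) : ResData (quiverSys I) where
  u i := toQ (R.u i)
  w i := toQ (R.w i)
  uw i := toQ ((R.u i).comp (R.w i))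
  m i := toQ (R.m i)
  v i := toQ (R.v i)
  D i := (R.D i).map RSegment.toPair
  X j n w := (R.X j n w).map RSegment.toPair
  pair_c := R.pair_c.maxPair
  len_u := hu
  comp _ := ⟨_, _⟩
  pair_a i := (R.pair_a i).maxPair
  rem_a i := (R.rem_a i).rem
  step_zero := R.step_zero.step
  step_one := R.step_one.step
  pair_top := R.pair_top.maxPair
  rem_zero := R.rem_zero.rem
  rem_one := R.rem_one.rem
  sequence j n w := (R.sequence j n w).step

/-- The data of the injective coresolution, in the opposite of the path system of the quiver. -/
def InjResData.toRes {z : Q} {e : Fin 2 → Q} (R : InjResData I z e)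
    (hu : ∀ i, (R.u i).length ≠ 0) : ResData (quiverSys I).op where
  u i := toQ (R.u i)
  w i := toQ (R.w i)
  uw i := toQ ((R.w i).comp (R.u i))
  m i := toQ (R.m i)
  v i := toQ (R.v i)
  D i := (R.D i).map LSegment.toPair
  X j n w := (R.X j n w).map LSegment.toPair
  pair_c := R.pair_z.maxPair
  len_u := hu
  comp _ := ⟨_, _⟩
  pair_a i := (R.pair_e i).maxPair
  rem_a i := (R.rem_e i).rem
  step_zero := R.step_zero.step
  step_one := R.step_one.step
  pair_top := R.pair_soc.maxPair
  rem_zero := R.rem_zero.rem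
  rem_one := R.rem_one.rem
  sequence j n w := (R.sequence j n w).step

theorem pt_map_rsegment (o : Option (RSegment Q)) :
    (quiverSys I).pt (o.map RSegment.toPair) = o.map RSegment.src := by cases o <;> rfl

theorem pt_map_lsegment (o : Option (LSegment Q)) :
    (quiverSys I).op.pt (o.map LSegment.toPair) = o.map LSegment.tgt := by cases o <;> rfl

variable (hI : IsStringPresentation I)

theorem co_map_rsegment (o : Option (RSegment Q)) :
    (quiverAlg I hI).co (o.map RSegment.toPair) = RSegment.connCls I o := by cases o <;> rfl

theorem co_map_lsegment (o : Option (LSegment Q)) :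
    (quiverAlg I hI).op.co (o.map LSegment.toPair) = LSegment.connCls I o := by cases o <;> rfl

theorem ProjResData.toRes_point {c : Q} {a : Fin 2 → Q} (R : ProjResData I c a)
    (hu : ∀ i, (R.u i).length ≠ 0) (n : ℕ) (l : Label n) :
    (R.toRes hu).point n l = R.point n l := by
  match n, l with
  | 0, i => rfl
  | 1, i =>
    exact congrFun (congrArg₂ (fun x y => (![x, some c, y] : Fin 3 → Option Q))
      (pt_map_rsegment _) (pt_map_rsegment _)) i
  | n + 2, (j, w) => exact pt_map_rsegment _

theorem ProjResData.toRes_matrix {c : Q} {a : Fin 2 → Q} (R : ProjResData I c a)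
    (hu : ∀ i, (R.u i).length ≠ 0) (n : ℕ) (l : Label n) (l' : Label (n + 1)) :
    (R.toRes hu).matrix (quiverAlg I hI) n l l' = R.matrix n l l' := by
  match n, l, l' with
  | 0, i, l =>
    change (![![_, _, _], ![_, _, _]] : Fin 2 → Fin 3 → BoundAlgebra I) i l =
      (![![_, _, _], ![_, _, _]] : Fin 2 → Fin 3 → BoundAlgebra I) i l
    rw [← co_map_rsegment hI, ← co_map_rsegment hI]
    rfl
  | 1, l, (j, w) =>
    exact congrArg (fun v => @ite _ (l = parent j) (Classical.propDecidable _) v 0)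
      (co_map_rsegment hI _)
  | n + 2, (j, w), (j', w') => exact @if_congr _ _ _ _ _ _ _ _ _ Iff.rfl (co_map_rsegment hI _) rfl

theorem InjResData.toRes_point {z : Q} {e : Fin 2 → Q} (R : InjResData I z e)
    (hu : ∀ i, (R.u i).length ≠ 0) (n : ℕ) (l : Label n) :
    (R.toRes hu).point n l = R.point n l := by
  match n, l with
  | 0, i => rfl
  | 1, i =>
    exact congrFun (congrArg₂ (fun x y => (![x, some z, y] : Fin 3 → Option Q))
      (pt_map_lsegment _) (pt_map_lsegment _)) i
  | n + 2, (j, w) => exact pt_map_lsegment _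

theorem InjResData.toRes_matrix {z : Q} {e : Fin 2 → Q} (R : InjResData I z e)
    (hu : ∀ i, (R.u i).length ≠ 0) (n : ℕ) (l : Label n) (l' : Label (n + 1)) :
    (R.toRes hu).matrix (quiverAlg I hI).op n l l' = R.matrix n l l' := by
  match n, l, l' with
  | 0, i, l =>
    change (![![_, _, _], ![_, _, _]] : Fin 2 → Fin 3 → BoundAlgebra I) i l =
      (![![_, _, _], ![_, _, _]] : Fin 2 → Fin 3 → BoundAlgebra I) i l
    rw [← co_map_lsegment hI, ← co_map_lsegment hI]
    rfl
  | 1, l, (j, w) =>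
    exact congrArg (fun v => @ite _ (l = parent j) (Classical.propDecidable _) v 0)
      (co_map_lsegment hI _)
  | n + 2, (j, w), (j', w') => exact @if_congr _ _ _ _ _ _ _ _ _ Iff.rfl (co_map_lsegment hI _) rfl

theorem mem_proj_iff {x : Q} {a : BoundAlgebra I} :
    a ∈ Proj I x ↔ idem I x * a = a := by
  rw [Submodule.mem_span_singleton]
  constructor
  · rintro ⟨b, rfl⟩
    rw [MulOpposite.smul_eq_mul_unop, ← mul_assoc]
    congr 1
    exact cls_mul_cls I _ _
  · exact fun h => ⟨MulOpposite.op a, h⟩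

theorem mem_leftProj_iff {x : Q} {a : BoundAlgebra I} :
    a ∈ LeftProj I x ↔ a * idem I x = a := by
  rw [Submodule.mem_span_singleton]
  constructor
  · rintro ⟨b, rfl⟩
    rw [smul_eq_mul, mul_assoc]
    congr 1
    exact cls_mul_cls I _ _
  · exact fun h => ⟨a, h⟩

theorem alg_mul (a b : BoundAlgebra I) : (quiverAlg I hI).mul a b = a * b := rfl

theorem alg_op_mul (a b : BoundAlgebra I) : (quiverAlg I hI).op.mul a b = b * a := rfl

theorem alg_cl (q : QPath Q) : (quiverAlg I hI).cl q = qcls I q := rfl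

theorem alg_op_cl (q : QPath Q) : (quiverAlg I hI).op.cl q = qcls I q := rfl

theorem alg_cf : (quiverAlg I hI).cf = coeffs hI := rfl

theorem alg_op_cf : (quiverAlg I hI).op.cf = coeffs hI := rfl

theorem idem_eq (x : Q) : idem I x = qcls I (toQ (Path.nil : Path x x)) := rfl

theorem coeffs_qcls_mul {p q r : QPath Q} (a : BoundAlgebra I) (h : QComp p q r)
    (hr : IsNonzero I r.2.2) : coeffs hI (qcls I p * a) r = coeffs hI a q := by
  have := (quiverAlg I hI).cf_mul a h hr
  rwa [alg_mul, alg_cl, alg_cf] at this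

theorem coeffs_mul_qcls {p q r : QPath Q} (a : BoundAlgebra I) (h : QComp p q r)
    (hr : IsNonzero I r.2.2) : coeffs hI (a * qcls I q) r = coeffs hI a p := by
  have := (quiverAlg I hI).cf_mul' a h hr
  rwa [alg_mul, alg_cl, alg_cf] at this

theorem coeffs_qcls_mul_of_not {p r : QPath Q} (a : BoundAlgebra I)
    (h : ¬ (quiverSys I).Init p r) : coeffs hI (qcls I p * a) r = 0 := by
  have := (quiverAlg I hI).cf_mul_zero a h
  rwa [alg_mul, alg_cl, alg_cf] at this

theorem coeffs_mul_qcls_of_not {p r : QPath Q} (a : BoundAlgebra I)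
    (h : ¬ (quiverSys I).op.Init p r) : coeffs hI (a * qcls I p) r = 0 := by
  have := (quiverAlg I hI).cf_mul_zero' a h
  rwa [alg_mul, alg_cl, alg_cf] at this

theorem mem_proj_iff_mem_E {x : Q} {a : BoundAlgebra I} :
    a ∈ Proj I x ↔ a ∈ (quiverAlg I hI).E (some x) := by
  rw [mem_proj_iff]
  constructor
  · intro h
    rw [← h, idem_eq, ← alg_mul hI, ← alg_cl hI]
    exact (quiverAlg I hI).cl_mul_mem_E (p := toQ (Path.nil : Path x x)) a
  · intro h
    refine coeffs_inj hI fun b hb => ?_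
    rw [idem_eq]
    by_cases hx : b.1 = x
    · subst hx
      exact coeffs_qcls_mul hI a ((quiverSys I).e_C b) hb
    · rw [coeffs_qcls_mul_of_not hI a fun hi => hx (PathSys.Init.s_eq (p := toQ (Path.nil : Path x x)) hi)]
      exact (h b hb fun h => hx (Option.some.inj h).symm).symm

theorem mem_leftProj_iff_mem_E {x : Q} {a : BoundAlgebra I} :
    a ∈ LeftProj I x ↔ a ∈ (quiverAlg I hI).op.E (some x) := by
  rw [mem_leftProj_iff]
  constructor
  · intro h
    rw [← h, idem_eq, ← alg_op_mul hI, ← alg_op_cl hI]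
    exact (quiverAlg I hI).op.cl_mul_mem_E (p := toQ (Path.nil : Path x x)) a
  · intro h
    refine coeffs_inj hI fun b hb => ?_
    rw [idem_eq]
    by_cases hx : b.2.1 = x
    · subst hx
      exact coeffs_mul_qcls hI a ((quiverSys I).C_e b) hb
    · rw [coeffs_mul_qcls_of_not hI a fun hi => hx (PathSys.Init.s_eq (p := toQ (Path.nil : Path x x)) hi)]
      exact (h b hb fun h => hx (Option.some.inj h).symm).symm

/-- The classes of paths span `A`, so the defining values leave only the coefficient functional at
`p`. -/
theorem isDualOfPath_iff {x y : Q} {p : Path x y} (hp : IsNonzero I p)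
    {φ : BoundAlgebra I →ₗ[k] k} :
    IsDualOfPath I p φ ↔ ∀ a, φ a = coeffs hI a (toQ p) := by
  classical
  have key : ∀ q : QPath Q, coeffs hI (qcls I q) (toQ p) = if q = toQ p then 1 else 0 := by
    intro q
    rw [coeffs_qcls]
    exact if_congr ⟨fun h => h.2.symm, fun h => ⟨hp, h.symm⟩⟩ rfl rfl
  constructor
  · intro h a
    have : φ = LinearMap.proj (toQ p) ∘ₗ coeffs hI := qcls_ext fun q =>
      (h q).trans (by simp only [LinearMap.comp_apply, LinearMap.proj_apply, key])
    rw [this]; rfl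
  · intro h q
    rw [h]
    exact (key q).trans (by congr)

end Conversion

/-! ### Uniqueness of projective covers and injective envelopes -/

section Covers

variable {R : Type u} [Ring R] {M M' N P P' : Type u} [AddCommGroup M] [Module R M]
  [AddCommGroup M'] [Module R M'] [AddCommGroup N] [Module R N]
  [AddCommGroup P] [Module R P] [AddCommGroup P'] [Module R P']

/-- A lift `g` of `f` along `f'` is onto because the kernel of `f'` is superfluous, so it splits. -/
theorem IsProjectiveCover.exists_equiv {f : P →ₗ[R] M} {f' : P' →ₗ[R] M}
    (h : IsProjectiveCover f) (h' : IsProjectiveCover f') :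
    ∃ e : P ≃ₗ[R] P', f' ∘ₗ e.toLinearMap = f := by
  have := h.projective
  have := h'.projective
  obtain ⟨g, hg⟩ := Module.projective_lifting_property f' f h'.surjective
  have hg' : ∀ x, f' (g x) = f x := fun x => LinearMap.congr_fun hg x
  have hgs : Function.Surjective g := by
    rw [← LinearMap.range_eq_top]
    refine h'.superfluous _ (eq_top_iff.2 fun x _ => ?_)
    obtain ⟨y, hy⟩ := h.surjective (f' x)
    refine Submodule.mem_sup.2 ⟨x - g y, ?_, g y, ⟨y, rfl⟩, by simp⟩
    simp [hg', hy]
  -- The section is onto as well, since the kernel of `g` lies in the superfluous kernel of `f`;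
  -- hence `g` is injective.
  obtain ⟨s, hs⟩ := Module.projective_lifting_property g LinearMap.id hgs
  have hs' : ∀ x, g (s x) = x := fun x => LinearMap.congr_fun hs x
  have hss : Function.Surjective s := by
    rw [← LinearMap.range_eq_top]
    refine h.superfluous _ (eq_top_iff.2 fun x _ => ?_)
    refine Submodule.mem_sup.2 ⟨x - s (g x), ?_, s (g x), ⟨g x, rfl⟩, by simp⟩
    rw [LinearMap.mem_ker, ← hg', map_sub, hs', sub_self, map_zero]
  have hgi : Function.Injective g := by
    intro x y hxy
    obtain ⟨x, rfl⟩ := hss x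
    obtain ⟨y, rfl⟩ := hss y
    rw [hs', hs'] at hxy
    rw [hxy]
  exact ⟨LinearEquiv.ofBijective g ⟨hgi, hgs⟩, hg⟩

theorem IsProjectiveCover.equiv_comp {f : P →ₗ[R] M} (h : IsProjectiveCover f) (e : M ≃ₗ[R] M') :
    IsProjectiveCover (e.toLinearMap ∘ₗ f) where
  projective := h.projective
  surjective := e.surjective.comp h.surjective
  superfluous := by rw [LinearEquiv.ker_comp]; exact h.superfluous

theorem IsSyzygy.equiv_ker (h : IsSyzygy R M N) {f : P →ₗ[R] M} (hf : IsProjectiveCover f) :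
    Nonempty (N ≃ₗ[R] LinearMap.ker f) := by
  obtain ⟨P', _, _, f', hf', ⟨e⟩⟩ := h
  obtain ⟨g, rfl⟩ := hf.exists_equiv hf'
  refine ⟨e ≪≫ₗ (g.ofSubmodules _ _ ?_).symm⟩
  rw [LinearMap.ker_comp]
  exact Submodule.map_comap_eq_of_surjective g.surjective _

/-- The second syzygy can be read off from any minimal projective presentation: restricted to its
image, `g` is a projective cover of the first syzygy. -/
theorem IsSecondSyzygy.equiv_ker (h : IsSecondSyzygy R M N) {f : P →ₗ[R] M}
    (hf : IsProjectiveCover f) {g : P' →ₗ[R] P} (hP : Module.Projective R P')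
    (hg : Function.Exact g f) (hs : IsSuperfluous (LinearMap.ker g)) :
    Nonempty (N ≃ₗ[R] LinearMap.ker g) := by
  obtain ⟨K, _, _, hK, hN⟩ := h
  obtain ⟨e⟩ := hK.equiv_ker hf
  let g' : P' →ₗ[R] LinearMap.ker f := g.codRestrict _ fun x => hg.apply_apply_eq_zero x
  have hk : LinearMap.ker g' = LinearMap.ker g := LinearMap.ker_codRestrict _ _ _
  have hc : IsProjectiveCover g' := by
    refine ⟨hP, fun x => ?_, by rw [hk]; exact hs⟩
    obtain ⟨y, hy⟩ := (hg x.1).1 x.2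
    exact ⟨y, Subtype.ext hy⟩
  obtain ⟨i⟩ := hN.equiv_ker (hc.equiv_comp e.symm)
  exact ⟨i ≪≫ₗ LinearEquiv.ofEq _ _ ((LinearEquiv.ker_comp _ _).trans hk)⟩

/-- An extension `g` of `f'` along `f` is injective by essentiality of `f`; a retraction of `g` is
injective by essentiality of `f'`, so `g` is onto. -/
theorem IsInjectiveEnvelope.exists_equiv {f : M →ₗ[R] P} {f' : M →ₗ[R] P'}
    (h : IsInjectiveEnvelope f) (h' : IsInjectiveEnvelope f') :
    ∃ e : P ≃ₗ[R] P', e.toLinearMap ∘ₗ f = f' := by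
  obtain ⟨g, hg⟩ := h'.injective_module.out f h.injective f'
  have hgi : Function.Injective g := by
    rw [← LinearMap.ker_eq_bot]
    refine h.essential _ (eq_bot_iff.2 ?_)
    rintro _ ⟨⟨x, rfl⟩, hx⟩
    have : f' x = 0 := by rw [← hg]; exact hx
    rw [(map_eq_zero_iff f' h'.injective).1 this, map_zero]
    exact zero_mem _
  obtain ⟨r, hr⟩ := h.injective_module.out g hgi LinearMap.id
  have hri : Function.Injective r := by
    rw [← LinearMap.ker_eq_bot]
    refine h'.essential _ (eq_bot_iff.2 ?_)
    rintro _ ⟨⟨x, rfl⟩, hx⟩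
    rw [← hg] at hx ⊢
    have : f x = 0 := (hr (f x)).symm.trans hx
    rw [this, map_zero]
    exact zero_mem _
  exact ⟨LinearEquiv.ofBijective g ⟨hgi, fun x => ⟨r x, hri (hr (r x))⟩⟩, LinearMap.ext hg⟩

theorem IsInjectiveEnvelope.comp_equiv {f : M →ₗ[R] P} (h : IsInjectiveEnvelope f)
    (e : M' ≃ₗ[R] M) : IsInjectiveEnvelope (f ∘ₗ e.toLinearMap) where
  injective_module := h.injective_module
  injective := h.injective.comp e.injective
  essential := by rw [LinearEquiv.range_comp]; exact h.essential

theorem IsCosyzygy.equiv_quotient (h : IsCosyzygy R M N) {f : M →ₗ[R] P}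
    (hf : IsInjectiveEnvelope f) : Nonempty (N ≃ₗ[R] P ⧸ LinearMap.range f) := by
  obtain ⟨P', _, _, f', hf', ⟨e⟩⟩ := h
  obtain ⟨g, rfl⟩ := hf'.exists_equiv hf
  exact ⟨e ≪≫ₗ Submodule.Quotient.equiv _ _ g (LinearMap.range_comp _ _).symm⟩

/-- Dual to the case of syzygies: the map induced by `g` on the cokernel of `f` is an injective
envelope of the first cosyzygy. -/
theorem IsSecondCosyzygy.equiv_quotient (h : IsSecondCosyzygy R M N) {f : M →ₗ[R] P}
    (hf : IsInjectiveEnvelope f) {g : P →ₗ[R] P'} (hP : Module.Injective R P')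
    (hg : Function.Exact f g) (hs : IsEssential (LinearMap.range g)) :
    Nonempty (N ≃ₗ[R] P' ⧸ LinearMap.range g) := by
  obtain ⟨K, _, _, hK, hN⟩ := h
  obtain ⟨e⟩ := hK.equiv_quotient hf
  have hker : LinearMap.range f = LinearMap.ker g := (LinearMap.exact_iff.1 hg).symm
  let g' : (P ⧸ LinearMap.range f) →ₗ[R] P' := (LinearMap.range f).liftQ g hker.le
  have hr : LinearMap.range g' = LinearMap.range g := Submodule.range_liftQ _ _ _
  have hc : IsInjectiveEnvelope g' := by
    refine ⟨hP, ?_, by rw [hr]; exact hs⟩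
    rw [← LinearMap.ker_eq_bot]
    exact Submodule.ker_liftQ_eq_bot _ _ _ hker.ge
  obtain ⟨i⟩ := hN.equiv_quotient (hc.comp_equiv e)
  exact ⟨i ≪≫ₗ Submodule.quotEquivOfEq _ _ ((LinearEquiv.range_comp _ _).trans hr)⟩

end Covers

/-! ### Direct sums of uniserial modules -/

section Sums

variable {R : Type u} [Ring R] {M M' : Type u} [AddCommGroup M] [Module R M]
  [AddCommGroup M'] [Module R M']

theorem IsUniserial.of_equiv (e : M ≃ₗ[R] M') (h : IsUniserial R M) : IsUniserial R M' := by
  have := h.1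
  refine ⟨e.symm.toEquiv.nontrivial, fun N N' => ?_⟩
  have := h.2 (N.comap e.toLinearMap) (N'.comap e.toLinearMap)
  refine this.imp (fun h x hx => ?_) fun h x hx => ?_
  · simpa using h (show e.symm x ∈ N.comap e.toLinearMap by simpa using hx)
  · simpa using h (show e.symm x ∈ N'.comap e.toLinearMap by simpa using hx)

/-- A module is uniserial or zero. -/
def IsUniserialOrZero (R : Type u) [Ring R] (M : Type u) [AddCommGroup M] [Module R M] : Prop :=
  ∀ N N' : Submodule R M, N ≤ N' ∨ N' ≤ N

theorem IsUniserialOrZero.of_surjective (f : M →ₗ[R] M') (hf : Function.Surjective f)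
    (h : IsUniserialOrZero R M) : IsUniserialOrZero R M' := by
  intro N N'
  have := h (N.comap f) (N'.comap f)
  exact this.imp (Submodule.comap_le_comap_iff_of_surjective hf).1
    (Submodule.comap_le_comap_iff_of_surjective hf).1

theorem IsUniserialOrZero.of_injective (f : M →ₗ[R] M') (hf : Function.Injective f)
    (h : IsUniserialOrZero R M') : IsUniserialOrZero R M := by
  intro N N'
  exact (h (N.map f) (N'.map f)).imp (Submodule.map_le_map_iff_of_injective hf _ _).1
    (Submodule.map_le_map_iff_of_injective hf _ _).1

/-- Zero summands are discarded, which is why the count is only an upper bound and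
`IsUniserialOrZero` suffices for the summands. -/
theorem isSumOfUniserials_of_iSupIndep {ι : Type} [Fintype ι] {n : ℕ} (hn : Fintype.card ι ≤ n)
    (U : ι → Submodule R M) (hi : iSupIndep U) (ht : iSup U = ⊤)
    (hU : ∀ i, IsUniserialOrZero R (U i)) : IsSumOfUniserials R n M := by
  classical
  let κ := {i : ι // U i ≠ ⊥}
  let e : Fin (Fintype.card κ) ≃ κ := (Fintype.equivFin κ).symm
  refine ⟨Fintype.card κ, (Fintype.card_subtype_le _).trans hn, fun j => U (e j).1, ?_, fun j => ?_⟩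
  · refine DirectSum.isInternal_submodule_of_iSupIndep_of_iSup_eq_top ?_ ?_
    · exact hi.comp (Subtype.val_injective.comp e.injective)
    · rw [← ht, ← iSup_ne_bot_subtype U]
      exact e.iSup_comp (g := fun i : κ => U i.1)
  · exact ⟨Submodule.nontrivial_iff_ne_bot.2 (e j).2, hU _⟩

theorem IsSumOfUniserials.of_equiv {n : ℕ} (e : M ≃ₗ[R] M') (h : IsSumOfUniserials R n M) :
    IsSumOfUniserials R n M' := by
  obtain ⟨m, hm, U, hU, hu⟩ := h
  have h2 := hU.submodule_iSupIndep
  have h3 := hU.submodule_iSup_eq_top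
  refine isSumOfUniserials_of_iSupIndep (ι := Fin m) (by simpa using hm)
    (fun i => (U i).map e.toLinearMap) ?_ ?_ fun i => ?_
  · exact h2.map_orderIso (Submodule.orderIsoMapComap e)
  · rw [← Submodule.map_iSup, h3, Submodule.map_top, LinearEquiv.range]
  · exact ((hu i).of_equiv (e.submoduleMap (U i))).2

/-- By `h0` the kernel of `g` contains the components of its elements, and this is exactly the
independence of the images of the factors. -/
theorem isSumOfUniserials_of_surjective {ι : Type} [Fintype ι] [DecidableEq ι] {n : ℕ}
    (hn : Fintype.card ι ≤ n) {P : ι → Type u} [∀ i, AddCommGroup (P i)] [∀ i, Module R (P i)]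
    (g : (∀ i, P i) →ₗ[R] M) (hg : Function.Surjective g)
    (h0 : ∀ y, g y = 0 → ∀ i, g (LinearMap.single R P i (y i)) = 0)
    (hU : ∀ i, IsUniserialOrZero R (LinearMap.range (g ∘ₗ LinearMap.single R P i))) :
    IsSumOfUniserials R n M := by
  have hsum : ∀ y, g y = ∑ i, g (LinearMap.single R P i (y i)) := fun y => by
    rw [← map_sum]
    congr 1
    ext i
    simp
  refine isSumOfUniserials_of_iSupIndep hn
    (fun i => LinearMap.range (g ∘ₗ LinearMap.single R P i)) ?_ ?_ hU
  · rw [iSupIndep_iff_finsetSum_eq_zero_imp_eq_zero]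
    intro s v hv hv0 i hi
    choose y hy using hv
    let y' : ∀ i, P i := fun i => if hi : i ∈ s then y i hi else 0
    have hy' : ∀ i (hi : i ∈ s), g (LinearMap.single R P i (y' i)) = v i := fun i hi => by
      rw [← hy i hi]
      simp only [y', dif_pos hi]
      rfl
    rw [← hy' i hi]
    refine h0 y' ?_ i
    rw [hsum, ← hv0, ← Finset.sum_subset (Finset.subset_univ s) fun i _ hi => by simp [y', hi]]
    exact Finset.sum_congr rfl hy'
  · refine eq_top_iff.2 fun x _ => ?_
    obtain ⟨y, rfl⟩ := hg x
    rw [hsum]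
    exact Submodule.sum_mem _ fun i _ => Submodule.mem_iSup_of_mem i ⟨y i, rfl⟩

theorem isSumOfUniserials_range {ι : Type} [Fintype ι] [DecidableEq ι] {n : ℕ}
    (hn : Fintype.card ι ≤ n) {P : ι → Type u} [∀ i, AddCommGroup (P i)] [∀ i, Module R (P i)]
    (g : (∀ i, P i) →ₗ[R] M) (h0 : ∀ y, g y = 0 → ∀ i, g (LinearMap.single R P i (y i)) = 0)
    (hU : ∀ i, IsUniserialOrZero R (LinearMap.range (g ∘ₗ LinearMap.single R P i))) :
    IsSumOfUniserials R n (LinearMap.range g) := by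
  refine isSumOfUniserials_of_surjective hn g.rangeRestrict g.surjective_rangeRestrict
    (fun y hy i => Subtype.ext (h0 y (congrArg Subtype.val hy) i)) fun i => ?_
  refine (hU i).of_injective (LinearMap.codRestrict (LinearMap.range (g ∘ₗ LinearMap.single R P i))
    ((LinearMap.range g).subtype ∘ₗ
    Submodule.subtype _) ?_) fun x y h =>
      Subtype.ext (Subtype.ext (Subtype.ext_iff.1 h :))
  rintro ⟨_, y, rfl⟩
  exact ⟨y, rfl⟩

/-- A submodule of a product that contains the components of its elements is the product of its
projections. This version serves the coresolution, where the image is known as a submodule of the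
target. -/
theorem isSumOfUniserials_of_single_mem {ι : Type} [Fintype ι] [DecidableEq ι] {n : ℕ}
    (hn : Fintype.card ι ≤ n) {P : ι → Type u} [∀ i, AddCommGroup (P i)] [∀ i, Module R (P i)]
    (S : Submodule R (∀ i, P i)) (hS : ∀ y ∈ S, ∀ i, LinearMap.single R P i (y i) ∈ S)
    (hU : ∀ i, IsUniserialOrZero R (S.map (LinearMap.proj i))) :
    IsSumOfUniserials R n S := by
  have hmem : ∀ y : (∀ i, S.map (LinearMap.proj i : (∀ i, P i) →ₗ[R] P i)),
      (fun i => (y i : P i)) ∈ S := fun y => by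
    have : (fun i => (y i : P i)) = ∑ i, LinearMap.single R P i (y i : P i) := by
      ext i
      simp
    rw [this]
    refine Submodule.sum_mem _ fun i _ => ?_
    obtain ⟨z, hz, hzi⟩ := (y i).2
    rw [← hzi]
    exact hS z hz i
  let g : (∀ i, S.map (LinearMap.proj i : (∀ i, P i) →ₗ[R] P i)) →ₗ[R] S :=
    { toFun := fun y => ⟨fun i => (y i : P i), hmem y⟩
      map_add' := fun _ _ => rfl
      map_smul' := fun _ _ => rfl }
  refine isSumOfUniserials_of_surjective hn g (fun x => ?_) (fun y hy i => ?_) fun i => ?_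
  · exact ⟨fun i => ⟨x.1 i, x.1, x.2, rfl⟩, rfl⟩
  · have : y = 0 := by
      ext i
      exact congrFun (congrArg Subtype.val hy) i
    rw [this, Pi.zero_apply, map_zero, map_zero]
  · exact (hU i).of_surjective _ (LinearMap.surjective_rangeRestrict _)

end Sums

/-! ### The radical, one-dimensional simple modules, and criteria for minimality -/

section Radical

variable {k Q : Type u} [Field k] [Fintype Q] [Quiver.{u} Q]
  {I : TwoSidedIdeal (PathAlgebra k Q)}

open PathAlgebra MulOpposite

/-- Elements of `I` are combinations of paths of length at least two, and such combinations have no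
coefficient at a shorter path. -/
theorem isNonzero_of_length_le (hI : IsStringPresentation I) (q : QPath Q)
    (h : q.2.2.length ≤ 1) : IsNonzero I q.2.2 := by
  intro hq
  have key : ∀ f ∈ Submodule.span k {g : PathAlgebra k Q | ∃ p : QPath Q, 2 ≤ p.2.2.length ∧
      g = PathAlgebra.of p}, toFinsupp (k := k) f q = 0 := by
    intro f hf
    induction hf using Submodule.span_induction with
    | mem f hf =>
      obtain ⟨p, hp, rfl⟩ := hf
      rw [toFinsupp_of, Finsupp.single_eq_of_ne]
      rintro rfl
      omega
    | zero => simp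
    | add f g _ _ hf hg => simp [hf, hg]
    | smul r f _ hf => simp [hf]
  have := key _ (hI.le_sq _ hq)
  rw [show (⟨q.1, q.2.1, q.2.2⟩ : QPath Q) = q from rfl, toFinsupp_of, Finsupp.single_eq_same] at this
  exact one_ne_zero this

theorem isNonzero_nil (hI : IsStringPresentation I) (x : Q) : IsNonzero I (Path.nil : Path x x) :=
  isNonzero_of_length_le hI ⟨x, x, Path.nil⟩ (Nat.zero_le _)

theorem qcls_eq_zero (q : QPath Q) (h : ¬ IsNonzero I q.2.2) : qcls I q = 0 :=
  Ideal.Quotient.eq_zero_iff_mem.2 (not_not.1 h)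

theorem one_eq_sum : (1 : BoundAlgebra I) = ∑ x, idem I x := by
  unfold idem cls
  rw [← map_sum]
  rfl

theorem exists_bound (hI : IsStringPresentation I) :
    ∃ N : ℕ, ∀ q : QPath Q, N ≤ q.2.2.length → qcls I q = 0 := by
  obtain ⟨N, hN⟩ := hI.pow_le
  exact ⟨N, fun q hq => qcls_eq_zero q fun h => h (hN q hq)⟩

theorem idem_mul_idem (x : Q) : idem I x * idem I x = idem I x := cls_mul_cls I _ _

omit [Fintype Q] in
theorem eq_nil_of_length {q : QPath Q} (h : q.2.2.length = 0) : q = toQ (Path.nil : Path q.1 q.1) := by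
  obtain ⟨a, b, f⟩ := q
  cases f with
  | nil => rfl
  | cons f e => simp at h

omit [Fintype Q] in
theorem qcomp_nil (q : QPath Q) : QComp q (toQ (Path.nil : Path q.2.1 q.2.1)) q :=
  QComp.mk q.2.2 Path.nil

omit [Fintype Q] in
theorem nil_qcomp (q : QPath Q) : QComp (toQ (Path.nil : Path q.1 q.1)) q q := by
  have h := QComp.mk (Path.nil : Path q.1 q.1) q.2.2
  rwa [Path.nil_comp] at h

/-- The coefficient of the stationary path at a point is multiplicative. -/
theorem coeffs_nil_mul (hI : IsStringPresentation I) (x : Q) (a b : BoundAlgebra I) :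
    coeffs hI (a * b) (toQ (Path.nil : Path x x)) =
      coeffs hI a (toQ (Path.nil : Path x x)) * coeffs hI b (toQ (Path.nil : Path x x)) := by
  classical
  induction a using qcls_induction with
  | zero => simp
  | add a a' h h' => rw [add_mul, map_add, map_add, Pi.add_apply, Pi.add_apply, h, h', add_mul]
  | cls r q =>
    rw [smul_mul_assoc, map_smul, map_smul, Pi.smul_apply, Pi.smul_apply, smul_eq_mul, smul_eq_mul,
      mul_assoc]
    congr 1
    rw [coeffs_qcls]
    split_ifs with h
    · rw [← h.2, one_mul]
      exact coeffs_qcls_mul hI b (nil_qcomp (toQ (Path.nil : Path x x))) (isNonzero_nil hI x)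
    · rw [zero_mul]
      refine coeffs_qcls_mul_of_not hI b fun hi => h ⟨isNonzero_nil hI x, ?_⟩
      exact (PathSys.init_e (S := quiverSys I) hi).symm

/-- The one-dimensional module at a point. -/
def PointModule (_ : IsStringPresentation I) (_ : Q) : Type u := k

instance (hI : IsStringPresentation I) (x : Q) : AddCommGroup (PointModule hI x) :=
  inferInstanceAs (AddCommGroup k)

/-- The coefficient of the stationary path at a point, as a ring homomorphism. -/
def pointHom (hI : IsStringPresentation I) (x : Q) : (BoundAlgebra I)ᵐᵒᵖ →+* k where
  toFun a := coeffs hI a.unop (toQ (Path.nil : Path x x))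
  map_one' := by
    classical
    have h := coeffs_nil_mul hI x 1 (idem I x)
    rwa [one_mul, idem_eq, coeffs_qcls, if_pos ⟨isNonzero_nil hI x, rfl⟩, mul_one, eq_comm] at h
  map_mul' a b := by rw [unop_mul, coeffs_nil_mul, mul_comm]
  map_zero' := by simp
  map_add' a b := by simp

instance (hI : IsStringPresentation I) (x : Q) : Module (BoundAlgebra I)ᵐᵒᵖ (PointModule hI x) :=
  Module.compHom k (pointHom hI x)

/-- The identity map of the underlying field. -/
def PointModule.val {hI : IsStringPresentation I} {x : Q} : PointModule hI x ≃+ k := AddEquiv.refl k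

theorem PointModule.val_smul {hI : IsStringPresentation I} {x : Q} (a : (BoundAlgebra I)ᵐᵒᵖ)
    (r : PointModule hI x) :
    (a • r).val = coeffs hI a.unop (toQ (Path.nil : Path x x)) * r.val := rfl

variable {M : Type u} [AddCommGroup M] [Module (BoundAlgebra I)ᵐᵒᵖ M]

theorem op_qcls_smul {p q r : QPath Q} (h : QComp p q r) (m : M) :
    op (qcls I q) • op (qcls I p) • m = op (qcls I r) • m := by
  rw [smul_smul, ← op_mul, qcls_mul I h]

theorem op_qcls_smul_of_ne {p q : QPath Q} (h : q.1 ≠ p.2.1) (m : M) :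
    op (qcls I q) • op (qcls I p) • m = 0 := by
  rw [smul_smul, ← op_mul, qcls_mul_of_ne I h, op_zero, zero_smul]

theorem sum_idem_smul (m : M) : ∑ x, op (idem I x) • m = m := by
  rw [← Finset.sum_smul]
  refine Eq.trans (congrArg (· • m) ?_) (one_smul _ m)
  exact (map_sum opAddEquiv _ _).symm.trans (congrArg op (one_eq_sum (I := I)).symm)

variable (I) in
/-- An element is killed by the radical. -/
def Killed (m : M) : Prop := ∀ q : QPath Q, q.2.2.length ≠ 0 → op (qcls I q) • m = 0

/-- For a longest path `q` with `m q` non-zero, any non-stationary path acts as zero on `m q`, since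
it would lead to a longer path of this kind. -/
theorem exists_killed (hI : IsStringPresentation I) {m : M} (hm : m ≠ 0) :
    ∃ q : QPath Q, op (qcls I q) • m ≠ 0 ∧ Killed I (op (qcls I q) • m) := by
  classical
  obtain ⟨N, hN⟩ := exists_bound hI
  -- The number `n` is the defect of the length from the bound `N`, so minimising it selects a
  -- longest path; a stationary path with `n = N` starts the search.
  have h0 : ∃ n, ∃ q : QPath Q, n + q.2.2.length = N ∧ op (qcls I q) • m ≠ 0 := by
    have : ∃ x : Q, op (idem I x) • m ≠ 0 := by
      by_contra! h
      exact hm (by rw [← sum_idem_smul (I := I) m, Finset.sum_eq_zero fun x _ => h x])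
    obtain ⟨x, hx⟩ := this
    exact ⟨N, toQ (Path.nil : Path x x), rfl, hx⟩
  obtain ⟨q, hq, hne⟩ := Nat.find_spec h0
  refine ⟨q, hne, fun r hr => ?_⟩
  by_cases h : r.1 = q.2.1
  · obtain ⟨s, hs⟩ := exists_comp h
    rw [op_qcls_smul hs]
    by_contra hne'
    have hl : s.2.2.length = q.2.2.length + r.2.2.length := by
      cases hs; exact Path.length_comp _ _
    have hlt : s.2.2.length < N := by
      by_contra! hle
      exact hne' (by rw [hN s hle, op_zero, zero_smul])
    exact Nat.find_min h0 (m := N - s.2.2.length) (by omega) ⟨s, by omega, hne'⟩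
  · exact op_qcls_smul_of_ne h m

/-- Every non-zero submodule contains a non-zero element killed by the radical, so a submodule
containing all such elements is essential. -/
theorem isEssential_of_killed (hI : IsStringPresentation I)
    {K : Submodule (BoundAlgebra I)ᵐᵒᵖ M} (h : ∀ m : M, Killed I m → m ∈ K) : IsEssential K := by
  intro L hL
  refine eq_bot_iff.2 fun m hm => ?_
  by_contra hne
  obtain ⟨q, hq, hk⟩ := exists_killed hI hne
  have : op (qcls I q) • m ∈ K ⊓ L := ⟨h _ hk, L.smul_mem _ hm⟩
  rw [hL] at this
  exact hq this

variable (I M) in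
/-- A module over the algebra, as a vector space. -/
abbrev scalarModule : Module k M := Module.compHom M (algebraMap k (BoundAlgebra I)ᵐᵒᵖ)

/-- A form of Nakayama's lemma: nilpotency of the radical keeps `L + M rad A` proper, and modulo
this submodule the algebra acts through the coefficients of the stationary paths. No finiteness of
`M` is needed. -/
theorem exists_functional (hI : IsStringPresentation I) {L : Submodule (BoundAlgebra I)ᵐᵒᵖ M}
    (hL : L ≠ ⊤) :
    ∃ (x : Q) (f : M →ₗ[(BoundAlgebra I)ᵐᵒᵖ] PointModule hI x), f ≠ 0 ∧ L ≤ LinearMap.ker f := by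
  classical
  let _ := scalarModule I M
  have hsmul : ∀ (c : k) (m : M), c • m = algebraMap k (BoundAlgebra I)ᵐᵒᵖ c • m := fun _ _ => rfl
  have hop : ∀ (c : k) (a : BoundAlgebra I) (m : M), op (c • a) • m = c • op a • m := by
    intro c a m
    rw [op_smul, Algebra.smul_def, mul_smul, hsmul]
  have hcomm : ∀ (c : k) (a : (BoundAlgebra I)ᵐᵒᵖ) (m : M), a • c • m = c • a • m := by
    intro c a m
    rw [hsmul, hsmul, smul_smul, smul_smul, Algebra.commutes]
  let L' : Submodule k M :=
    { carrier := L
      zero_mem' := L.zero_mem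
      add_mem' := L.add_mem
      smul_mem' := fun c m hm => L.smul_mem _ hm }
  let J : Submodule k M :=
    L' ⊔ Submodule.span k {y | ∃ (q : QPath Q) (m : M), q.2.2.length ≠ 0 ∧ y = op (qcls I q) • m}
  -- For a longest path `q` with `M q` not contained in `L`, acting by `q` sends `J` into `L`,
  -- because a non-stationary path followed by `q` is longer or zero. An element `m` with `m q`
  -- outside `L` is therefore outside `J`.
  have hJ : ∃ m, m ∉ J := by
    obtain ⟨N, hN⟩ := exists_bound hI
    have h0 : ∃ n, ∃ q : QPath Q, n + q.2.2.length = N ∧ ∃ m, op (qcls I q) • m ∉ L := by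
      obtain ⟨m, hm⟩ : ∃ m, m ∉ L := by
        by_contra! h
        exact hL (eq_top_iff.2 fun m _ => h m)
      have : ∃ x : Q, op (idem I x) • m ∉ L := by
        by_contra! h
        exact hm (by rw [← sum_idem_smul (I := I) m]; exact Submodule.sum_mem _ fun x _ => h x)
      obtain ⟨x, hx⟩ := this
      exact ⟨N, toQ (Path.nil : Path x x), rfl, m, hx⟩
    obtain ⟨q, hq, m, hne⟩ := Nat.find_spec h0
    refine ⟨m, fun hm => hne ?_⟩
    obtain ⟨l, hl, y, hy, rfl⟩ := Submodule.mem_sup.1 hm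
    rw [smul_add]
    refine L.add_mem (L.smul_mem _ hl) ?_
    clear hm hne
    induction hy using Submodule.span_induction with
    | mem y hy =>
      obtain ⟨r, m', hr, rfl⟩ := hy
      by_cases h : q.1 = r.2.1
      · obtain ⟨s, hs⟩ := exists_comp h
        rw [op_qcls_smul hs]
        by_contra hne'
        have hl : s.2.2.length = r.2.2.length + q.2.2.length := by
          cases hs; exact Path.length_comp _ _
        have hlt : s.2.2.length < N := by
          by_contra! hle
          exact hne' (by rw [hN s hle, op_zero, zero_smul]; exact L.zero_mem)
        exact Nat.find_min h0 (m := N - s.2.2.length) (by omega) ⟨s, by omega, _, hne'⟩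
      · rw [op_qcls_smul_of_ne h]
        exact L.zero_mem
    | zero => rw [smul_zero]; exact L.zero_mem
    | add y z _ _ hy hz => rw [smul_add]; exact L.add_mem hy hz
    | smul c y _ hy => rw [hcomm]; exact L.smul_mem _ hy
  obtain ⟨m, hm⟩ := hJ
  obtain ⟨x, hx⟩ : ∃ x : Q, op (idem I x) • m ∉ J := by
    by_contra! h
    exact hm (by rw [← sum_idem_smul (I := I) m]; exact Submodule.sum_mem _ fun x _ => h x)
  -- A linear form that vanishes on `J` but not at `m e_x` becomes a module homomorphism when
  -- composed with the action of `e_x`: of all paths, only the stationary one at `x` survives.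
  obtain ⟨f, hf, hfJ⟩ := Submodule.exists_le_ker_of_notMem hx
  have hfL : ∀ l ∈ L, f l = 0 := fun l hl => hfJ (Submodule.mem_sup_left hl)
  have hfq : ∀ (q : QPath Q) (m : M), q.2.2.length ≠ 0 → f (op (qcls I q) • m) = 0 :=
    fun q m hq => hfJ (Submodule.mem_sup_right (Submodule.subset_span ⟨q, m, hq, rfl⟩))
  have key : ∀ (a : BoundAlgebra I) (m : M), f (op (idem I x) • op a • m) =
      coeffs hI a (toQ (Path.nil : Path x x)) * f (op (idem I x) • m) := by
    intro a m
    induction a using qcls_induction with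
    | zero => simp
    | add a b ha hb => rw [op_add, add_smul, smul_add, map_add, ha, hb, map_add, Pi.add_apply, add_mul]
    | cls r q =>
      rw [hop, hcomm, f.map_smul, (coeffs hI).map_smul, Pi.smul_apply, smul_eq_mul, smul_eq_mul,
        mul_assoc]
      congr 1
      rw [coeffs_qcls, idem_eq]
      split_ifs with h
      · rw [← h.2, op_qcls_smul (qcomp_nil (toQ (Path.nil : Path x x))), one_mul]
      · rw [zero_mul]
        by_cases hq : x = q.2.1
        · subst hq
          rw [op_qcls_smul (qcomp_nil q)]
          refine hfq q m fun h0 => h ⟨isNonzero_nil hI _, ?_⟩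
          obtain ⟨a, b, p⟩ := q
          cases p with
          | nil => rfl
          | cons p e => simp at h0
        · rw [op_qcls_smul_of_ne hq, map_zero]
  refine ⟨x, { toFun := fun m => f (op (idem I x) • m), map_add' := ?_, map_smul' := ?_ }, ?_, ?_⟩
  · intro y z
    exact (congrArg f (smul_add _ y z)).trans (map_add f _ _)
  · exact fun a y => key a.unop y
  · exact fun h => hf (LinearMap.congr_fun h m)
  · exact fun l hl => hfL _ (L.smul_mem _ hl)

/-- A proper supplement of `K` would lie in the kernel of a non-zero map to a simple module; this
map also kills `K`, hence everything. -/
theorem isSuperfluous_of_functional (hI : IsStringPresentation I)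
    {K : Submodule (BoundAlgebra I)ᵐᵒᵖ M}
    (h : ∀ (x : Q) (f : M →ₗ[(BoundAlgebra I)ᵐᵒᵖ] PointModule hI x), K ≤ LinearMap.ker f) :
    IsSuperfluous K := by
  intro L hL
  by_contra hne
  obtain ⟨x, f, hf, hLf⟩ := exists_functional hI hne
  refine hf (LinearMap.ker_eq_top.1 (top_le_iff.1 ?_))
  rw [← hL]
  exact sup_le (h x f) hLf

end Radical

/-! ### Uniserial cyclic modules -/

section Cyclic

variable {k Q : Type u} [Field k] [Fintype Q] [Quiver.{u} Q]
  {I : TwoSidedIdeal (PathAlgebra k Q)}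

open PathAlgebra MulOpposite

variable {M : Type u} [AddCommGroup M] [Module (BoundAlgebra I)ᵐᵒᵖ M]

theorem op_smul_eq_zero (hI : IsStringPresentation I) (a : BoundAlgebra I) (m : M)
    (h : ∀ q : QPath Q, IsNonzero I q.2.2 → coeffs hI a q ≠ 0 → op (qcls I q) • m = 0) :
    op a • m = 0 := by
  classical
  have hfin := finite_nonzero hI
  have ha : a = ∑ q ∈ hfin.toFinset, coeffs hI a q • qcls I q := by
    refine coeffs_inj hI fun q hq => ?_
    rw [map_sum, Finset.sum_apply, Finset.sum_eq_single q]
    · rw [map_smul, Pi.smul_apply, coeffs_qcls, if_pos ⟨hq, rfl⟩, smul_eq_mul, mul_one]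
    · intro b _ hb
      rw [map_smul, Pi.smul_apply, coeffs_qcls, if_neg fun h => hb h.2.symm, smul_zero]
    · exact fun h => absurd (hfin.mem_toFinset.2 hq) h
  rw [ha, Finset.op_sum, Finset.sum_smul]
  refine Finset.sum_eq_zero fun q hq => ?_
  by_cases h0 : coeffs hI a q = 0
  · rw [h0, zero_smul, op_zero, zero_smul]
  · rw [op_smul, Algebra.smul_def, mul_smul, h q (hfin.mem_toFinset.1 hq) h0, smul_zero]

/-- A cyclic module on whose generator only the initial subpaths of a path act non-trivially is
uniserial or zero. -/
theorem isUniserialOrZero_of_path (hI : IsStringPresentation I) {p : QPath Q} {g : M}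
    (hg : ∀ m, ∃ a : BoundAlgebra I, m = op a • g)
    (hp : ∀ q, ¬ (quiverSys I).Init q p → op (qcls I q) • g = 0) :
    IsUniserialOrZero (BoundAlgebra I)ᵐᵒᵖ M := by
  classical
  -- Every non-zero element generates the same submodule as `g q` for some initial subpath `q` of
  -- `p`: if the element is `g a`, a shortest such `q` in the support of `a` will do.
  have key : ∀ m : M, m ≠ 0 → ∃ q, (quiverSys I).Init q p ∧
      Submodule.span (BoundAlgebra I)ᵐᵒᵖ {m} =
        Submodule.span (BoundAlgebra I)ᵐᵒᵖ {op (qcls I q) • g} := by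
    intro m hm
    obtain ⟨a, rfl⟩ := hg m
    have h0 : ∃ n, ∃ q : QPath Q, q.2.2.length = n ∧ IsNonzero I q.2.2 ∧ coeffs hI a q ≠ 0 ∧
        (quiverSys I).Init q p := by
      by_contra! h
      refine hm (op_smul_eq_zero hI a g fun q hq hq' => hp q (h _ q rfl hq hq'))
    obtain ⟨q, hql, hq, hqa, hqp⟩ := Nat.find_spec h0
    -- Dividing the part of `a` supported on paths through `q` by `q` gives `b`, whose stationary
    -- coefficient is the coefficient of `a` at `q`.
    obtain ⟨b, -, hb⟩ := (quiverAlg I hI).exists_div (some (q, toQ (Path.nil : Path q.2.1 q.2.1)))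
      (fun T hT => by obtain rfl := Option.some.inj hT; rfl) a
    rw [PathAlg.co_some, alg_mul, alg_cl, alg_cf] at hb
    have hcov : ∀ r, (quiverSys I).Covers (some (q, toQ (Path.nil : Path q.2.1 q.2.1))) r ↔
        (quiverSys I).Init q r := fun r =>
      ⟨fun ⟨T, hT, h⟩ => by obtain rfl := Option.some.inj hT; exact h, fun h => ⟨_, rfl, h⟩⟩
    -- Only coefficients at initial subpaths of `p` count. Those that do not begin with `q` are
    -- shorter than `q`, so by minimality they are absent from `a`.
    have hm' : op a • g = op b • op (qcls I q) • g := by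
      rw [smul_smul, ← op_mul, ← sub_eq_zero, ← sub_smul, ← op_sub]
      refine op_smul_eq_zero hI _ g fun r hr hne => hp r fun hrp => hne ?_
      rw [map_sub, Pi.sub_apply, sub_eq_zero]
      by_cases hqr : (quiverSys I).Init q r
      · exact (hb r hr ((hcov r).2 hqr)).symm
      · rw [coeffs_qcls_mul_of_not hI b hqr]
        by_contra hra
        rcases le_total q.2.2.length r.2.2.length with hl | hl
        · exact hqr (PathSys.Init.total hqp hrp hl)
        · rcases hl.lt_or_eq with hl | hl
          · exact Nat.find_min h0 (hl.trans_le hql.le) ⟨r, rfl, hr, hra, hrp⟩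
          · exact hqr (PathSys.Init.total hqp hrp hl.ge)
    have hbe : coeffs hI b (toQ (Path.nil : Path q.2.1 q.2.1)) ≠ 0 := by
      rw [← coeffs_qcls_mul hI b (qcomp_nil q) hq,
        hb q hq ((hcov q).2 (PathSys.Init.refl q))]
      exact hqa
    refine ⟨q, hqp, le_antisymm ?_ ?_⟩
    · rw [Submodule.span_singleton_le_iff_mem, hm']
      exact Submodule.smul_mem _ _ (Submodule.mem_span_singleton_self _)
    · set G := Submodule.span (BoundAlgebra I)ᵐᵒᵖ {op (qcls I q) • g} with hG
      let g' : G := ⟨_, Submodule.mem_span_singleton_self _⟩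
      -- The stationary coefficient of `b` is non-zero, so `b` moves the generator of `G` to an
      -- element outside the radical of `G`, and this element generates `G`.
      let L : Submodule (BoundAlgebra I)ᵐᵒᵖ G := (Submodule.span (BoundAlgebra I)ᵐᵒᵖ {op a • g}).comap G.subtype
      have hL : L = ⊤ := by
        by_contra hne
        obtain ⟨x, f, hf, hLf⟩ := exists_functional hI hne
        have h1 : f (op b • g') = 0 := hLf (show G.subtype (op b • g') ∈
            Submodule.span (BoundAlgebra I)ᵐᵒᵖ {op a • g} by
          rw [show G.subtype (op b • g') = op a • g from hm'.symm]
          exact Submodule.mem_span_singleton_self _)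
        have hfg : f g' ≠ 0 := by
          intro h
          refine hf (LinearMap.ext ?_)
          rintro ⟨y, hy⟩
          obtain ⟨c, rfl⟩ := Submodule.mem_span_singleton.1 hy
          exact (map_smul f c g').trans (by rw [h, smul_zero]; rfl)
        have hg' : op (idem I q.2.1) • g' = g' := Subtype.ext (op_qcls_smul (qcomp_nil q) g)
        have hx : x = q.2.1 := by
          by_contra hx
          refine hfg (PointModule.val.injective ?_)
          rw [← hg', map_smul, PointModule.val_smul, unop_op, idem_eq, coeffs_qcls,
            if_neg fun h => hx (congrArg Sigma.fst h.2), zero_mul, map_zero]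
        subst hx
        rw [map_smul] at h1
        have h2 := congrArg PointModule.val h1
        rw [PointModule.val_smul, map_zero, unop_op, mul_eq_zero] at h2
        exact h2.elim hbe fun h => hfg (PointModule.val.injective (h.trans (map_zero _).symm))
      rw [hG, Submodule.span_singleton_le_iff_mem]
      exact (hL ▸ Submodule.mem_top : g' ∈ L)
  have chain : ∀ q q' : QPath Q, (quiverSys I).Init q q' →
      Submodule.span (BoundAlgebra I)ᵐᵒᵖ {op (qcls I q') • g} ≤
        Submodule.span (BoundAlgebra I)ᵐᵒᵖ {op (qcls I q) • g} := by
    rintro q q' ⟨r, hr⟩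
    rw [Submodule.span_singleton_le_iff_mem, ← op_qcls_smul hr]
    exact Submodule.smul_mem _ _ (Submodule.mem_span_singleton_self _)
  intro N N'
  -- Elements witnessing that `N` and `N'` are incomparable would generate incomparable cyclic
  -- submodules, whereas initial subpaths of `p` form a chain.
  by_contra! h
  obtain ⟨m, hm, hm'⟩ := SetLike.not_le_iff_exists.1 h.1
  obtain ⟨n, hn, hn'⟩ := SetLike.not_le_iff_exists.1 h.2
  obtain ⟨q, hq, hqm⟩ := key m fun h => hm' (h ▸ N'.zero_mem)
  obtain ⟨r, hr, hrn⟩ := key n fun h => hn' (h ▸ N.zero_mem)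
  rcases le_total q.2.2.length r.2.2.length with hl | hl
  · have := chain q r (PathSys.Init.total hq hr hl)
    rw [← hqm, ← hrn, Submodule.span_singleton_le_iff_mem] at this
    exact hn' ((Submodule.span_singleton_le_iff_mem m N).2 hm this)
  · have := chain r q (PathSys.Init.total hr hq hl)
    rw [← hqm, ← hrn, Submodule.span_singleton_le_iff_mem] at this
    exact hm' ((Submodule.span_singleton_le_iff_mem n N').2 hn this)

theorem isUniserialOrZero_range_of_path (hI : IsStringPresentation I) {N : Type u} [AddCommGroup N]
    [Module (BoundAlgebra I)ᵐᵒᵖ N] (g : N →ₗ[(BoundAlgebra I)ᵐᵒᵖ] M) {p : QPath Q} {n : N}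
    (hn : ∀ m, ∃ a : BoundAlgebra I, m = op a • n)
    (hp : ∀ q, ¬ (quiverSys I).Init q p → g (op (qcls I q) • n) = 0) :
    IsUniserialOrZero (BoundAlgebra I)ᵐᵒᵖ (LinearMap.range g) := by
  refine isUniserialOrZero_of_path hI (p := p) (g := g.rangeRestrict n) ?_ fun q hq => ?_
  · rintro ⟨_, m, rfl⟩
    obtain ⟨a, rfl⟩ := hn m
    exact ⟨a, map_smul g.rangeRestrict _ _⟩
  · rw [← map_smul]
    exact Subtype.ext (hp q hq)

end Cyclic

/-! ### Projectivity of `P(x)` and injectivity of `I(x)` -/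

section ProjInj

variable {k Q : Type u} [Field k] [Fintype Q] [Quiver.{u} Q]
  {I : TwoSidedIdeal (PathAlgebra k Q)}

open PathAlgebra MulOpposite

/-- The generator of `P(x)`. -/
def projGen (x : Q) : Proj I x := ⟨idem I x, Submodule.mem_span_singleton_self _⟩

theorem op_smul_projGen {x : Q} (a : Proj I x) : op (a : BoundAlgebra I) • projGen x = a :=
  Subtype.ext (mem_proj_iff.1 a.2)

/-- `P(x)` is a direct summand of the regular module: left multiplication by `e_x` splits the
inclusion. -/
instance (x : Q) : Module.Projective (BoundAlgebra I)ᵐᵒᵖ (Proj I x) := by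
  refine Module.Projective.of_split
    (R := (BoundAlgebra I)ᵐᵒᵖ) (M := (BoundAlgebra I)ᵐᵒᵖ) (P := Proj I x)
    { toFun := fun a => op (a : BoundAlgebra I), map_add' := fun _ _ => rfl, map_smul' := fun _ _ => rfl }
    (LinearMap.toSpanSingleton _ _ (projGen x)) ?_
  ext a
  exact congrArg Subtype.val (op_smul_projGen a)

namespace Inj

variable {x : Q}

/-- The element of `I(x)` given by a linear form on the algebra. -/
def mk (φ : BoundAlgebra I →ₗ[k] k) : Inj I x :=
  (φ.comp ((LeftProj I x).subtype.restrictScalars k) : LeftProj I x →ₗ[k] k)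

/-- The evaluation of an element of `I(x)`, as a linear form on the algebra. -/
def toLin (f : Inj I x) : BoundAlgebra I →ₗ[k] k where
  toFun := f.eval
  map_add' a b := by
    unfold eval
    rw [← map_add]
    exact congrArg _ (Subtype.ext (add_mul a b _))
  map_smul' r a := by
    unfold eval
    rw [RingHom.id_apply, ← map_smul]
    exact congrArg _ (Subtype.ext (smul_mul_assoc r a _))

theorem toLin_apply (f : Inj I x) (a : BoundAlgebra I) : f.toLin a = f.eval a := rfl

theorem eval_mk (φ : BoundAlgebra I →ₗ[k] k) (a : BoundAlgebra I) :
    (mk φ : Inj I x).eval a = φ (a * idem I x) := rfl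

theorem eval_mul_idem (f : Inj I x) (a : BoundAlgebra I) : f.eval (a * idem I x) = f.eval a :=
  congrArg f.form (Subtype.ext ((mul_assoc _ _ _).trans (congrArg (a * ·) (idem_mul_idem x))))

theorem eval_smul (b : BoundAlgebra I) (f : Inj I x) (a : BoundAlgebra I) :
    (op b • f).eval a = f.eval (b * a) :=
  congrArg f.form (Subtype.ext (mul_assoc b a _).symm)

theorem eval_add (f g : Inj I x) (a : BoundAlgebra I) : (f + g).eval a = f.eval a + g.eval a := rfl

theorem eval_zero (a : BoundAlgebra I) : (0 : Inj I x).eval a = 0 := rfl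

theorem ext {f g : Inj I x} (h : ∀ a ∈ LeftProj I x, f.eval a = g.eval a) : f = g := by
  refine LinearMap.ext fun a => ?_
  have ha := mem_leftProj_iff.1 a.2
  have := h a a.2
  unfold eval at this
  rwa [show (⟨(a : BoundAlgebra I) * idem I x, _⟩ : LeftProj I x) = a from Subtype.ext ha] at this

/-- A homomorphism into `D(A e_x)` is determined by the linear form obtained by evaluation at `e_x`,
so extending homomorphisms reduces to extending linear forms over the field. -/
theorem injective_module (x : Q) : Module.Injective (BoundAlgebra I)ᵐᵒᵖ (Inj I x) := by
  refine ⟨fun X Y _ _ _ _ f hf g => ?_⟩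
  let _ := scalarModule I X
  let _ := scalarModule I Y
  have hop : ∀ (c : k) (a : BoundAlgebra I) (m : Y), op (c • a) • m = c • op a • m := by
    intro c a m
    rw [op_smul, Algebra.smul_def, mul_smul]
    rfl
  let f' : X →ₗ[k] Y := { f with map_smul' := fun c m => map_smul f (algebraMap k _ c) m }
  obtain ⟨r, hr⟩ := LinearMap.exists_leftInverse_of_injective f' (LinearMap.ker_eq_bot.2 hf)
  have hr' : ∀ m, r (f m) = m := fun m => LinearMap.congr_fun hr m
  -- The linear form attached to `g`. Composed with the linear retraction `r`, it lives on `Y`, and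
  -- from there `h` recovers a module homomorphism.
  let l : X →ₗ[k] k :=
    { toFun := fun m => (g m).eval (idem I x)
      map_add' := fun m n => by rw [map_add]; rfl
      map_smul' := fun c m => by
        refine (congrArg (fun h : Inj I x => h.eval (idem I x))
          (map_smul g (algebraMap k (BoundAlgebra I)ᵐᵒᵖ c) m)).trans ?_
        refine (eval_smul (algebraMap k (BoundAlgebra I) c) (g m) (idem I x)).trans ?_
        rw [← Algebra.smul_def]
        exact map_smul (g m).toLin c _ }
  let h : Y → Inj I x := fun y => mk
    { toFun := fun a => l (r (op a • y))
      map_add' := fun a b => by rw [op_add, add_smul, map_add, map_add]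
      map_smul' := fun c a => by rw [hop, map_smul, map_smul]; rfl }
  have hh : ∀ y, ∀ a ∈ LeftProj I x, (h y).eval a = l (r (op a • y)) := fun y a ha => by
    rw [eval_mk, mem_leftProj_iff.1 ha]
    rfl
  refine ⟨{ toFun := h, map_add' := fun y z => ext fun a ha => ?_,
            map_smul' := fun b y => ext fun a ha => ?_ }, fun m => ext fun a ha => ?_⟩
  · rw [eval_add, hh _ a ha, hh _ a ha, hh _ a ha, smul_add, map_add, map_add]
  · rw [RingHom.id_apply, ← op_unop b, eval_smul, hh _ a ha, hh, smul_smul, ← op_mul]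
    exact Submodule.smul_mem _ _ ha
  · refine (hh _ a ha).trans ?_
    rw [← map_smul, hr']
    change (g (op a • m)).eval _ = _
    rw [map_smul, eval_smul, mem_leftProj_iff.1 ha]

/-- The product `a q` is a combination of non-stationary paths `s`, and the value of `f` at `s` is
the value of `f s = 0` at `1`. -/
theorem eval_mul_eq_zero (f : Inj I x) (hf : Killed I f) {q : QPath Q} (hq : q.2.2.length ≠ 0)
    (a : BoundAlgebra I) : f.eval (a * qcls I q) = 0 := by
  induction a using qcls_induction with
  | zero => rw [zero_mul]; exact map_zero f.toLin
  | add a b ha hb => rw [add_mul, ← toLin_apply, map_add, toLin_apply, toLin_apply, ha, hb, add_zero]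
  | cls c r =>
    rw [smul_mul_assoc, ← toLin_apply, map_smul, toLin_apply]
    by_cases h : q.1 = r.2.1
    · obtain ⟨s, hs⟩ := exists_comp h
      have hl : s.2.2.length ≠ 0 := by
        have : s.2.2.length = r.2.2.length + q.2.2.length := by cases hs; exact Path.length_comp _ _
        omega
      rw [qcls_mul I hs, ← mul_one (qcls I s), ← eval_smul, hf s hl, eval_zero, smul_zero]
    · rw [qcls_mul_of_ne I h, ← toLin_apply, map_zero, smul_zero]

end Inj

end ProjInj

/-! ### Maps between sums of modules `P(x)` -/

section Terms

variable {k Q : Type u} [Field k] [Fintype Q] [Quiver.{u} Q]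
  {I : TwoSidedIdeal (PathAlgebra k Q)} (hI : IsStringPresentation I)

open PathAlgebra MulOpposite

variable {ι ι' ι'' : Type} [Fintype ι] [Fintype ι'] [Fintype ι'']
  {pt : ι → Option Q} {pt' : ι' → Option Q} {pt'' : ι'' → Option Q}

/-- Lets sums over the existing points be computed over all labels, as in the abstract complex,
where absent summands carry zero. -/
theorem sum_subtype_isSome {V : Type*} [AddCommMonoid V] (F : ι → V)
    (hF : ∀ l, pt l = none → F l = 0) :
    ∑ t : {l // (pt l).isSome}, F t.1 = ∑ l, F l := by
  classical
  rw [← Finset.sum_filter_of_ne (s := Finset.univ) (p := fun l => (pt l).isSome)]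
  · exact (Finset.sum_subtype _ (by simp) F).symm
  · intro l _ h
    by_contra hn
    exact h (hF l (by simpa using hn))

variable (I pt) in
/-- The direct sum of the modules `P(x)`, over a family of points that need not all exist. -/
abbrev PTerm : Type u := (t : {l // (pt l).isSome}) → Proj I ((pt t.1).get t.2)

variable (I pt) in
/-- The direct sum of the modules `I(x)`, over a family of points that need not all exist. -/
abbrev ITerm : Type u := (t : {l // (pt l).isSome}) → Inj I ((pt t.1).get t.2)

/-- The coordinates of an element, with value zero at the points that do not exist. -/
def PTerm.coord (y : PTerm I pt) (l : ι) : BoundAlgebra I :=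
  if h : (pt l).isSome then (y ⟨l, h⟩ : BoundAlgebra I) else 0

theorem PTerm.coord_val (y : PTerm I pt) (t : {l // (pt l).isSome}) : y.coord t.1 = y t :=
  dif_pos t.2

theorem PTerm.coord_none (y : PTerm I pt) {l : ι} (h : pt l = none) : y.coord l = 0 :=
  dif_neg (by simp [h])

theorem PTerm.coord_mem (y : PTerm I pt) (l : ι) : y.coord l ∈ (quiverAlg I hI).E (pt l) := by
  by_cases h : (pt l).isSome
  · rw [y.coord_val ⟨l, h⟩]
    have hm := (mem_proj_iff_mem_E hI).1 (y ⟨l, h⟩).2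
    rwa [Option.some_get] at hm
  · rw [y.coord_none (by simpa using h)]
    exact Submodule.zero_mem _

theorem PTerm.coord_injective {y z : PTerm I pt} (h : ∀ l, y.coord l = z.coord l) : y = z := by
  funext t
  refine Subtype.ext ?_
  rw [← coord_val, ← coord_val, h]

theorem PTerm.exists_coord {z : ι → BoundAlgebra I}
    (hz : ∀ l, z l ∈ (quiverAlg I hI).E (pt l)) : ∃ y : PTerm I pt, ∀ l, y.coord l = z l := by
  refine ⟨fun t => ⟨z t.1, ?_⟩, fun l => ?_⟩
  · rw [mem_proj_iff_mem_E hI, Option.some_get]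
    exact hz _
  · unfold coord
    split_ifs with h
    · rfl
    · have := hz l
      rw [show pt l = none by simpa using h] at this
      exact (PathAlg.E_none _ this).symm

open Classical in
theorem PTerm.coord_single (t : {l // (pt l).isSome}) (a : Proj I ((pt t.1).get t.2)) (l : ι) :
    PTerm.coord (pt := pt) (Pi.single t a) l = if l = t.1 then (a : BoundAlgebra I) else 0 := by
  split_ifs with h
  · subst h
    rw [coord_val, Pi.single_eq_same]
  · unfold coord
    split_ifs with h'
    · rw [Pi.single_eq_of_ne fun h'' => h (congrArg Subtype.val h'')]
      rfl
    · rfl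

instance : Module.Projective (BoundAlgebra I)ᵐᵒᵖ (PTerm I pt) := by
  classical
  exact Module.Projective.of_equiv (DFinsupp.linearEquivFunOnFintype (R := (BoundAlgebra I)ᵐᵒᵖ)
    (M := fun t : {l // (pt l).isSome} => Proj I ((pt t.1).get t.2)))

theorem ITerm.injective_module : Module.Injective (BoundAlgebra I)ᵐᵒᵖ (ITerm I pt) := by
  have := fun x : Q => Inj.injective_module (I := I) x
  infer_instance

/-- The map between sums of modules `P(x)` given by a matrix. -/
def projMap (M : ι → ι' → BoundAlgebra I) (hM : ∀ l l', (quiverAlg I hI).Entry (pt l) (M l l')) :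
    PTerm I pt' →ₗ[(BoundAlgebra I)ᵐᵒᵖ] PTerm I pt where
  toFun y s := ⟨∑ t : {l // (pt' l).isSome}, M s.1 t.1 * (y t : BoundAlgebra I),
    Submodule.sum_mem _ fun t _ => by
      rw [mem_proj_iff_mem_E hI, Option.some_get]
      exact (hM s.1 t.1).mul_mem _ _⟩
  map_add' y z := funext fun s => Subtype.ext (by
    simp only [Pi.add_apply, Submodule.coe_add, mul_add, Finset.sum_add_distrib])
  map_smul' a y := funext fun s => Subtype.ext (by
    simp only [Pi.smul_apply, Submodule.coe_smul, RingHom.id_apply, Finset.smul_sum,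
      MulOpposite.smul_eq_mul_unop, mul_assoc])

variable {M : ι → ι' → BoundAlgebra I} (hM : ∀ l l', (quiverAlg I hI).Entry (pt l) (M l l'))
  {M' : ι' → ι'' → BoundAlgebra I} (hM' : ∀ l l', (quiverAlg I hI).Entry (pt' l) (M' l l'))

theorem projMap_apply (y : PTerm I pt') (s : {l // (pt l).isSome}) :
    (projMap hI M hM y s : BoundAlgebra I) =
      ∑ t : {l // (pt' l).isSome}, M s.1 t.1 * (y t : BoundAlgebra I) := rfl

theorem entry_none {v : BoundAlgebra I} (h : (quiverAlg I hI).Entry none v) : v = 0 := by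
  rcases h with h | ⟨c, -, h, -⟩
  · exact h
  · cases h

theorem coord_projMap (y : PTerm I pt') (l : ι) :
    (projMap hI M hM y).coord l = ∑ l', M l l' * y.coord l' := by
  by_cases h : (pt l).isSome
  · rw [PTerm.coord_val _ ⟨l, h⟩, projMap_apply,
      ← sum_subtype_isSome (pt := pt') (fun l' => M l l' * y.coord l')
        fun l' h => by rw [y.coord_none h, mul_zero]]
    exact Finset.sum_congr rfl fun t _ => by rw [y.coord_val]
  · have h' : pt l = none := by simpa using h
    rw [PTerm.coord_none _ h']
    refine (Finset.sum_eq_zero fun l' _ => ?_).symm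
    have := hM l l'
    rw [h'] at this
    rw [entry_none hI this, zero_mul]

theorem projMap_eq_zero_iff (y : PTerm I pt') :
    projMap hI M hM y = 0 ↔ ∀ l, ∑ l', M l l' * y.coord l' = 0 := by
  have h0 : ∀ l, (0 : PTerm I pt).coord l = 0 := fun l => by
    unfold PTerm.coord; split_ifs <;> rfl
  simp only [← coord_projMap hI hM]
  exact ⟨fun h l => by rw [h, h0], fun h => PTerm.coord_injective fun l => by rw [h, h0]⟩

/-- Passes from the coordinatewise exactness of the abstract complex to exactness of module
homomorphisms. -/
theorem projMap_exact (h : ∀ x : ι' → BoundAlgebra I, (∀ l, x l ∈ (quiverAlg I hI).E (pt' l)) →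
    ((∀ l, ∑ l', M l l' * x l' = 0) ↔ ∃ y : ι'' → BoundAlgebra I,
      (∀ l, y l ∈ (quiverAlg I hI).E (pt'' l)) ∧ ∀ l, ∑ l', M' l l' * y l' = x l)) :
    Function.Exact (projMap hI (pt' := pt'') M' hM') (projMap hI M hM) := by
  intro x
  rw [projMap_eq_zero_iff, h _ (x.coord_mem hI)]
  constructor
  · rintro ⟨y, hy, hyx⟩
    obtain ⟨y', hy'⟩ := PTerm.exists_coord hI hy
    refine ⟨y', PTerm.coord_injective fun l => ?_⟩
    rw [coord_projMap, ← hyx]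
    exact Finset.sum_congr rfl fun l' _ => by rw [hy']
  · rintro ⟨y, rfl⟩
    exact ⟨y.coord, y.coord_mem hI, fun l => (coord_projMap hI hM' y l).symm⟩

theorem coeffs_entry_mul {o : Option Q} {v : BoundAlgebra I} (h : (quiverAlg I hI).Entry o v)
    (a : BoundAlgebra I) (x : Q) : coeffs hI (v * a) (toQ (Path.nil : Path x x)) = 0 := by
  have key : ∀ c : QPath Q, c.2.2.length ≠ 0 →
      coeffs hI (qcls I c * a) (toQ (Path.nil : Path x x)) = 0 := by
    intro c hc
    refine coeffs_qcls_mul_of_not hI a fun hi => hc ?_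
    rw [PathSys.init_e (S := quiverSys I) (x := x) hi]
    rfl
  rcases h with rfl | ⟨c, hc, -, rfl | rfl⟩
  · simp
  · exact key c hc
  · rw [alg_cl, neg_mul, map_neg, Pi.neg_apply, key c hc, neg_zero]

/-- The stationary generators span the module, and the action on the simple module at `x` sees only
the coefficient of the stationary path at `x`. -/
theorem PTerm.map_pointModule {x : Q}
    (f : PTerm I pt →ₗ[(BoundAlgebra I)ᵐᵒᵖ] PointModule hI x) (y : PTerm I pt)
    (hy : ∀ t, coeffs hI (y t : BoundAlgebra I) (toQ (Path.nil : Path x x)) = 0) : f y = 0 := by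
  classical
  have : y = ∑ t, op (y t : BoundAlgebra I) •
      (Pi.single t (projGen ((pt t.1).get t.2)) : PTerm I pt) := by
    funext t
    rw [Finset.sum_apply, Finset.sum_eq_single t]
    · rw [Pi.smul_apply, Pi.single_eq_same, op_smul_projGen]
    · intro s _ hs
      rw [Pi.smul_apply, Pi.single_eq_of_ne hs.symm, smul_zero]
    · simp
  rw [this, map_sum]
  refine Finset.sum_eq_zero fun t _ => PointModule.val.injective ?_
  rw [map_smul, PointModule.val_smul, unop_op, hy, zero_mul, map_zero]

/-- Multiples of non-stationary paths have no stationary coefficients, so the image dies under every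
map to a simple module. With exactness this is the minimality of the resolution. -/
theorem isSuperfluous_range_projMap :
    IsSuperfluous (LinearMap.range (projMap hI (pt' := pt') M hM)) := by
  refine isSuperfluous_of_functional hI fun x f => ?_
  rintro _ ⟨y, rfl⟩
  refine PTerm.map_pointModule hI f _ fun t => ?_
  rw [projMap_apply, map_sum, Finset.sum_apply]
  exact Finset.sum_eq_zero fun s _ => coeffs_entry_mul hI (hM _ _) _ _

/-- By `hind` the image is the direct sum of the images of single columns. A non-zero column
contains only copies of one connecting path, and on its image of the generator only the initial
subpaths of the corresponding segment act non-trivially. -/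
theorem isSumOfUniserials_range_projMap {n : ℕ} (hn : Fintype.card ι' ≤ n)
    (hind : ∀ x : ι' → BoundAlgebra I, (∀ l, x l ∈ (quiverAlg I hI).E (pt' l)) →
      (∀ l, ∑ l', M l l' * x l' = 0) → ∀ l l', M l l' * x l' = 0)
    (hcol : ∀ l', ∃ o : Option (QPath Q × QPath Q), (∀ T ∈ o, (quiverSys I).Good T.1 T.2) ∧
      ∀ l, M l l' = 0 ∨ M l l' = (quiverAlg I hI).co o) :
    IsSumOfUniserials (BoundAlgebra I)ᵐᵒᵖ n (LinearMap.range (projMap hI (pt' := pt') M hM)) := by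
  classical
  have hsingle : ∀ (t : {l // (pt' l).isSome}) (a : Proj I ((pt' t.1).get t.2)) (l : ι),
      ∑ l', M l l' * PTerm.coord (pt := pt') (Pi.single t a) l' = M l t.1 * a := by
    intro t a l
    rw [Finset.sum_eq_single t.1]
    · rw [PTerm.coord_single, if_pos rfl]
    · intro l' _ h
      rw [PTerm.coord_single, if_neg h, mul_zero]
    · simp
  refine isSumOfUniserials_range (ι := {l // (pt' l).isSome})
    ((Fintype.card_subtype_le _).trans hn) (projMap hI (pt' := pt') M hM)
    (fun y hy t => ?_) fun t => ?_
  · have hy' := (projMap_eq_zero_iff hI hM y).1 hy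
    refine (projMap_eq_zero_iff hI hM _).2 fun l => ?_
    rw [LinearMap.coe_single, hsingle, ← PTerm.coord_val]
    exact hind _ (PTerm.coord_mem hI y) hy' l t.1
  · obtain ⟨o, ho, hl⟩ := hcol t.1
    let g : Proj I ((pt' t.1).get t.2) →ₗ[(BoundAlgebra I)ᵐᵒᵖ] PTerm I pt :=
      projMap hI (pt' := pt') M hM ∘ₗ LinearMap.single (BoundAlgebra I)ᵐᵒᵖ
        (fun t : {l // (pt' l).isSome} => Proj I ((pt' t.1).get t.2)) t
    have hzero : ∀ a : Proj I ((pt' t.1).get t.2), (∀ l, M l t.1 * (a : BoundAlgebra I) = 0) → g a = 0 := fun a ha =>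
      (projMap_eq_zero_iff hI hM _).2 fun l => by
        rw [LinearMap.coe_single, hsingle]; exact ha l
    refine isUniserialOrZero_range_of_path hI g
      (p := (o.map Prod.snd).getD (toQ (Path.nil : Path ((pt' t.1).get t.2) _)))
      (n := projGen _) (fun a => ⟨a, (op_smul_projGen a).symm⟩) fun q hq => hzero _ fun l => ?_
    rcases hl l with h | h
    · rw [h, zero_mul]
    · rw [h]
      cases o with
      | none => exact zero_mul _
      | some T =>
        rw [PathAlg.co_some, ← alg_mul hI, (quiverAlg I hI).mul_eq_zero_iff (ho T rfl), alg_cf]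
        intro r hr
        change coeffs hI (idem I _ * qcls I q) r = 0
        by_cases h1 : q.1 = (pt' t.1).get t.2
        · rw [← h1, idem_eq, qcls_mul I (nil_qcomp q), coeffs_qcls, if_neg]
          rintro ⟨-, rfl⟩
          exact hq hr
        · rw [idem_eq, qcls_mul_of_ne I h1]
          simp

end Terms

/-- A form vanishing on the right kernel of `B` factors through the map from `W` to the dual of `V`,
hence is given by an element of the double dual, which is `V` by finite dimension. -/
theorem exists_eq_of_bilin {k V W : Type*} [Field k] [AddCommGroup V] [Module k V] [AddCommGroup W]
    [Module k W] [Module.Finite k V] (B : V →ₗ[k] W →ₗ[k] k) (φ : W →ₗ[k] k)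
    (h : ∀ w, (∀ v, B v w = 0) → φ w = 0) : ∃ v, ∀ w, φ w = B v w := by
  have hφ : φ ∈ LinearMap.range B.flip.dualMap := by
    rw [LinearMap.range_dualMap_eq_dualAnnihilator_ker, Submodule.mem_dualAnnihilator]
    exact fun w hw => h w fun v => LinearMap.congr_fun hw v
  obtain ⟨G, rfl⟩ := hφ
  refine ⟨(Module.evalEquiv k V).symm G, fun w => ?_⟩
  rw [LinearMap.dualMap_apply, ← LinearMap.flip_apply B]
  conv_lhs => rw [← (Module.evalEquiv k V).apply_symm_apply G]
  rfl

theorem exists_factor_of_ker_le {k V W : Type*} [Field k] [AddCommGroup V] [Module k V]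
    [AddCommGroup W] [Module k W] (e : W →ₗ[k] V) (φ : W →ₗ[k] k)
    (h : ∀ w, e w = 0 → φ w = 0) : ∃ G : V →ₗ[k] k, ∀ w, φ w = G (e w) := by
  have hφ : φ ∈ LinearMap.range e.dualMap := by
    rw [LinearMap.range_dualMap_eq_dualAnnihilator_ker, Submodule.mem_dualAnnihilator]
    exact h
  obtain ⟨G, rfl⟩ := hφ
  exact ⟨G, fun w => rfl⟩

/-! ### Maps between sums of modules `I(x)`, by duality -/

section Terms

variable {k Q : Type u} [Field k] [Fintype Q] [Quiver.{u} Q]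
  {I : TwoSidedIdeal (PathAlgebra k Q)} (hI : IsStringPresentation I)

open PathAlgebra MulOpposite

include hI in
theorem finite_boundAlgebra : Module.Finite k (BoundAlgebra I) := by
  have := (finite_nonzero hI).to_subtype
  let f : BoundAlgebra I →ₗ[k] ({q : QPath Q | IsNonzero I q.2.2} → k) :=
    LinearMap.funLeft k k Subtype.val ∘ₗ coeffs hI
  refine Module.Finite.of_injective f fun a b h => coeffs_inj hI fun q hq => ?_
  exact congrFun h ⟨q, hq⟩

variable {ι ι' ι'' : Type} [Fintype ι] [Fintype ι'] [Fintype ι'']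
  {pt : ι → Option Q} {pt' : ι' → Option Q} {pt'' : ι'' → Option Q}

namespace ITerm

/-- The linear form given by an element of a sum of modules `I(x)`. -/
def fn (f : ITerm I pt) : (ι → BoundAlgebra I) →ₗ[k] k :=
  ∑ t : {l // (pt l).isSome}, (f t).toLin ∘ₗ LinearMap.proj t.1

theorem fn_apply (f : ITerm I pt) (z : ι → BoundAlgebra I) :
    f.fn z = ∑ t : {l // (pt l).isSome}, (f t).eval (z t.1) := by
  unfold fn
  rw [LinearMap.sum_apply]
  rfl

open Classical in
theorem fn_single (f : ITerm I pt) (t : {l // (pt l).isSome}) (a : BoundAlgebra I) :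
    f.fn (Pi.single t.1 a) = (f t).eval a := by
  rw [fn_apply, Finset.sum_eq_single t]
  · rw [Pi.single_eq_same]
  · intro s _ hs
    rw [Pi.single_eq_of_ne fun h => hs (Subtype.ext h)]
    exact map_zero (f s).toLin
  · simp

open Classical in
/-- The element of a sum of modules `I(x)` given by a linear form. -/
def ofFn (G : (ι → BoundAlgebra I) →ₗ[k] k) : ITerm I pt := fun t =>
  Inj.mk (G ∘ₗ LinearMap.single k (fun _ : ι => BoundAlgebra I) t.1)

theorem mul_idem_of_mem {l : ι} (h : (pt l).isSome) {a : BoundAlgebra I}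
    (ha : a ∈ (quiverAlg I hI).op.E (pt l)) : a * idem I ((pt l).get h) = a := by
  rw [← mem_leftProj_iff, mem_leftProj_iff_mem_E hI, Option.some_get]
  exact ha

theorem fn_ofFn (G : (ι → BoundAlgebra I) →ₗ[k] k) {z : ι → BoundAlgebra I}
    (hz : ∀ l, z l ∈ (quiverAlg I hI).op.E (pt l)) : (ofFn G : ITerm I pt).fn z = G z := by
  classical
  have hsum : z = ∑ l, Pi.single l (z l) := by
    rw [Finset.univ_sum_single]
  rw [fn_apply]
  conv_rhs => rw [hsum, map_sum]
  rw [← sum_subtype_isSome (pt := pt) fun l => G (Pi.single l (z l))]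
  · refine Finset.sum_congr rfl fun t _ => ?_
    unfold ofFn
    rw [Inj.eval_mk, mul_idem_of_mem hI t.2 (hz t.1), LinearMap.comp_apply, LinearMap.coe_single]
  · intro l hl
    have := hz l
    rw [hl] at this
    rw [PathAlg.E_none _ this, Pi.single_zero, map_zero]

theorem ext_fn {f g : ITerm I pt}
    (h : ∀ z : ι → BoundAlgebra I, (∀ l, z l ∈ (quiverAlg I hI).op.E (pt l)) → f.fn z = g.fn z) :
    f = g := by
  classical
  funext t
  refine Inj.ext fun a ha => ?_
  rw [← fn_single, ← fn_single]
  refine h _ fun l => ?_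
  by_cases hl : l = t.1
  · subst hl
    rw [Pi.single_eq_same]
    rw [mem_leftProj_iff_mem_E hI, Option.some_get] at ha
    exact ha
  · rw [Pi.single_eq_of_ne hl]
    exact Submodule.zero_mem _

end ITerm

/-- The map between sums of modules `I(x)` given by a matrix. -/
def injMap (M : ι → ι' → BoundAlgebra I) : ITerm I pt →ₗ[(BoundAlgebra I)ᵐᵒᵖ] ITerm I pt' where
  toFun f t := Inj.mk (∑ s : {l // (pt l).isSome},
    (f s).toLin ∘ₗ LinearMap.mulRight k (M s.1 t.1))
  map_add' f g := funext fun t => Inj.ext fun a _ => by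
    rw [Pi.add_apply, Inj.eval_add, Inj.eval_mk, Inj.eval_mk, Inj.eval_mk, LinearMap.sum_apply,
      LinearMap.sum_apply, LinearMap.sum_apply, ← Finset.sum_add_distrib]
    rfl
  map_smul' b f := funext fun t => Inj.ext fun a _ => by
    rw [Pi.smul_apply, RingHom.id_apply, ← op_unop b, Inj.eval_smul, Inj.eval_mk, Inj.eval_mk,
      LinearMap.sum_apply, LinearMap.sum_apply]
    refine Finset.sum_congr rfl fun s _ => ?_
    rw [LinearMap.comp_apply, LinearMap.comp_apply, LinearMap.mulRight_apply,
      LinearMap.mulRight_apply, Pi.smul_apply, Inj.toLin_apply, Inj.toLin_apply, Inj.eval_smul,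
      mul_assoc, mul_assoc, mul_assoc]

theorem eval_injMap (M : ι → ι' → BoundAlgebra I) (f : ITerm I pt) (t : {l // (pt' l).isSome})
    {a : BoundAlgebra I} (ha : a ∈ LeftProj I ((pt' t.1).get t.2)) :
    (injMap (pt' := pt') M f t).eval a =
      ∑ s : {l // (pt l).isSome}, (f s).eval (a * M s.1 t.1) := by
  change (Inj.mk _ : Inj I _).eval a = _
  rw [Inj.eval_mk, mem_leftProj_iff.1 ha, LinearMap.sum_apply]
  rfl

/-- `injMap` is the transpose of right multiplication of vectors by the matrix. Questions about it
thereby become questions about the opposite path system. -/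
theorem fn_injMap (M : ι → ι' → BoundAlgebra I) (f : ITerm I pt) {z : ι' → BoundAlgebra I}
    (hz : ∀ l, z l ∈ (quiverAlg I hI).op.E (pt' l)) :
    (injMap (pt' := pt') M f).fn z = f.fn fun l => ∑ l', z l' * M l l' := by
  have h1 : ∀ t : {l // (pt' l).isSome}, (injMap (pt' := pt') M f t).eval (z t.1) =
      ∑ s : {l // (pt l).isSome}, (f s).eval (z t.1 * M s.1 t.1) := fun t =>
    eval_injMap M f t (mem_leftProj_iff.2 (ITerm.mul_idem_of_mem hI t.2 (hz t.1)))
  rw [ITerm.fn_apply, ITerm.fn_apply, Finset.sum_congr rfl fun t _ => h1 t, Finset.sum_comm]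
  refine Finset.sum_congr rfl fun s _ => ?_
  rw [← Inj.toLin_apply, map_sum,
    ← sum_subtype_isSome (pt := pt') fun l' => (f s).toLin (z l' * M s.1 l')]
  · rfl
  · intro l hl
    have := hz l
    rw [hl] at this
    rw [PathAlg.E_none _ this, zero_mul, map_zero]

theorem op_entry_mul_mem {o : Option Q} {v : BoundAlgebra I} (h : (quiverAlg I hI).op.Entry o v)
    (a : BoundAlgebra I) : a * v ∈ (quiverAlg I hI).op.E o := by
  rw [← alg_op_mul hI]
  exact h.mul_mem _ _

variable {M : ι → ι' → BoundAlgebra I}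
  (hM : ∀ l l', (quiverAlg I hI).op.Entry (pt l) (M l l'))
  {M' : ι' → ι'' → BoundAlgebra I}

-- Over a field, the image of a transposed map is the annihilator of the kernel.
include hM in
theorem mem_range_injMap_iff (f : ITerm I pt') :
    f ∈ LinearMap.range (injMap (pt := pt) (pt' := pt') M) ↔ ∀ z : ι' → BoundAlgebra I,
      (∀ l, z l ∈ (quiverAlg I hI).op.E (pt' l)) → (∀ l, ∑ l', z l' * M l l' = 0) → f.fn z = 0 := by
  classical
  constructor
  · rintro ⟨g, rfl⟩ z hz h
    rw [fn_injMap hI M _ hz]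
    simp only [h]
    exact map_zero g.fn
  · intro hf
    let W : Submodule k (ι' → BoundAlgebra I) :=
      Submodule.pi Set.univ fun l => (quiverAlg I hI).op.E (pt' l)
    have hW : ∀ z, z ∈ W ↔ ∀ l, z l ∈ (quiverAlg I hI).op.E (pt' l) := fun z => by
      simp [W, Submodule.mem_pi]
    let e : W →ₗ[k] (ι → BoundAlgebra I) := LinearMap.pi fun l =>
      ∑ l', LinearMap.mulRight k (M l l') ∘ₗ LinearMap.proj l' ∘ₗ W.subtype
    have he : ∀ (z : W) l, e z l = ∑ l', z.1 l' * M l l' := fun z l => by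
      simp only [e, LinearMap.pi_apply, LinearMap.sum_apply]
      rfl
    -- The form factors through multiplication by the matrix, and the factor is a linear form on all
    -- vectors; `ITerm.ofFn` restricts it to the summands that exist.
    obtain ⟨G, hG⟩ := exists_factor_of_ker_le e (f.fn ∘ₗ W.subtype) fun w hw =>
      hf w.1 ((hW _).1 w.2) fun l => by rw [← he, hw]; rfl
    refine ⟨ITerm.ofFn G, ITerm.ext_fn hI fun z hz => ?_⟩
    rw [fn_injMap hI M _ hz, ITerm.fn_ofFn hI]
    · refine Eq.trans (congrArg G ?_) (hG ⟨z, (hW z).2 hz⟩).symm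
      exact funext fun l => (he ⟨z, (hW z).2 hz⟩ l).symm
    · exact fun l => Submodule.sum_mem _ fun l' _ => op_entry_mul_mem hI (hM l l') _

theorem injMap_eq_zero_iff (f : ITerm I pt') : injMap (pt' := pt'') M' f = 0 ↔ ∀ y : ι'' → BoundAlgebra I,
      (∀ l, y l ∈ (quiverAlg I hI).op.E (pt'' l)) → f.fn (fun l => ∑ l', y l' * M' l l') = 0 := by
  have h0 : ∀ z, (0 : ITerm I pt'').fn z = 0 := fun z => by
    rw [ITerm.fn_apply]
    exact Finset.sum_eq_zero fun t _ => Inj.eval_zero _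
  constructor
  · intro h y hy
    rw [← fn_injMap hI M' f hy, h, h0]
  · intro h
    refine ITerm.ext_fn hI fun y hy => ?_
    rw [fn_injMap hI M' f hy, h y hy, h0]

-- Both kernel and image are annihilators of subspaces, and the hypothesis `h` says that these
-- subspaces coincide.
include hM in
theorem injMap_exact (hM' : ∀ l l', (quiverAlg I hI).op.Entry (pt' l) (M' l l'))
    (h : ∀ x : ι' → BoundAlgebra I, (∀ l, x l ∈ (quiverAlg I hI).op.E (pt' l)) →
      ((∀ l, ∑ l', x l' * M l l' = 0) ↔ ∃ y : ι'' → BoundAlgebra I,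
        (∀ l, y l ∈ (quiverAlg I hI).op.E (pt'' l)) ∧ ∀ l, ∑ l', y l' * M' l l' = x l)) :
    Function.Exact (injMap (pt := pt) (pt' := pt') M) (injMap (pt' := pt'') M') := by
  intro f
  refine Iff.trans ?_ (mem_range_injMap_iff hI hM f).symm
  rw [injMap_eq_zero_iff hI]
  constructor
  · intro hf z hz h0
    obtain ⟨y, hy, hyz⟩ := (h z hz).1 h0
    rw [show z = fun l => ∑ l', y l' * M' l l' from funext fun l => (hyz l).symm]
    exact hf y hy
  · intro hf y hy
    have hm : ∀ l, ∑ l', y l' * M' l l' ∈ (quiverAlg I hI).op.E (pt' l) := fun l =>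
      Submodule.sum_mem _ fun l' _ => op_entry_mul_mem hI (hM' l l') _
    exact hf _ hm ((h _ hm).2 ⟨y, hy, fun l => rfl⟩)

theorem eval_mul_op_entry {x : Q} (f : Inj I x) (hf : Killed I f) {o : Option Q}
    {v : BoundAlgebra I} (h : (quiverAlg I hI).op.Entry o v) (a : BoundAlgebra I) :
    f.eval (a * v) = 0 := by
  rcases h with rfl | ⟨c, hc, -, rfl | rfl⟩
  · rw [mul_zero]; exact map_zero f.toLin
  · exact f.eval_mul_eq_zero hf hc a
  · rw [mul_neg, ← Inj.toLin_apply, map_neg, Inj.toLin_apply, neg_eq_zero]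
    exact f.eval_mul_eq_zero hf hc a

include hM in
theorem injMap_eq_zero_of_killed (f : ITerm I pt) (hf : Killed I f) :
    injMap (pt' := pt') M f = 0 := by
  refine funext fun t => Inj.ext fun a ha => ?_
  rw [eval_injMap M f t ha]
  exact Finset.sum_eq_zero fun s _ =>
    eval_mul_op_entry hI (f s) (fun q hq => congrFun (hf q hq) s) (hM s.1 t.1) a

-- The kernel contains everything killed by the radical, because the entries of the matrix are
-- non-stationary paths up to sign, or zero. Combined with exactness this gives minimality of the
-- coresolution.
include hM in
theorem isEssential_ker_injMap : IsEssential (LinearMap.ker (injMap (pt := pt) (pt' := pt') M)) :=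
  isEssential_of_killed hI fun f hf => injMap_eq_zero_of_killed hI hM f hf

include hI in
theorem isUniserialOrZero_of_le_span {V : Type u} [AddCommGroup V]
    [Module (BoundAlgebra I)ᵐᵒᵖ V] {S : Submodule (BoundAlgebra I)ᵐᵒᵖ V} {p : QPath Q} {g : V}
    (hS : ∀ v ∈ S, ∃ a : BoundAlgebra I, v = op a • g)
    (hp : ∀ q, ¬ (quiverSys I).Init q p → op (qcls I q) • g = 0) :
    IsUniserialOrZero (BoundAlgebra I)ᵐᵒᵖ S := by
  have h : IsUniserialOrZero (BoundAlgebra I)ᵐᵒᵖ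
      (LinearMap.range (LinearMap.toSpanSingleton (BoundAlgebra I)ᵐᵒᵖ V g)) := by
    refine isUniserialOrZero_range_of_path hI _ (p := p) (n := (1 : (BoundAlgebra I)ᵐᵒᵖ))
      (fun m => ⟨m.unop, (mul_one m).symm⟩) fun q hq => ?_
    rw [LinearMap.toSpanSingleton_apply, smul_eq_mul, mul_one]
    exact hp q hq
  refine h.of_injective (Submodule.inclusion fun v hv => ?_) (Submodule.inclusion_injective _)
  obtain ⟨a, rfl⟩ := hS v hv
  exact ⟨op a, rfl⟩

-- Dual to the projective case, but the image is treated as the annihilator of the kernel of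
-- multiplication by the matrix rather than through generators.
include hM in
theorem isSumOfUniserials_range_injMap {n : ℕ} (hn : Fintype.card ι' ≤ n)
    (hind : ∀ x : ι' → BoundAlgebra I, (∀ l, x l ∈ (quiverAlg I hI).op.E (pt' l)) →
      (∀ l, ∑ l', x l' * M l l' = 0) → ∀ l l', x l' * M l l' = 0)
    (hcol : ∀ l', ∃ o : Option (QPath Q × QPath Q), (∀ T ∈ o, (quiverSys I).op.Good T.1 T.2) ∧
      ∀ l, M l l' = 0 ∨ M l l' = (quiverAlg I hI).op.co o) :
    IsSumOfUniserials (BoundAlgebra I)ᵐᵒᵖ n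
      (LinearMap.range (injMap (pt := pt) (pt' := pt') M)) := by
  classical
  refine isSumOfUniserials_of_single_mem (ι := {l // (pt' l).isSome})
    ((Fintype.card_subtype_le _).trans hn) _ (fun f hf t => ?_) fun t => ?_
  -- By `hind` the kernel contains the components of its elements; its annihilator inherits this
  -- property.
  · rw [mem_range_injMap_iff hI hM] at hf ⊢
    intro z hz h0
    have h1 := hf (Pi.single t.1 (z t.1)) (fun l => ?_) fun l => ?_
    · rw [ITerm.fn_single] at h1
      rw [ITerm.fn_apply, Finset.sum_eq_single t]
      · rw [LinearMap.coe_single, Pi.single_eq_same, h1]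
      · intro s _ hs
        rw [LinearMap.coe_single, Pi.single_eq_of_ne hs]
        exact Inj.eval_zero _
      · simp
    · by_cases hl : l = t.1
      · subst hl
        rw [Pi.single_eq_same]
        exact hz _
      · rw [Pi.single_eq_of_ne hl]
        exact Submodule.zero_mem _
    · rw [Finset.sum_eq_single t.1]
      · rw [Pi.single_eq_same]
        exact hind z hz h0 l t.1
      · intro l' _ h
        rw [Pi.single_eq_of_ne h, zero_mul]
      · simp
  · obtain ⟨o, ho, hl⟩ := hcol t.1
    cases o with
    | none =>
      refine isUniserialOrZero_of_le_span hI (p := toQ (Path.nil : Path ((pt' t.1).get t.2) _))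
        (g := 0) ?_ fun q _ => smul_zero _
      rintro _ ⟨_, ⟨f, rfl⟩, rfl⟩
      refine ⟨0, Inj.ext fun a ha => ?_⟩
      rw [LinearMap.proj_apply, eval_injMap M f t ha, smul_zero, Inj.eval_zero]
      refine Finset.sum_eq_zero fun s _ => ?_
      rw [(hl s.1).elim id id, mul_zero]
      exact map_zero (f s).toLin
    | some T =>
      have hg := ho T rfl
      have heval : ∀ (b a : BoundAlgebra I), a ∈ LeftProj I ((pt' t.1).get t.2) →
          (op b • (Inj.mk (LinearMap.proj T.2 ∘ₗ coeffs hI) : Inj I ((pt' t.1).get t.2))).eval a =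
            coeffs hI (b * a) T.2 := fun b a ha => by
        rw [Inj.eval_smul, Inj.eval_mk, mul_assoc, mem_leftProj_iff.1 ha]
        rfl
      -- The column lies in the submodule generated by the form dual to the segment `T.2`, on which
      -- a path acts non-trivially only if `T.2` begins with it.
      refine isUniserialOrZero_of_le_span hI (p := T.2)
        (g := (Inj.mk (LinearMap.proj T.2 ∘ₗ coeffs hI) : Inj I ((pt' t.1).get t.2))) ?_
        fun q hq => Inj.ext fun a ha => ?_
      · rintro _ ⟨_, ⟨f, rfl⟩, rfl⟩
        have := finite_boundAlgebra hI
        -- If the coefficient of `b a` at `T.2` is zero for all `b`, then `a` vanishes on the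
        -- terminal subpaths of `T.2`, so `a` times the connecting path is zero and the column form
        -- vanishes at `a`. Hence that form is the dual form acted on by some `b`.
        obtain ⟨b, hb⟩ := exists_eq_of_bilin
          ((LinearMap.mul k (BoundAlgebra I)).compr₂ (LinearMap.proj T.2 ∘ₗ coeffs hI))
          (∑ s : {l // (pt l).isSome}, (f s).toLin ∘ₗ LinearMap.mulRight k (M s.1 t.1))
          fun a ha => by
            have hac : a * qcls I T.1 = 0 := by
              rw [← alg_op_mul hI, ← alg_op_cl hI, (quiverAlg I hI).op.mul_eq_zero_iff hg]
              rintro q ⟨r, hr⟩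
              rw [alg_op_cf, ← coeffs_qcls_mul hI a hr hg.nz]
              exact ha (qcls I r)
            rw [LinearMap.sum_apply]
            refine Finset.sum_eq_zero fun s _ => ?_
            rw [LinearMap.comp_apply, LinearMap.mulRight_apply]
            rcases hl s.1 with h | h
            · rw [h, mul_zero, map_zero]
            · rw [h, PathAlg.co_some, alg_op_cl, hac, map_zero]
        refine ⟨b, Inj.ext fun a ha => ?_⟩
        rw [heval b a ha, LinearMap.proj_apply, eval_injMap M f t ha]
        refine Eq.trans ?_ (hb a)
        rw [LinearMap.sum_apply]
        rfl
      · rw [heval _ a ha, coeffs_qcls_mul_of_not hI a hq, Inj.eval_zero]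

end Terms

/-! ### The augmentation and the coaugmentation -/

section Forms

variable {k Q : Type u} [Field k] [Fintype Q] [Quiver.{u} Q]
  {I : TwoSidedIdeal (PathAlgebra k Q)} (hI : IsStringPresentation I)

open PathAlgebra MulOpposite

variable {ι ι' : Type} [Fintype ι] [Fintype ι'] {pt : ι → Option Q} {pt' : ι' → Option Q}

theorem coeffs_mul_idem (a : BoundAlgebra I) (q : QPath Q) :
    coeffs hI (a * idem I q.2.1) q = coeffs hI a q := by
  by_cases hq : IsNonzero I q.2.2
  · exact coeffs_mul_qcls hI a (qcomp_nil q) hq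
  · rw [coeffs_of_not_isNonzero hI _ hq, coeffs_of_not_isNonzero hI _ hq]

/-- The map from a sum of modules `P(x)` to `I(c)` given by a family of paths ending at `c`. -/
def formMap (φ : ι → QPath Q) (c : Q) : PTerm I pt →ₗ[(BoundAlgebra I)ᵐᵒᵖ] Inj I c where
  toFun x := Inj.mk (∑ t : {l // (pt l).isSome},
    (LinearMap.proj (φ t.1) ∘ₗ coeffs hI) ∘ₗ LinearMap.mulLeft k (x t : BoundAlgebra I))
  map_add' x y := Inj.ext fun a _ => by
    rw [Inj.eval_add, Inj.eval_mk, Inj.eval_mk, Inj.eval_mk, LinearMap.sum_apply,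
      LinearMap.sum_apply, LinearMap.sum_apply, ← Finset.sum_add_distrib]
    refine Finset.sum_congr rfl fun t _ => ?_
    simp only [LinearMap.comp_apply, LinearMap.mulLeft_apply, Pi.add_apply, Submodule.coe_add,
      add_mul, map_add]
  map_smul' b x := Inj.ext fun a _ => by
    rw [RingHom.id_apply, ← op_unop b, Inj.eval_smul, Inj.eval_mk, Inj.eval_mk,
      LinearMap.sum_apply, LinearMap.sum_apply]
    refine Finset.sum_congr rfl fun t _ => ?_
    simp only [LinearMap.comp_apply, LinearMap.mulLeft_apply, Pi.smul_apply, Submodule.coe_smul,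
      MulOpposite.smul_eq_mul_unop, unop_op, mul_assoc]

variable {φ : ι → QPath Q} {c : Q}

theorem eval_formMap (hφ : ∀ l, (φ l).2.1 = c) (x : PTerm I pt) (a : BoundAlgebra I) :
    (formMap hI φ c x).eval a = ∑ l, coeffs hI (x.coord l * a) (φ l) := by
  change (Inj.mk _ : Inj I c).eval a = _
  rw [Inj.eval_mk, LinearMap.sum_apply,
    ← sum_subtype_isSome (pt := pt) fun l => coeffs hI (x.coord l * a) (φ l)]
  · refine Finset.sum_congr rfl fun t _ => ?_
    rw [LinearMap.comp_apply, LinearMap.mulLeft_apply, ← mul_assoc, LinearMap.comp_apply,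
      LinearMap.proj_apply, x.coord_val, ← hφ t.1, coeffs_mul_idem]
  · intro l hl
    rw [x.coord_none hl, zero_mul, map_zero, Pi.zero_apply]

/-- By finite dimension, every form in `I(c)` comes from the pairing as soon as no non-zero element
of `A e_c` pairs to zero with everything. -/
theorem formMap_surjective (hφ : ∀ l, (φ l).2.1 = c)
    (h : ∀ y ∈ (quiverAlg I hI).op.E (some c), (∀ x : ι → BoundAlgebra I,
      (∀ l, x l ∈ (quiverAlg I hI).E (pt l)) → ∑ l, coeffs hI (x l * y) (φ l) = 0) → y = 0) :
    Function.Surjective (formMap (pt := pt) hI φ c) := by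
  intro f
  have := finite_boundAlgebra hI
  let W : Submodule k (ι → BoundAlgebra I) :=
    Submodule.pi Set.univ fun l => (quiverAlg I hI).E (pt l)
  have hW : ∀ z, z ∈ W ↔ ∀ l, z l ∈ (quiverAlg I hI).E (pt l) := fun z => by
    simp [W, Submodule.mem_pi]
  let B : W →ₗ[k] BoundAlgebra I →ₗ[k] k := ∑ l,
    ((LinearMap.mul k (BoundAlgebra I)).compr₂ (LinearMap.proj (φ l) ∘ₗ coeffs hI)) ∘ₗ
      LinearMap.proj l ∘ₗ W.subtype
  have hB : ∀ (x : W) y, B x y = ∑ l, coeffs hI (x.1 l * y) (φ l) := fun x y => by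
    simp only [B, LinearMap.sum_apply]
    rfl
  obtain ⟨v, hv⟩ := exists_eq_of_bilin B f.toLin fun w hw => by
    have h0 : w * idem I c = 0 := by
      refine h _ ?_ fun x hx => ?_
      · rw [← mem_leftProj_iff_mem_E, mem_leftProj_iff, mul_assoc, idem_mul_idem]
      · rw [← hw ⟨x, (hW x).2 hx⟩, hB]
        refine Finset.sum_congr rfl fun l _ => ?_
        rw [← mul_assoc, ← hφ l, coeffs_mul_idem]
    rw [Inj.toLin_apply, ← Inj.eval_mul_idem, h0]
    exact map_zero f.toLin
  obtain ⟨x, hx⟩ := PTerm.exists_coord hI ((hW _).1 v.2)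
  refine ⟨x, Inj.ext fun a _ => ?_⟩
  rw [eval_formMap hI hφ]
  refine Eq.trans ?_ (hv a).symm
  rw [hB]
  exact Finset.sum_congr rfl fun l _ => by rw [hx]

theorem formMap_exact (hφ : ∀ l, (φ l).2.1 = c) {M : ι → ι' → BoundAlgebra I}
    (hM : ∀ l l', (quiverAlg I hI).Entry (pt l) (M l l'))
    (h : ∀ x : ι → BoundAlgebra I, (∀ l, x l ∈ (quiverAlg I hI).E (pt l)) →
      ((∀ y ∈ (quiverAlg I hI).op.E (some c), ∑ l, coeffs hI (x l * y) (φ l) = 0) ↔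
        ∃ y : ι' → BoundAlgebra I, (∀ l, y l ∈ (quiverAlg I hI).E (pt' l)) ∧
          ∀ l, ∑ l', M l l' * y l' = x l)) :
    Function.Exact (projMap hI (pt' := pt') M hM) (formMap hI φ c) := by
  intro x
  have h0 : formMap hI φ c x = 0 ↔
      ∀ y ∈ (quiverAlg I hI).op.E (some c), ∑ l, coeffs hI (x.coord l * y) (φ l) = 0 := by
    constructor
    · intro h y _
      rw [← eval_formMap hI hφ, h, Inj.eval_zero]
    · intro h
      refine Inj.ext fun a ha => ?_
      rw [eval_formMap hI hφ, h a ((mem_leftProj_iff_mem_E hI).1 ha), Inj.eval_zero]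
  rw [h0, h _ (x.coord_mem hI)]
  constructor
  · rintro ⟨y, hy, hyx⟩
    obtain ⟨y', hy'⟩ := PTerm.exists_coord hI hy
    refine ⟨y', PTerm.coord_injective fun l => ?_⟩
    rw [coord_projMap, ← hyx]
    exact Finset.sum_congr rfl fun l' _ => by rw [hy']
  · rintro ⟨y, rfl⟩
    exact ⟨y.coord, y.coord_mem hI, fun l => (coord_projMap hI hM y l).symm⟩

/-- The map from `P(z)` to a sum of modules `I(x)` given by a family of paths starting at `z`. -/
def coformMap (φ : ι → QPath Q) (z : Q) : Proj I z →ₗ[(BoundAlgebra I)ᵐᵒᵖ] ITerm I pt where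
  toFun x t := Inj.mk
    ((LinearMap.proj (φ t.1) ∘ₗ coeffs hI) ∘ₗ LinearMap.mulLeft k (x : BoundAlgebra I))
  map_add' x y := funext fun t => Inj.ext fun a _ => by
    rw [Pi.add_apply, Inj.eval_add, Inj.eval_mk, Inj.eval_mk, Inj.eval_mk]
    simp only [LinearMap.comp_apply, LinearMap.mulLeft_apply, Submodule.coe_add, add_mul, map_add]
  map_smul' b x := funext fun t => Inj.ext fun a _ => by
    rw [RingHom.id_apply, Pi.smul_apply, ← op_unop b, Inj.eval_smul, Inj.eval_mk, Inj.eval_mk]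
    simp only [LinearMap.comp_apply, LinearMap.mulLeft_apply, Submodule.coe_smul,
      MulOpposite.smul_eq_mul_unop, unop_op, mul_assoc]

variable {z : Q}

theorem eval_coformMap (x : Proj I z) (t : {l // (pt l).isSome}) {a : BoundAlgebra I}
    (ha : a ∈ LeftProj I ((pt t.1).get t.2)) :
    (coformMap hI φ z x t).eval a = coeffs hI (x * a) (φ t.1) := by
  change (Inj.mk _ : Inj I _).eval a = _
  rw [Inj.eval_mk, mem_leftProj_iff.1 ha]
  rfl

theorem fn_coformMap (x : Proj I z) {y : ι → BoundAlgebra I}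
    (hy : ∀ l, y l ∈ (quiverAlg I hI).op.E (pt l)) :
    (coformMap (pt := pt) hI φ z x).fn y = ∑ l, coeffs hI (x * y l) (φ l) := by
  rw [ITerm.fn_apply, ← sum_subtype_isSome (pt := pt) fun l => coeffs hI (x * y l) (φ l)]
  · exact Finset.sum_congr rfl fun t _ => eval_coformMap hI x t
      (mem_leftProj_iff.2 (ITerm.mul_idem_of_mem hI t.2 (hy t.1)))
  · intro l hl
    have := hy l
    rw [hl] at this
    rw [PathAlg.E_none _ this, mul_zero, map_zero, Pi.zero_apply]

theorem coformMap_injective (h : ∀ x ∈ (quiverAlg I hI).E (some z), (∀ y : ι → BoundAlgebra I,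
      (∀ l, y l ∈ (quiverAlg I hI).op.E (pt l)) → ∑ l, coeffs hI (x * y l) (φ l) = 0) → x = 0) :
    Function.Injective (coformMap (pt := pt) hI φ z) := by
  rw [injective_iff_map_eq_zero]
  intro x hx
  refine Subtype.ext (h x ((mem_proj_iff_mem_E hI).1 x.2) fun y hy => ?_)
  rw [← fn_coformMap hI x hy, hx, ITerm.fn_apply]
  exact Finset.sum_eq_zero fun t _ => Inj.eval_zero _

theorem coformMap_exact {M : ι → ι' → BoundAlgebra I}
    (hM : ∀ l l', (quiverAlg I hI).op.Entry (pt l) (M l l'))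
    (h : ∀ y : ι → BoundAlgebra I, (∀ l, y l ∈ (quiverAlg I hI).op.E (pt l)) →
      ((∀ x ∈ (quiverAlg I hI).E (some z), ∑ l, coeffs hI (x * y l) (φ l) = 0) ↔
        ∃ x : ι' → BoundAlgebra I, (∀ l, x l ∈ (quiverAlg I hI).op.E (pt' l)) ∧
          ∀ l, ∑ l', x l' * M l l' = y l)) :
    Function.Exact (coformMap hI φ z) (injMap (pt := pt) (pt' := pt') M) := by
  intro f
  rw [injMap_eq_zero_iff hI]
  constructor
  · intro hf
    have := finite_boundAlgebra hI
    let W : Submodule k (ι → BoundAlgebra I) :=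
      Submodule.pi Set.univ fun l => (quiverAlg I hI).op.E (pt l)
    have hW : ∀ z, z ∈ W ↔ ∀ l, z l ∈ (quiverAlg I hI).op.E (pt l) := fun z => by
      simp [W, Submodule.mem_pi]
    let P := (quiverAlg I hI).E (some z)
    let B : P →ₗ[k] W →ₗ[k] k := ∑ l,
      ((LinearMap.mul k (BoundAlgebra I)).compr₂ (LinearMap.proj (φ l) ∘ₗ coeffs hI)).compl₁₂
        P.subtype (LinearMap.proj l ∘ₗ W.subtype)
    have hB : ∀ (x : P) (y : W), B x y = ∑ l, coeffs hI (x.1 * y.1 l) (φ l) := fun x y => by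
      simp only [B, LinearMap.sum_apply]
      rfl
    -- By `h`, whatever pairs to zero with all of `P(z)` is a multiple of the matrix, where `f`
    -- vanishes; so `f` is given by the pairing with some element of `P(z)`.
    obtain ⟨v, hv⟩ := exists_eq_of_bilin B (f.fn ∘ₗ W.subtype) fun w hw => by
      obtain ⟨x, hx, hxw⟩ := (h w.1 ((hW _).1 w.2)).1 fun x hx => by rw [← hw ⟨x, hx⟩, hB]
      rw [LinearMap.comp_apply, Submodule.subtype_apply,
        show (w : ι → BoundAlgebra I) = fun l => ∑ l', x l' * M l l' from
          funext fun l => (hxw l).symm]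
      exact hf x hx
    refine ⟨⟨v.1, (mem_proj_iff_mem_E hI).2 v.2⟩, ITerm.ext_fn hI fun y hy => ?_⟩
    rw [fn_coformMap hI _ hy, ← hB v ⟨y, (hW y).2 hy⟩, ← hv]
    rfl
  · rintro ⟨x, rfl⟩ y hy
    have hm : ∀ l, ∑ l', y l' * M l l' ∈ (quiverAlg I hI).op.E (pt l) := fun l =>
      Submodule.sum_mem _ fun l' _ => op_entry_mul_mem hI (hM l l') _
    rw [fn_coformMap hI x hm]
    exact (h _ hm).2 ⟨y, hy, fun l => rfl⟩ x ((mem_proj_iff_mem_E hI).1 x.2)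

end Forms

/-! ### The explicit resolution and coresolution -/

section Resolution

variable {k Q : Type u} [Field k] [Fintype Q] [Quiver.{u} Q]
  {I : TwoSidedIdeal (PathAlgebra k Q)} (hI : IsStringPresentation I)

open PathAlgebra MulOpposite

theorem card_label_two : Fintype.card (Label 2) ≤ 6 := by
  change Fintype.card (Fin 6 × (Fin 0 → Fin 2)) ≤ 6
  simp

open Classical in
theorem ResData.matrix_one {B k V : Type u} [Field k] [AddCommGroup V] [Module k V]
    {S : PathSys Q B} (R : ResData S) (P : PathAlg S k V) (l : Label 1) (l' : Label 2) :
    R.matrix P 1 l l' = 0 ∨ R.matrix P 1 l l' = P.co (R.X l'.1 0 l'.2) := by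
  change (if l = parent l'.1 then _ else 0) = 0 ∨ (if l = parent l'.1 then _ else 0) = _
  split_ifs
  · exact Or.inr rfl
  · exact Or.inl rfl

theorem ResData.mul_matrix_one {B k V : Type u} [Field k] [AddCommGroup V] [Module k V]
    {S : PathSys Q B} (R : ResData S) (P : PathAlg S k V) {x : Label 2 → V}
    (h : ∀ l, R.dif P 1 x l = 0) (l : Label 1) (l' : Label 2) :
    P.mul (R.matrix P 1 l l') (x l') = 0 := by
  rcases R.matrix_one P l l' with h' | h'
  · rw [h', map_zero, LinearMap.zero_apply]
  · rw [h']
    exact (R.dif_eq_zero_iff P 1 x).1 h l'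

namespace ProjResData

variable {c : Q} {a : Fin 2 → Q} (R : ProjResData I c a) (hu : ∀ i, (R.u i).length ≠ 0)

theorem isNonzero_u (i : Fin 2) : IsNonzero I (R.u i) := by
  fin_cases i
  · exact R.pair_c.nonzero_left
  · exact R.pair_c.nonzero_right

include hu in
theorem entry_matrix (n : ℕ) (l : Label n) (l' : Label (n + 1)) :
    (quiverAlg I hI).Entry (R.point n l) (R.matrix n l l') := by
  rw [← R.toRes_point hu, ← R.toRes_matrix hI hu]
  exact (R.toRes hu).entry_matrix _ n l l'

theorem toRes_dif (n : ℕ) (x : Label (n + 1) → BoundAlgebra I) (l : Label n) :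
    (R.toRes hu).dif (quiverAlg I hI) n x l = ∑ l', R.matrix n l l' * x l' :=
  Finset.sum_congr rfl fun l' _ => by rw [alg_mul, R.toRes_matrix hI hu]

include hu in
theorem exact_matrix (n : ℕ) (x : Label (n + 1) → BoundAlgebra I)
    (hx : ∀ l, x l ∈ (quiverAlg I hI).E (R.point (n + 1) l)) :
    (∀ l, ∑ l', R.matrix n l l' * x l' = 0) ↔ ∃ y : Label (n + 2) → BoundAlgebra I,
      (∀ l, y l ∈ (quiverAlg I hI).E (R.point (n + 2) l)) ∧
        ∀ l, ∑ l', R.matrix (n + 1) l l' * y l' = x l := by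
  have := (R.toRes hu).exact (quiverAlg I hI) n x fun l => by
    rw [R.toRes_point hu]; exact hx l
  simpa only [R.toRes_dif hI hu, R.toRes_point hu] using this

-- The image of `d 1` is recorded along with the resolution because exactness makes it the second
-- syzygy of `I(c)`.
include hI hu in
theorem exists_resolution :
    ∃ (ε : R.Term 0 →ₗ[(BoundAlgebra I)ᵐᵒᵖ] Inj I c)
      (d : ∀ n, R.Term (n + 1) →ₗ[(BoundAlgebra I)ᵐᵒᵖ] R.Term n),
      R.IsInducedByPaths ε d ∧ IsMinimalProjectiveResolution ε d ∧
        IsSumOfUniserials (BoundAlgebra I)ᵐᵒᵖ 6 (LinearMap.range (d 1)) := by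
  let φ : Label 0 → QPath Q := fun i : Fin 2 => toQ (R.u i)
  have hM := R.entry_matrix hI hu
  have hφ : ∀ l, (φ l).2.1 = c := fun _ => rfl
  have hε : Function.Exact (projMap hI (pt' := R.point 1) (R.matrix 0) (hM 0))
      (formMap hI φ c) := formMap_exact hI hφ (hM 0) fun x hx =>
    ((R.toRes hu).exact_pairing (quiverAlg I hI) x hx).trans (exists_congr fun y => and_congr
      (forall_congr' fun l => by rw [R.toRes_point hu])
      (forall_congr' fun l => (congrArg (· = x l) (R.toRes_dif hI hu 0 y l)).to_iff))
  have hd : ∀ n, Function.Exact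
      (projMap hI (pt' := R.point (n + 2)) (R.matrix (n + 1)) (hM (n + 1)))
      (projMap hI (R.matrix n) (hM n)) := fun n =>
    projMap_exact hI (hM n) (hM (n + 1)) (R.exact_matrix hI hu n)
  refine ⟨formMap hI φ c, fun n => projMap hI (R.matrix n) (hM n), ⟨?_, ?_⟩, ⟨?_, ?_, hε, hd, ?_, ?_⟩,
    ?_⟩
  · refine ⟨fun i => LinearMap.proj (toQ (R.u i)) ∘ₗ coeffs hI, fun i => ?_, fun x y => ?_⟩
    · exact (isDualOfPath_iff hI (R.isNonzero_u i)).2 fun _ => rfl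
    · refine (eval_formMap hI hφ x y).trans ?_
      exact Finset.sum_congr rfl fun i _ => by
        rw [PTerm.coord_val x ⟨i, rfl⟩]; rfl
  · intro n x s
    rfl
  · exact fun n => inferInstanceAs (Module.Projective _ (PTerm I (R.point n)))
  · refine formMap_surjective hI hφ fun y hy h => ?_
    exact (R.toRes hu).pairing_nondegenerate (quiverAlg I hI) hy h
  · rw [LinearMap.exact_iff.1 hε]
    exact isSuperfluous_range_projMap hI (hM 0)
  · intro n
    rw [LinearMap.exact_iff.1 (hd n)]
    exact isSuperfluous_range_projMap hI (hM (n + 1))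
  · refine isSumOfUniserials_range_projMap hI (hM 1) card_label_two (fun x _ h l l' => ?_)
      fun l' => ?_
    · rw [← R.toRes_matrix hI hu, ← alg_mul hI]
      exact (R.toRes hu).mul_matrix_one _ (fun l => by rw [R.toRes_dif hI hu]; exact h l) l l'
    · refine ⟨_, (R.toRes hu).good_X l'.1 0 l'.2, fun l => ?_⟩
      rw [← R.toRes_matrix hI hu]
      exact (R.toRes hu).matrix_one _ l l'

end ProjResData

namespace InjResData

variable {z : Q} {e : Fin 2 → Q} (R : InjResData I z e) (hu : ∀ i, (R.u i).length ≠ 0)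

theorem isNonzero_u (i : Fin 2) : IsNonzero I (R.u i) := by
  fin_cases i
  · exact R.pair_z.nonzero_left
  · exact R.pair_z.nonzero_right

include hu in
theorem entry_matrix (n : ℕ) (l : Label n) (l' : Label (n + 1)) :
    (quiverAlg I hI).op.Entry (R.point n l) (R.matrix n l l') := by
  rw [← R.toRes_point hu, ← R.toRes_matrix hI hu]
  exact (R.toRes hu).entry_matrix _ n l l'

theorem toRes_dif (n : ℕ) (x : Label (n + 1) → BoundAlgebra I) (l : Label n) :
    (R.toRes hu).dif (quiverAlg I hI).op n x l = ∑ l', x l' * R.matrix n l l' :=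
  Finset.sum_congr rfl fun l' _ => by rw [alg_op_mul, R.toRes_matrix hI hu]

include hu in
theorem exact_matrix (n : ℕ) (x : Label (n + 1) → BoundAlgebra I)
    (hx : ∀ l, x l ∈ (quiverAlg I hI).op.E (R.point (n + 1) l)) :
    (∀ l, ∑ l', x l' * R.matrix n l l' = 0) ↔ ∃ y : Label (n + 2) → BoundAlgebra I,
      (∀ l, y l ∈ (quiverAlg I hI).op.E (R.point (n + 2) l)) ∧
        ∀ l, ∑ l', y l' * R.matrix (n + 1) l l' = x l := by
  have := (R.toRes hu).exact (quiverAlg I hI).op n x fun l => by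
    rw [R.toRes_point hu]; exact hx l
  simpa only [R.toRes_dif hI hu, R.toRes_point hu] using this

include hI hu in
theorem exists_coresolution :
    ∃ (η : Proj I z →ₗ[(BoundAlgebra I)ᵐᵒᵖ] R.Term 0)
      (d : ∀ n, R.Term n →ₗ[(BoundAlgebra I)ᵐᵒᵖ] R.Term (n + 1)),
      R.IsInducedByPaths η d ∧ IsMinimalInjectiveCoresolution η d ∧
        IsSumOfUniserials (BoundAlgebra I)ᵐᵒᵖ 6 (LinearMap.range (d 1)) := by
  let φ : Label 0 → QPath Q := fun i : Fin 2 => toQ (R.u i)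
  have hM := R.entry_matrix hI hu
  have hη : Function.Exact (coformMap hI φ z)
      (injMap (pt := R.point 0) (pt' := R.point 1) (R.matrix 0)) :=
    coformMap_exact hI (hM 0) fun x hx =>
      ((R.toRes hu).exact_pairing (quiverAlg I hI).op x hx).trans (exists_congr fun y => and_congr
        (forall_congr' fun l => by rw [R.toRes_point hu])
        (forall_congr' fun l => (congrArg (· = x l) (R.toRes_dif hI hu 0 y l)).to_iff))
  have hd : ∀ n, Function.Exact (injMap (pt := R.point n) (pt' := R.point (n + 1)) (R.matrix n))
      (injMap (pt' := R.point (n + 2)) (R.matrix (n + 1))) := fun n =>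
    injMap_exact hI (hM n) (hM (n + 1)) (R.exact_matrix hI hu n)
  refine ⟨coformMap hI φ z, fun n => injMap (R.matrix n), ⟨?_, ?_⟩, ⟨?_, ?_, hη, hd, ?_, ?_⟩, ?_⟩
  · refine ⟨fun i => LinearMap.proj (toQ (R.u i)) ∘ₗ coeffs hI, fun i => ?_, fun x i y hy => ?_⟩
    · exact (isDualOfPath_iff hI (R.isNonzero_u i)).2 fun _ => rfl
    · exact eval_coformMap hI (pt := R.point 0) x ⟨i, rfl⟩ hy
  · intro n f t y hy
    exact eval_injMap (pt := R.point n) (pt' := R.point (n + 1)) (R.matrix n) f t hy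
  · exact fun n => ITerm.injective_module
  · refine coformMap_injective hI fun x hx h => ?_
    exact (R.toRes hu).pairing_nondegenerate (quiverAlg I hI).op hx h
  · rw [← LinearMap.exact_iff.1 hη]
    exact isEssential_ker_injMap hI (hM 0)
  · intro n
    rw [← LinearMap.exact_iff.1 (hd n)]
    exact isEssential_ker_injMap hI (hM (n + 1))
  · refine isSumOfUniserials_range_injMap hI (hM 1) card_label_two (fun x _ h l l' => ?_)
      fun l' => ?_
    · rw [← R.toRes_matrix hI hu, ← alg_op_mul hI]
      exact (R.toRes hu).mul_matrix_one _ (fun l => by rw [R.toRes_dif hI hu]; exact h l) l l'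
    · refine ⟨_, (R.toRes hu).good_X l'.1 0 l'.2, fun l => ?_⟩
      rw [← R.toRes_matrix hI hu]
      exact (R.toRes hu).matrix_one _ l l'

end InjResData

end Resolution

/-! ### Invariance of syzygies under isomorphism -/

section Transport

variable {R : Type u} [Ring R] {M M' N : Type u} [AddCommGroup M] [Module R M]
  [AddCommGroup M'] [Module R M'] [AddCommGroup N] [Module R N]

theorem IsSecondSyzygy.of_equiv (e : M ≃ₗ[R] M') (h : IsSecondSyzygy R M N) :
    IsSecondSyzygy R M' N := by
  obtain ⟨K, _, _, ⟨P, _, _, f, hf, ⟨i⟩⟩, hN⟩ := h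
  exact ⟨K, _, _, ⟨P, _, _, _, hf.equiv_comp e,
    ⟨i ≪≫ₗ LinearEquiv.ofEq _ _ (LinearEquiv.ker_comp _ _).symm⟩⟩, hN⟩

theorem IsSecondCosyzygy.of_equiv (e : M ≃ₗ[R] M') (h : IsSecondCosyzygy R M N) :
    IsSecondCosyzygy R M' N := by
  obtain ⟨K, _, _, ⟨P, _, _, f, hf, ⟨i⟩⟩, hN⟩ := h
  exact ⟨K, _, _, ⟨P, _, _, _, hf.comp_equiv e.symm,
    ⟨i ≪≫ₗ Submodule.quotEquivOfEq _ _ (LinearEquiv.range_comp _ _).symm⟩⟩, hN⟩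

end Transport

/-! ### Second syzygies and cosyzygies as sums of uniserial modules -/

section Syzygies

variable {k Q : Type u} [Field k] [Fintype Q] [Quiver.{u} Q]
  {I : TwoSidedIdeal (PathAlgebra k Q)} (hI : IsStringPresentation I)

open PathAlgebra MulOpposite

variable {N : Type u} [AddCommGroup N] [Module (BoundAlgebra I)ᵐᵒᵖ N]

include hI in
theorem ProjResData.isSumOfUniserials {c : Q} {a : Fin 2 → Q} (R : ProjResData I c a)
    (hu : ∀ i, (R.u i).length ≠ 0) (h : IsSecondSyzygy (BoundAlgebra I)ᵐᵒᵖ (Inj I c) N) :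
    IsSumOfUniserials (BoundAlgebra I)ᵐᵒᵖ 6 N := by
  obtain ⟨ε, d, -, hr, hs⟩ := R.exists_resolution hI hu
  obtain ⟨e⟩ := h.equiv_ker ⟨hr.projective 0, hr.surjective, hr.minimal_zero⟩ (hr.projective 1)
    hr.exact_zero (hr.minimal_succ 0)
  rw [← LinearMap.exact_iff.1 (hr.exact_succ 0)] at hs
  exact hs.of_equiv e.symm

include hI in
theorem InjResData.isSumOfUniserials {z : Q} {e : Fin 2 → Q} (R : InjResData I z e)
    (hu : ∀ i, (R.u i).length ≠ 0) (h : IsSecondCosyzygy (BoundAlgebra I)ᵐᵒᵖ (Proj I z) N) :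
    IsSumOfUniserials (BoundAlgebra I)ᵐᵒᵖ 6 N := by
  obtain ⟨η, d, -, hr, hs⟩ := R.exists_coresolution hI hu
  obtain ⟨e⟩ := h.equiv_quotient ⟨hr.injective_module 0, hr.injective, hr.minimal_zero⟩
    (hr.injective_module 1) hr.exact_zero (hr.minimal_succ 0)
  rw [← LinearMap.exact_iff.1 (hr.exact_succ 0)] at e
  exact hs.of_equiv (e ≪≫ₗ (d 1).quotKerEquivRange).symm

theorem card_degenerate : Fintype.card (Fin 2 × Fin 2) ≤ 6 := by decide

-- Here the first three terms have at most one, two and four summands, so at most four uniserials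
-- occur.
include hI in
theorem ResData₁.isSumOfUniserials (R : ResData₁ (quiverSys I))
    (h : IsSecondSyzygy (BoundAlgebra I)ᵐᵒᵖ (Inj I R.u.2.1) N) :
    IsSumOfUniserials (BoundAlgebra I)ᵐᵒᵖ 6 N := by
  let P := quiverAlg I hI
  let pt₀ : Unit → Option Q := fun _ => some R.u.1
  let pt₁ : Fin 2 → Option Q := fun i => (quiverSys I).pt (R.o i)
  let pt₂ : Fin 2 × Fin 2 → Option Q := fun j => (quiverSys I).pt (R.X j.1 j.2)
  let φ : Unit → QPath Q := fun _ => R.u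
  let M₀ : Unit → Fin 2 → BoundAlgebra I := fun _ i => P.co (R.o i)
  have hM₀ : ∀ l l', P.Entry (pt₀ l) (M₀ l l') := fun _ i => R.entry_o P i
  have hM₁ : ∀ l l', P.Entry (pt₁ l) (R.matrix P l l') := R.entry_matrix P
  have hφ : ∀ l, (φ l).2.1 = R.u.2.1 := fun _ => rfl
  have hsurj : Function.Surjective (formMap (pt := pt₀) hI φ R.u.2.1) :=
    formMap_surjective hI hφ fun y hy h => R.pairing_nondegenerate P hy fun x hx =>
      (Fintype.sum_unique fun _ : Unit => coeffs hI (x * y) R.u).symm.trans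
        (h (fun _ => x) fun _ => hx)
  have hε : Function.Exact (projMap hI (pt' := pt₁) M₀ hM₀) (formMap hI φ R.u.2.1) :=
    formMap_exact hI hφ hM₀ fun x hx => by
      simp only [Fintype.sum_unique, Fin.sum_univ_two, Fin.forall_fin_two]
      refine (R.exact_pairing P (hx ())).trans ⟨?_, ?_⟩
      · rintro ⟨y₀, h₀, y₁, h₁, h⟩
        exact ⟨![y₀, y₁], ⟨h₀, h₁⟩, fun _ => h⟩
      · rintro ⟨y, ⟨h₀, h₁⟩, h⟩
        exact ⟨y 0, h₀, y 1, h₁, h ()⟩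
  have hd : Function.Exact (projMap hI (pt' := pt₂) (R.matrix P) hM₁) (projMap hI M₀ hM₀) :=
    projMap_exact hI hM₀ hM₁ fun x hx => by
      refine Iff.trans ?_ (R.exact_o P x hx)
      exact ⟨fun h => h (), fun h _ => h⟩
  have hs := isSumOfUniserials_range_projMap hI (pt' := pt₂) hM₁ card_degenerate
    (fun y _ h => R.indep_matrix P y h) fun l' => ⟨_, R.good_X l'.1 l'.2, fun l => by
      unfold ResData₁.matrix
      split_ifs
      · exact Or.inr rfl
      · exact Or.inl rfl⟩
  have hk := LinearMap.exact_iff.1 hε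
  have hk' := LinearMap.exact_iff.1 hd
  obtain ⟨e⟩ := h.equiv_ker ⟨inferInstance, hsurj, by
    rw [hk]; exact isSuperfluous_range_projMap hI hM₀⟩ inferInstance hε (by
      rw [hk']; exact isSuperfluous_range_projMap hI hM₁)
  rw [← hk'] at hs
  exact hs.of_equiv e.symm

include hI in
theorem ResData₁.isSumOfUniserials_op (R : ResData₁ (quiverSys I).op)
    (h : IsSecondCosyzygy (BoundAlgebra I)ᵐᵒᵖ (Proj I R.u.1) N) :
    IsSumOfUniserials (BoundAlgebra I)ᵐᵒᵖ 6 N := by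
  let P := (quiverAlg I hI).op
  let pt₀ : Unit → Option Q := fun _ => some R.u.2.1
  let pt₁ : Fin 2 → Option Q := fun i => (quiverSys I).op.pt (R.o i)
  let pt₂ : Fin 2 × Fin 2 → Option Q := fun j => (quiverSys I).op.pt (R.X j.1 j.2)
  let φ : Unit → QPath Q := fun _ => R.u
  let M₀ : Unit → Fin 2 → BoundAlgebra I := fun _ i => P.co (R.o i)
  have hM₀ : ∀ l l', P.Entry (pt₀ l) (M₀ l l') := fun _ i => R.entry_o P i
  have hM₁ : ∀ l l', P.Entry (pt₁ l) (R.matrix P l l') := R.entry_matrix P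
  have hinj : Function.Injective (coformMap (pt := pt₀) hI φ R.u.1) :=
    coformMap_injective hI fun y hy h => R.pairing_nondegenerate P hy fun x hx =>
      (Fintype.sum_unique fun _ : Unit => coeffs hI (y * x) R.u).symm.trans
        (h (fun _ => x) fun _ => hx)
  have hη : Function.Exact (coformMap hI φ R.u.1) (injMap (pt := pt₀) (pt' := pt₁) M₀) :=
    coformMap_exact hI hM₀ fun x hx => by
      simp only [Fintype.sum_unique, Fin.sum_univ_two, Fin.forall_fin_two]
      refine (R.exact_pairing P (hx ())).trans ⟨?_, ?_⟩
      · rintro ⟨y₀, h₀, y₁, h₁, h⟩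
        exact ⟨![y₀, y₁], ⟨h₀, h₁⟩, fun _ => h⟩
      · rintro ⟨y, ⟨h₀, h₁⟩, h⟩
        exact ⟨y 0, h₀, y 1, h₁, h ()⟩
  have hd : Function.Exact (injMap (pt := pt₀) (pt' := pt₁) M₀)
      (injMap (pt' := pt₂) (R.matrix P)) :=
    injMap_exact hI hM₀ hM₁ fun x hx => by
      refine Iff.trans ?_ (R.exact_o P x hx)
      exact ⟨fun h => h (), fun h _ => h⟩
  have hs := isSumOfUniserials_range_injMap hI (pt := pt₁) (pt' := pt₂) hM₁ card_degenerate
    (fun y _ h => R.indep_matrix P y h) fun l' => ⟨_, R.good_X l'.1 l'.2, fun l => by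
      unfold ResData₁.matrix
      split_ifs
      · exact Or.inr rfl
      · exact Or.inl rfl⟩
  have hk := LinearMap.exact_iff.1 hη
  have hk' := LinearMap.exact_iff.1 hd
  obtain ⟨e⟩ := h.equiv_quotient ⟨ITerm.injective_module, hinj, by
    rw [← hk]; exact isEssential_ker_injMap hI hM₀⟩ ITerm.injective_module hη (by
      rw [← hk']; exact isEssential_ker_injMap hI hM₁)
  rw [← hk'] at e
  exact hs.of_equiv (e ≪≫ₗ (LinearMap.quotKerEquivRange _)).symm

end Syzygies

/-! ### Existence of maximal paths -/

/-- The formal properties of the paths of a string presentation. -/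
structure PathSys.IsString {Q B : Type u} (S : PathSys Q B) : Prop where
  split : ∀ q n, n ≤ S.len q → ∃ p r, S.C p r q ∧ S.len p = n
  uniq_right : ∀ {b a a' q q'}, S.len b = 1 → S.len a = 1 → S.len a' = 1 → S.C b a q → S.C b a' q' →
    S.nz q → S.nz q' → a = a'
  uniq_left : ∀ {b a a' q q'}, S.len b = 1 → S.len a = 1 → S.len a' = 1 → S.C a b q → S.C a' b q' →
    S.nz q → S.nz q' → a = a'
  two_source : ∀ {a b c}, S.len a = 1 → S.len b = 1 → S.len c = 1 → S.s a = S.s c → S.s b = S.s c →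
    a = b ∨ a = c ∨ b = c
  two_target : ∀ {a b c}, S.len a = 1 → S.len b = 1 → S.len c = 1 → S.t a = S.t c → S.t b = S.t c →
    a = b ∨ a = c ∨ b = c
  nz_e : ∀ x, S.nz (S.e x)
  bound : ∃ N, ∀ q, S.nz q → S.len q < N

namespace PathSys.IsString

variable {Q B : Type u} {S : PathSys Q B} (hS : S.IsString)

include hS

theorem op : S.op.IsString where
  split q n hn := by
    obtain ⟨p, r, h, hp⟩ := hS.split q (S.len q - n) (Nat.sub_le _ _)
    refine ⟨r, p, h, ?_⟩
    have := S.C_len h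
    change S.len r = n
    change n ≤ S.len q at hn
    omega
  uniq_right := hS.uniq_left
  uniq_left := hS.uniq_right
  two_source := hS.two_target
  two_target := hS.two_source
  nz_e := hS.nz_e
  bound := hS.bound

theorem exists_init {q : B} {n : ℕ} (hn : n ≤ S.len q) : ∃ p, S.Init p q ∧ S.len p = n := by
  obtain ⟨p, r, h, hp⟩ := hS.split q n hn
  exact ⟨p, ⟨r, h⟩, hp⟩

theorem uniq {p a a' q q' : B} (hp : S.len p ≠ 0) (ha : S.len a = 1) (ha' : S.len a' = 1)
    (h : S.C p a q) (h' : S.C p a' q') (hq : S.nz q) (hq' : S.nz q') : a = a' := by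
  obtain ⟨r, b, hb, hr⟩ := hS.split p (S.len p - 1) (Nat.sub_le _ _)
  have hlb : S.len b = 1 := by
    have := S.C_len hb
    omega
  obtain ⟨w, hw, hw'⟩ := S.C_assoc hb h
  obtain ⟨v, hv, hv'⟩ := S.C_assoc hb h'
  exact hS.uniq_right hlb ha ha' hw hv (S.nz_right hw' hq) (S.nz_right hv' hq')

/-- After a common non-stationary initial part, the string condition determines each further arrow
of a non-zero path. -/
theorem comparable {p q q' : B} (hp : S.len p ≠ 0) (h : S.Init p q) (h' : S.Init p q')
    (hq : S.nz q) (hq' : S.nz q') (hl : S.len q ≤ S.len q') : S.Init q q' := by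
  have key : ∀ n, S.len p ≤ n → n ≤ S.len q → ∃ r, S.Init r q ∧ S.Init r q' ∧ S.len r = n := by
    intro n hn
    induction n, hn using Nat.le_induction with
    | base => exact fun _ => ⟨p, h, h', rfl⟩
    | succ n hn ih =>
      intro hnq
      obtain ⟨r, hr, hr', hrn⟩ := ih (by omega)
      obtain ⟨v, hv, hvn⟩ := hS.exists_init hnq
      obtain ⟨w, hw, hwn⟩ := hS.exists_init (hnq.trans hl)
      obtain ⟨a, ha⟩ := hr.total hv (by omega)
      obtain ⟨b, hb⟩ := hr'.total hw (by omega)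
      have hla := S.C_len ha
      have hlb := S.C_len hb
      obtain rfl := hS.uniq (by omega) (by omega) (by omega) ha hb (hv.nz hq) (hw.nz hq')
      obtain rfl := S.C_fun ha hb
      exact ⟨v, hv, hw, hvn⟩
  obtain ⟨r, hr, hr', hrl⟩ := key (S.len q) h.len_le le_rfl
  exact ((Init.refl q).total hr hrl.ge).trans hr'

theorem exists_longest (T : Set B) (hT : ∀ q ∈ T, S.nz q) (hne : T.Nonempty) :
    ∃ m ∈ T, ∀ q ∈ T, S.len q ≤ S.len m := by
  obtain ⟨N, hN⟩ := hS.bound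
  have hfin : (S.len '' T).Finite := (Set.finite_lt_nat N).subset (by
    rintro _ ⟨q, hq, rfl⟩
    exact hN q (hT q hq))
  obtain ⟨n, ⟨m, hm, rfl⟩, hmax⟩ := hfin.exists_maximal (hne.image _)
  refine ⟨m, hm, fun q hq => ?_⟩
  rcases le_total (S.len m) (S.len q) with h | h
  · exact hmax ⟨q, hq, rfl⟩ h
  · exact h

theorem exists_maxPair (x : Q) : ∃ m₀ m₁, S.s m₀ = x ∧ S.MaxPair m₀ m₁ := by
  obtain ⟨m₀, ⟨hnz₀, hs₀⟩, hmax₀⟩ := hS.exists_longest {q | S.nz q ∧ S.s q = x} (fun q h => h.1)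
    ⟨S.e x, hS.nz_e x, S.s_e x⟩
  -- `m₀` is a longest non-zero path from `x`; `m₁` is a longest one that does not share its first
  -- arrow with `m₀`, possibly stationary.
  obtain ⟨m₁, ⟨hnz₁, hs₁, hd⟩, hmax₁⟩ := hS.exists_longest
    {q | S.nz q ∧ S.s q = x ∧ ∀ a, S.len a = 1 → S.Init a q → ¬ S.Init a m₀} (fun q h => h.1)
    ⟨S.e x, hS.nz_e x, S.s_e x, fun a ha h => by
      have := h.len_le
      rw [S.len_e] at this
      omega⟩
  refine ⟨m₀, m₁, hs₀, hnz₀, hnz₁, hs₁.trans hs₀.symm, fun q hq hs => ?_, fun q h h' => ?_⟩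
  · by_cases h : ∃ a, S.len a = 1 ∧ S.Init a q ∧ S.Init a m₀
    · obtain ⟨a, ha, haq, ham⟩ := h
      exact Or.inl (hS.comparable (by omega) haq ham hq hnz₀ (hmax₀ q ⟨hq, hs.trans hs₀⟩))
    · push Not at h
      by_cases hl : S.len q = 0
      · rw [S.eq_e hl, hs]
        exact Or.inl (e_init m₀)
      · have hl₁ := hmax₁ q ⟨hq, hs.trans hs₀, h⟩
        have hl₀ := hmax₀ q ⟨hq, hs.trans hs₀⟩
        obtain ⟨a, haq, ha⟩ := hS.exists_init (q := q) (n := 1) (by omega)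
        obtain ⟨a₀, ham₀, ha₀⟩ := hS.exists_init (q := m₀) (n := 1) (by omega)
        obtain ⟨a₁, ham₁, ha₁⟩ := hS.exists_init (q := m₁) (n := 1) (by omega)
        have hsa : S.s a = x := by rw [← haq.s_eq, hs, hs₀]
        have hsa₀ : S.s a₀ = x := by rw [← ham₀.s_eq, hs₀]
        have hsa₁ : S.s a₁ = x := by rw [← ham₁.s_eq, hs₁]
        -- Only two arrows start at `x`, so a path avoiding the first arrow of `m₀` must begin with
        -- that of `m₁`.
        rcases hS.two_source ha ha₁ ha₀ (hsa.trans hsa₀.symm) (hsa₁.trans hsa₀.symm) with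
          rfl | rfl | rfl
        · exact Or.inr (hS.comparable (by omega) haq ham₁ hq hnz₁ hl₁)
        · exact absurd ham₀ (h a ha haq)
        · exact absurd ham₀ (hd a₁ ha₁ ham₁)
  · by_contra hl
    obtain ⟨a, haq, ha⟩ := hS.exists_init (q := q) (n := 1) (by omega)
    exact hd a ha (haq.trans h') (haq.trans h)

/-- If neither were stationary, `w₀` and `w₁` would begin with the same arrow. The last arrows of
`u₀` and `u₁` both have a non-zero product with it, so they coincide, against disjointness. -/
theorem stationary_of_common {u₀ u₁ w₀ w₁ m₀ m₁ v : B} (h : S.op.MaxPair u₀ u₁)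
    (hu₀ : S.len u₀ ≠ 0) (hu₁ : S.len u₁ ≠ 0) (h₀ : S.C u₀ w₀ m₀) (h₁ : S.C u₁ w₁ m₁)
    (hm₀ : S.nz m₀) (hm₁ : S.nz m₁) (hw₀ : S.Init w₀ v) (hw₁ : S.Init w₁ v) :
    S.len w₀ = 0 ∨ S.len w₁ = 0 := by
  by_contra! hl
  obtain ⟨a, haw, ha⟩ := hS.exists_init (q := w₀) (n := 1) (by omega)
  have haw₁ : S.Init a w₁ := (haw.trans hw₀).total hw₁ (by omega)
  obtain ⟨b₀, hb₀, hlb₀⟩ := hS.op.exists_init (q := u₀) (n := 1) (Nat.one_le_iff_ne_zero.2 hu₀)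
  obtain ⟨b₁, hb₁, hlb₁⟩ := hS.op.exists_init (q := u₁) (n := 1) (Nat.one_le_iff_ne_zero.2 hu₁)
  have key : ∀ {u w m b}, S.C u w m → S.nz m → S.op.Init b u → S.Init a w →
      ∃ q, S.C b a q ∧ S.nz q := by
    rintro u w m b hm hnz ⟨r, hr⟩ ⟨r', hr'⟩
    obtain ⟨x, hx, hx'⟩ := S.C_assoc hr hm
    obtain ⟨y, hy, hy'⟩ := S.C_assoc' hr' hx
    exact ⟨y, hy, S.nz_left hy' (S.nz_right hx' hnz)⟩
  obtain ⟨q₀, hq₀, hnz₀⟩ := key h₀ hm₀ hb₀ haw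
  obtain ⟨q₁, hq₁, hnz₁⟩ := key h₁ hm₁ hb₁ haw₁
  obtain rfl := hS.uniq_left ha hlb₀ hlb₁ hq₀ hq₁ hnz₀ hnz₁
  have := h.disjoint b₀ hb₀ hb₁
  omega

end PathSys.IsString

section Quiver

variable {k Q : Type u} [Field k] [Fintype Q] [Quiver.{u} Q]
  {I : TwoSidedIdeal (PathAlgebra k Q)} (hI : IsStringPresentation I)

theorem path_split {a b : Q} (p : Path a b) (n : ℕ) (hn : n ≤ p.length) :
    ∃ (c : Q) (f : Path a c) (g : Path c b), p = f.comp g ∧ f.length = n := by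
  induction p with
  | nil => exact ⟨a, Path.nil, Path.nil, rfl, by simpa using hn.antisymm' (Nat.zero_le _)⟩
  | @cons b c p e ih =>
    rcases hn.lt_or_eq with h | h
    · obtain ⟨d, f, g, rfl, hf⟩ := ih (Nat.lt_succ_iff.1 h)
      exact ⟨d, f, g.cons e, rfl, hf⟩
    · exact ⟨_, p.cons e, Path.nil, rfl, h.symm⟩

theorem exists_arrow {q : QPath Q} (h : q.2.2.length = 1) :
    ∃ (a b : Q) (e : a ⟶ b), q = toQ e.toPath := by
  obtain ⟨a, b, p⟩ := q
  cases p with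
  | nil => simp at h
  | cons p e =>
    cases p with
    | nil => exact ⟨_, _, e, rfl⟩
    | cons p e => simp at h

theorem eq_of_card_le_two {α : Type*} (h : ENat.card α ≤ 2) (a b c : α) :
    a = b ∨ a = c ∨ b = c := by
  by_contra! hne
  obtain ⟨h1, h2, h3⟩ := hne
  have hinj : Function.Injective ![a, b, c] := by
    intro i j hij
    fin_cases i <;> fin_cases j <;> simp_all [eq_comm]
  have := (ENat.card_le_card_of_injective hinj).trans h
  rw [ENat.card_eq_coe_fintype_card, Fintype.card_fin] at this
  exact absurd this (by decide)

include hI in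
theorem quiverSys_isString : (quiverSys I).IsString where
  split q n hn := by
    obtain ⟨a, b, p⟩ := q
    obtain ⟨c, f, g, rfl, hf⟩ := path_split p n hn
    exact ⟨_, _, ⟨f, g⟩, hf⟩
  uniq_right := by
    intro b a a' q q' hb ha ha' h h' hq hq'
    obtain ⟨x, y, β, rfl⟩ := exists_arrow hb
    obtain ⟨y', z, α, rfl⟩ := exists_arrow ha
    obtain ⟨y'', z', α', rfl⟩ := exists_arrow ha'
    obtain rfl : y = y' := (quiverSys I).C_mid h
    obtain rfl : y = y'' := (quiverSys I).C_mid h'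
    obtain rfl := QComp.eq h
    obtain rfl := QComp.eq h'
    cases hI.unique_right β ⟨z, α⟩ ⟨z', α'⟩ hq hq'
    rfl
  uniq_left := by
    intro b a a' q q' hb ha ha' h h' hq hq'
    obtain ⟨x, y, β, rfl⟩ := exists_arrow hb
    obtain ⟨z, x', α, rfl⟩ := exists_arrow ha
    obtain ⟨z', x'', α', rfl⟩ := exists_arrow ha'
    obtain rfl : x' = x := (quiverSys I).C_mid h
    obtain rfl : x'' = x' := (quiverSys I).C_mid h'
    obtain rfl := QComp.eq h
    obtain rfl := QComp.eq h'
    cases hI.unique_left β ⟨z, α⟩ ⟨z', α'⟩ hq hq'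
    rfl
  two_source := by
    intro a b c ha hb hc h h'
    obtain ⟨x, y, α, rfl⟩ := exists_arrow ha
    obtain ⟨x', y', β, rfl⟩ := exists_arrow hb
    obtain ⟨x'', y'', γ, rfl⟩ := exists_arrow hc
    obtain rfl : x = x'' := h
    obtain rfl : x' = x := h'
    rcases eq_of_card_le_two (hI.source_le_two x') ⟨y, α⟩ ⟨y', β⟩ ⟨y'', γ⟩ with h | h | h <;>
      cases h <;> simp
  two_target := by
    intro a b c ha hb hc h h'
    obtain ⟨y, x, α, rfl⟩ := exists_arrow ha
    obtain ⟨y', x', β, rfl⟩ := exists_arrow hb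
    obtain ⟨y'', x'', γ, rfl⟩ := exists_arrow hc
    obtain rfl : x = x'' := h
    obtain rfl : x' = x := h'
    rcases eq_of_card_le_two (hI.target_le_two x') ⟨y, α⟩ ⟨y', β⟩ ⟨y'', γ⟩ with h | h | h <;>
      cases h <;> simp
  nz_e := isNonzero_nil hI
  bound := by
    obtain ⟨N, hN⟩ := hI.pow_le
    exact ⟨N, fun q hq => not_le.1 fun h => hq (hN q h)⟩

end Quiver

/-! ### Existence of the paths in the corollary -/

section Existence

variable {k Q : Type u} [Field k] [Fintype Q] [Quiver.{u} Q]
  {I : TwoSidedIdeal (PathAlgebra k Q)} (hI : IsStringPresentation I)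

theorem isInitial_of_init {x y z : Q} {p : Path x y} {m : Path x z}
    (h : (quiverSys I).Init (toQ p) (toQ m)) : IsInitial p m := by
  obtain ⟨y', p', h1, h2⟩ := init_isInitial h
  obtain rfl : y = y' := congrArg (fun q : QPath Q => q.2.1) h1
  obtain rfl := sigma_path_inj h1
  exact h2

theorem isTerminal_of_init {x y z : Q} {p : Path y x} {m : Path z x}
    (h : (quiverSys I).op.Init (toQ p) (toQ m)) : IsTerminal p m := by
  obtain ⟨y', p', h1, h2⟩ := init_isTerminal h
  obtain rfl : y = y' := congrArg (fun q : QPath Q => q.1) h1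
  obtain rfl := sigma_path_inj h1
  exact h2

include hI in
theorem exists_maximalPairFrom (x : Q) :
    ∃ (y₀ y₁ : Q) (m₀ : Path x y₀) (m₁ : Path x y₁), MaximalPairFrom I m₀ m₁ := by
  obtain ⟨⟨x', y₀, m₀⟩, ⟨x'', y₁, m₁⟩, hs, h⟩ := (quiverSys_isString hI).exists_maxPair x
  obtain rfl : x' = x := hs
  obtain rfl : x'' = x' := h.src
  exact ⟨y₀, y₁, m₀, m₁, h.nz_left, h.nz_right,
    fun q hq => (h.cover (toQ q) hq rfl).imp isInitial_of_init isInitial_of_init,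
    fun q h0 h1 => h.disjoint (toQ q) h0.init h1.init⟩

include hI in
theorem exists_maximalPairTo (x : Q) :
    ∃ (y₀ y₁ : Q) (m₀ : Path y₀ x) (m₁ : Path y₁ x), MaximalPairTo I m₀ m₁ := by
  obtain ⟨⟨y₀, x', m₀⟩, ⟨y₁, x'', m₁⟩, hs, h⟩ := (quiverSys_isString hI).op.exists_maxPair x
  obtain rfl : x' = x := hs
  obtain rfl : x'' = x' := h.src
  exact ⟨y₀, y₁, m₀, m₁, h.nz_left, h.nz_right,
    fun q hq => (h.cover (toQ q) hq rfl).imp isTerminal_of_init isTerminal_of_init,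
    fun q h0 h1 => h.disjoint (toQ q) h0.init h1.init⟩

theorem MaximalPairFrom.symm {x y₀ y₁ : Q} {m₀ : Path x y₀} {m₁ : Path x y₁}
    (h : MaximalPairFrom I m₀ m₁) : MaximalPairFrom I m₁ m₀ :=
  ⟨h.nonzero_right, h.nonzero_left, fun q hq => (h.cover q hq).symm,
    fun q h0 h1 => h.disjoint q h1 h0⟩

theorem MaximalPairTo.symm {x y₀ y₁ : Q} {m₀ : Path y₀ x} {m₁ : Path y₁ x}
    (h : MaximalPairTo I m₀ m₁) : MaximalPairTo I m₁ m₀ :=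
  ⟨h.nonzero_right, h.nonzero_left, fun q hq => (h.cover q hq).symm,
    fun q h0 h1 => h.disjoint q h1 h0⟩

include hI in
/-- A non-zero path is contained in the first one of a suitable pair of maximal paths. -/
theorem exists_maximalPairFrom_initial {x z : Q} {q : Path x z} (hq : IsNonzero I q) :
    ∃ (y₀ y₁ : Q) (m₀ : Path x y₀) (m₁ : Path x y₁), MaximalPairFrom I m₀ m₁ ∧ IsInitial q m₀ := by
  obtain ⟨y₀, y₁, m₀, m₁, h⟩ := exists_maximalPairFrom hI x
  rcases h.cover q hq with h' | h'
  · exact ⟨_, _, _, _, h, h'⟩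
  · exact ⟨_, _, _, _, h.symm, h'⟩

include hI in
theorem exists_maximalPairTo_terminal {x z : Q} {q : Path z x} (hq : IsNonzero I q) :
    ∃ (y₀ y₁ : Q) (m₀ : Path y₀ x) (m₁ : Path y₁ x), MaximalPairTo I m₀ m₁ ∧ IsTerminal q m₀ := by
  obtain ⟨y₀, y₁, m₀, m₁, h⟩ := exists_maximalPairTo hI x
  rcases h.cover q hq with h' | h'
  · exact ⟨_, _, _, _, h, h'⟩
  · exact ⟨_, _, _, _, h.symm, h'⟩

/-- That the remaining path is again non-zero is the invariant allowing a maximal sequence to be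
continued. -/
theorem exists_rightRemainder {x y z : Q} {p : Path x y} {m : Path x z} (h : IsInitial p m)
    (hm : IsNonzero I m) :
    ∃ o : Option (RSegment Q), IsRightRemainder p m o ∧ ∀ T ∈ o, IsNonzero I T.seg := by
  obtain ⟨r, rfl⟩ := h
  by_cases hr : r.length = 0
  · cases r with
    | nil => exact ⟨none, IsRightRemainder.none p, fun T hT => by cases hT⟩
    | cons r e => simp at hr
  · obtain ⟨c, f, g, rfl, hf⟩ := path_split r 1 (Nat.one_le_iff_ne_zero.2 hr)
    obtain ⟨a, b, e, he⟩ := exists_arrow (q := toQ f) hf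
    obtain rfl : y = a := congrArg Sigma.fst he
    obtain rfl : c = b := congrArg (fun q : QPath Q => q.2.1) he
    obtain rfl := sigma_path_inj he
    rw [← Path.comp_assoc] at hm ⊢
    refine ⟨_, IsRightRemainder.some p e g, fun T hT => ?_⟩
    obtain rfl := Option.some.inj hT
    exact hm.right

theorem exists_leftRemainder {x y z : Q} {p : Path y x} {m : Path z x} (h : IsTerminal p m)
    (hm : IsNonzero I m) :
    ∃ o : Option (LSegment Q), IsLeftRemainder p m o ∧ ∀ T ∈ o, IsNonzero I T.seg := by
  obtain ⟨r, rfl⟩ := h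
  cases r with
  | nil =>
    rw [Path.nil_comp]
    exact ⟨none, IsLeftRemainder.none p, fun T hT => by cases hT⟩
  | cons r e =>
    have hc : (r.cons e).comp p = r.comp (e.toPath.comp p) := by
      rw [← Path.comp_assoc]
      rfl
    rw [hc] at hm ⊢
    refine ⟨_, IsLeftRemainder.some p e r, fun T hT => ?_⟩
    obtain rfl := Option.some.inj hT
    exact hm.left

theorem isInitial_nil {x y : Q} (m : Path x y) : IsInitial Path.nil m := ⟨m, (Path.nil_comp m).symm⟩

theorem isTerminal_nil {x y : Q} (m : Path x y) : IsTerminal Path.nil m := ⟨m, rfl⟩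

include hI in
theorem exists_rightStep (T : Option (RSegment Q)) (hT : ∀ t ∈ T, IsNonzero I t.seg) :
    ∃ o₀ o₁ : Option (RSegment Q), RightStep I T o₀ o₁ ∧ (∀ t ∈ o₀, IsNonzero I t.seg) ∧
      ∀ t ∈ o₁, IsNonzero I t.seg := by
  cases T with
  | none => exact ⟨none, none, ⟨rfl, rfl⟩, hT, hT⟩
  | some T =>
    obtain ⟨y₀, y₁, m₀, m₁, h, h'⟩ := exists_maximalPairFrom_initial hI (hT T rfl)
    obtain ⟨o₀, h₀, h₀'⟩ := exists_rightRemainder h' h.nonzero_left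
    obtain ⟨o₁, h₁, h₁'⟩ := exists_rightRemainder (isInitial_nil m₁) h.nonzero_right
    exact ⟨o₀, o₁, ⟨_, _, _, _, h, h₀, h₁⟩, h₀', h₁'⟩

include hI in
theorem exists_leftStep (T : Option (LSegment Q)) (hT : ∀ t ∈ T, IsNonzero I t.seg) :
    ∃ o₀ o₁ : Option (LSegment Q), LeftStep I T o₀ o₁ ∧ (∀ t ∈ o₀, IsNonzero I t.seg) ∧
      ∀ t ∈ o₁, IsNonzero I t.seg := by
  cases T with
  | none => exact ⟨none, none, ⟨rfl, rfl⟩, hT, hT⟩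
  | some T =>
    obtain ⟨y₀, y₁, m₀, m₁, h, h'⟩ := exists_maximalPairTo_terminal hI (hT T rfl)
    obtain ⟨o₀, h₀, h₀'⟩ := exists_leftRemainder h' h.nonzero_left
    obtain ⟨o₁, h₁, h₁'⟩ := exists_leftRemainder (isTerminal_nil m₁) h.nonzero_right
    exact ⟨o₀, o₁, ⟨_, _, _, _, h, h₀, h₁⟩, h₀', h₁'⟩

/-- The invariant is bundled with the entries, so that one choice of successors can be iterated
along the digits of the multi-index. -/
theorem exists_sequence {α : Type*} (inv : α → Prop) (step : α → α → α → Prop)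
    (h : ∀ x, inv x → ∃ y z, step x y z ∧ inv y ∧ inv z) (x : α) (hx : inv x) :
    ∃ X : (n : ℕ) → (Fin n → Fin 2) → α, X 0 ![] = x ∧ ∀ (n : ℕ) (w : Fin n → Fin 2),
      step (X n w) (X (n + 1) (Fin.snoc (α := fun _ => Fin 2) w 0))
        (X (n + 1) (Fin.snoc (α := fun _ => Fin 2) w 1)) := by
  choose f g hs hf hg using h
  let next : {x // inv x} → Fin 2 → {x // inv x} := fun x =>
    ![⟨f x.1 x.2, hf x.1 x.2⟩, ⟨g x.1 x.2, hg x.1 x.2⟩]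
  let X : (n : ℕ) → (Fin n → Fin 2) → {x // inv x} := fun n =>
    Nat.rec (motive := fun n => (Fin n → Fin 2) → {x // inv x}) (fun _ => ⟨x, hx⟩)
      (fun n ih w => next (ih (Fin.init (α := fun _ => Fin 2) w)) (w (Fin.last n))) n
  have hX : ∀ (n : ℕ) (w : Fin n → Fin 2) (i : Fin 2),
      X (n + 1) (Fin.snoc (α := fun _ => Fin 2) w i) = next (X n w) i := fun n w i => by
    change next (X n (Fin.init (α := fun _ => Fin 2) (Fin.snoc (α := fun _ => Fin 2) w i)))
      (Fin.snoc (α := fun _ => Fin 2) w i (Fin.last n)) = _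
    rw [Fin.init_snoc, Fin.snoc_last]
  refine ⟨fun n w => (X n w).1, rfl, fun n w => ?_⟩
  change step (X n w).1 (X (n + 1) (Fin.snoc (α := fun _ => Fin 2) w 0)).1
    (X (n + 1) (Fin.snoc (α := fun _ => Fin 2) w 1)).1
  rw [hX, hX]
  exact hs (X n w).1 (X n w).2

include hI in
theorem exists_rightMaximalSequence (T : Option (RSegment Q)) (hT : ∀ t ∈ T, IsNonzero I t.seg) :
    ∃ X, X 0 ![] = T ∧ IsRightMaximalSequence I X :=
  exists_sequence (fun T : Option (RSegment Q) => ∀ t ∈ T, IsNonzero I t.seg) (RightStep I)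
    (exists_rightStep hI) T hT

include hI in
theorem exists_leftMaximalSequence (T : Option (LSegment Q)) (hT : ∀ t ∈ T, IsNonzero I t.seg) :
    ∃ X, X 0 ![] = T ∧ IsLeftMaximalSequence I X :=
  exists_sequence (fun T : Option (LSegment Q) => ∀ t ∈ T, IsNonzero I t.seg) (LeftStep I)
    (exists_leftStep hI) T hT

include hI in
theorem exists_projResData {c : Q} {a : Fin 2 → Q} (u : ∀ i, Path (a i) c)
    (hu : ∀ i, (u i).length ≠ 0) (hp : MaximalPairTo I (u 0) (u 1)) :
    ∃ R : ProjResData I c a, R.u = u := by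
  have hnz : ∀ i, IsNonzero I (u i) := Fin.forall_fin_two.2 ⟨hp.nonzero_left, hp.nonzero_right⟩
  have hpair : ∀ i, ∃ (b' : Q) (w : Path c b') (b : Q) (m : Path (a i) b),
      MaximalPairFrom I ((u i).comp w) m := fun i => by
    obtain ⟨y₀, y₁, m₀, m₁, h, ⟨w, rfl⟩⟩ := exists_maximalPairFrom_initial hI (hnz i)
    exact ⟨_, w, _, m₁, h⟩
  choose b' w b m hm using hpair
  have hrem := fun i => exists_rightRemainder (isInitial_nil (m i)) (hm i).nonzero_right
  choose D hD hD' using hrem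
  have hw : ∀ i, IsNonzero I (w i) := fun i => (hm i).nonzero_left.right
  -- The two maximal paths from `c` have to be numbered so that `v i` contains `w i`. If both `w i`
  -- fall into the same maximal path, one of them is stationary and so lies in the other maximal
  -- path too.
  have hv : ∃ (t : Fin 2 → Q) (v : ∀ i, Path c (t i)), MaximalPairFrom I (v 0) (v 1) ∧
      ∀ i, IsInitial (w i) (v i) := by
    obtain ⟨y₀, y₁, v₀, v₁, h⟩ := exists_maximalPairFrom hI c
    have hmk : ∀ {y₀ y₁ : Q} {v₀ : Path c y₀} {v₁ : Path c y₁}, MaximalPairFrom I v₀ v₁ →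
        IsInitial (w 0) v₀ → IsInitial (w 1) v₁ → ∃ (t : Fin 2 → Q) (v : ∀ i, Path c (t i)),
          MaximalPairFrom I (v 0) (v 1) ∧ ∀ i, IsInitial (w i) (v i) := by
      intro y₀ y₁ v₀ v₁ h h0 h1
      exact ⟨![y₀, y₁], Fin.cons v₀ (Fin.cons v₁ fun i => i.elim0), h, Fin.forall_fin_two.2 ⟨h0, h1⟩⟩
    have hnil : ∀ i, (w i).length = 0 → ∀ {y : Q} (v : Path c y), IsInitial (w i) v := by
      intro i hi y v
      refine isInitial_of_init (I := I) ?_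
      rw [eq_nil_of_length (q := toQ (w i)) hi]
      exact PathSys.e_init (S := quiverSys I) (toQ v)
    have hcommon : ∀ {y : Q} {v : Path c y}, IsInitial (w 0) v → IsInitial (w 1) v →
        (w 0).length = 0 ∨ (w 1).length = 0 := fun h0 h1 =>
      (quiverSys_isString hI).stationary_of_common hp.maxPair (hu 0) (hu 1) ⟨u 0, w 0⟩ ⟨u 1, w 1⟩
        (hm 0).nonzero_left (hm 1).nonzero_left h0.init h1.init
    rcases h.cover (w 0) (hw 0) with h0 | h0 <;> rcases h.cover (w 1) (hw 1) with h1 | h1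
    · rcases hcommon h0 h1 with h2 | h2
      · exact hmk h.symm (hnil 0 h2 _) h1
      · exact hmk h h0 (hnil 1 h2 _)
    · exact hmk h h0 h1
    · exact hmk h.symm h0 h1
    · rcases hcommon h0 h1 with h2 | h2
      · exact hmk h (hnil 0 h2 _) h1
      · exact hmk h.symm h0 (hnil 1 h2 _)
  obtain ⟨t, v, hv, hwv⟩ := hv
  have hvnz : ∀ i, IsNonzero I (v i) := Fin.forall_fin_two.2 ⟨hv.nonzero_left, hv.nonzero_right⟩
  obtain ⟨o₀, o₁, hs, ho₀, ho₁⟩ := exists_rightStep hI (D 0) (hD' 0)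
  obtain ⟨o₂, o₃, hs', ho₂, ho₃⟩ := exists_rightStep hI (D 1) (hD' 1)
  obtain ⟨o₄, hr₄, ho₄⟩ := exists_rightRemainder (hwv 0) (hvnz 0)
  obtain ⟨o₅, hr₅, ho₅⟩ := exists_rightRemainder (hwv 1) (hvnz 1)
  obtain ⟨X₀, h₀, hX₀⟩ := exists_rightMaximalSequence hI o₀ ho₀
  obtain ⟨X₁, h₁, hX₁⟩ := exists_rightMaximalSequence hI o₁ ho₁
  obtain ⟨X₂, h₂, hX₂⟩ := exists_rightMaximalSequence hI o₂ ho₂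
  obtain ⟨X₃, h₃, hX₃⟩ := exists_rightMaximalSequence hI o₃ ho₃
  obtain ⟨X₄, h₄, hX₄⟩ := exists_rightMaximalSequence hI o₄ ho₄
  obtain ⟨X₅, h₅, hX₅⟩ := exists_rightMaximalSequence hI o₅ ho₅
  subst h₀ h₁ h₂ h₃ h₄ h₅
  refine ⟨⟨u, b', w, b, m, D, t, v, ![X₀, X₁, X₂, X₃, X₄, X₅], hp, hm, hD, hs, hs', hv, hr₄, hr₅,
    fun j => ?_⟩, rfl⟩
  fin_cases j
  exacts [hX₀, hX₁, hX₂, hX₃, hX₄, hX₅]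

include hI in
theorem exists_injResData {z : Q} {e : Fin 2 → Q} (u : ∀ i, Path z (e i))
    (hu : ∀ i, (u i).length ≠ 0) (hp : MaximalPairFrom I (u 0) (u 1)) :
    ∃ R : InjResData I z e, R.u = u := by
  have hnz : ∀ i, IsNonzero I (u i) := Fin.forall_fin_two.2 ⟨hp.nonzero_left, hp.nonzero_right⟩
  have hpair : ∀ i, ∃ (b' : Q) (w : Path b' z) (b : Q) (m : Path b (e i)),
      MaximalPairTo I (w.comp (u i)) m := fun i => by
    obtain ⟨y₀, y₁, m₀, m₁, h, ⟨w, rfl⟩⟩ := exists_maximalPairTo_terminal hI (hnz i)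
    exact ⟨_, w, _, m₁, h⟩
  choose b' w b m hm using hpair
  have hrem := fun i => exists_leftRemainder (isTerminal_nil (m i)) (hm i).nonzero_right
  choose D hD hD' using hrem
  have hw : ∀ i, IsNonzero I (w i) := fun i => (hm i).nonzero_left.left
  have hv : ∃ (t : Fin 2 → Q) (v : ∀ i, Path (t i) z), MaximalPairTo I (v 0) (v 1) ∧
      ∀ i, IsTerminal (w i) (v i) := by
    obtain ⟨y₀, y₁, v₀, v₁, h⟩ := exists_maximalPairTo hI z
    have hmk : ∀ {y₀ y₁ : Q} {v₀ : Path y₀ z} {v₁ : Path y₁ z}, MaximalPairTo I v₀ v₁ →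
        IsTerminal (w 0) v₀ → IsTerminal (w 1) v₁ → ∃ (t : Fin 2 → Q) (v : ∀ i, Path (t i) z),
          MaximalPairTo I (v 0) (v 1) ∧ ∀ i, IsTerminal (w i) (v i) := by
      intro y₀ y₁ v₀ v₁ h h0 h1
      exact ⟨![y₀, y₁], Fin.cons v₀ (Fin.cons v₁ fun i => i.elim0), h, Fin.forall_fin_two.2 ⟨h0, h1⟩⟩
    have hnil : ∀ i, (w i).length = 0 → ∀ {y : Q} (v : Path y z), IsTerminal (w i) v := by
      intro i hi y v
      refine isTerminal_of_init (I := I) ?_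
      rw [(quiverSys I).eq_e' (p := toQ (w i)) hi]
      exact PathSys.e_init (S := (quiverSys I).op) (toQ v)
    have hcommon : ∀ {y : Q} {v : Path y z}, IsTerminal (w 0) v → IsTerminal (w 1) v →
        (w 0).length = 0 ∨ (w 1).length = 0 := fun h0 h1 =>
      (quiverSys_isString hI).op.stationary_of_common (u₀ := toQ (u 0)) (u₁ := toQ (u 1))
        (w₀ := toQ (w 0)) (w₁ := toQ (w 1)) hp.maxPair (hu 0) (hu 1) ⟨w 0, u 0⟩ ⟨w 1, u 1⟩
        (hm 0).nonzero_left (hm 1).nonzero_left h0.init h1.init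
    rcases h.cover (w 0) (hw 0) with h0 | h0 <;> rcases h.cover (w 1) (hw 1) with h1 | h1
    · rcases hcommon h0 h1 with h2 | h2
      · exact hmk h.symm (hnil 0 h2 _) h1
      · exact hmk h h0 (hnil 1 h2 _)
    · exact hmk h h0 h1
    · exact hmk h.symm h0 h1
    · rcases hcommon h0 h1 with h2 | h2
      · exact hmk h (hnil 0 h2 _) h1
      · exact hmk h.symm h0 (hnil 1 h2 _)
  obtain ⟨t, v, hv, hwv⟩ := hv
  have hvnz : ∀ i, IsNonzero I (v i) := Fin.forall_fin_two.2 ⟨hv.nonzero_left, hv.nonzero_right⟩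
  obtain ⟨o₀, o₁, hs, ho₀, ho₁⟩ := exists_leftStep hI (D 0) (hD' 0)
  obtain ⟨o₂, o₃, hs', ho₂, ho₃⟩ := exists_leftStep hI (D 1) (hD' 1)
  obtain ⟨o₄, hr₄, ho₄⟩ := exists_leftRemainder (hwv 0) (hvnz 0)
  obtain ⟨o₅, hr₅, ho₅⟩ := exists_leftRemainder (hwv 1) (hvnz 1)
  obtain ⟨X₀, h₀, hX₀⟩ := exists_leftMaximalSequence hI o₀ ho₀
  obtain ⟨X₁, h₁, hX₁⟩ := exists_leftMaximalSequence hI o₁ ho₁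
  obtain ⟨X₂, h₂, hX₂⟩ := exists_leftMaximalSequence hI o₂ ho₂
  obtain ⟨X₃, h₃, hX₃⟩ := exists_leftMaximalSequence hI o₃ ho₃
  obtain ⟨X₄, h₄, hX₄⟩ := exists_leftMaximalSequence hI o₄ ho₄
  obtain ⟨X₅, h₅, hX₅⟩ := exists_leftMaximalSequence hI o₅ ho₅
  subst h₀ h₁ h₂ h₃ h₄ h₅
  refine ⟨⟨u, b', w, b, m, D, t, v, ![X₀, X₁, X₂, X₃, X₄, X₅], hp, hm, hD, hs, hs', hv, hr₄, hr₅,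
    fun j => ?_⟩, rfl⟩
  fin_cases j
  exacts [hX₀, hX₁, hX₂, hX₃, hX₄, hX₅]

theorem exists_resData₁ {c a b : Q} {u : Path a c} {u' : Path b c} (hI : IsStringPresentation I)
    (hp : MaximalPairTo I u u') (hu' : u'.length = 0) :
    ∃ R : ResData₁ (quiverSys I), R.u = toQ u := by
  obtain ⟨y₀, y₁, m₀, m₁, h, hi⟩ := exists_maximalPairFrom_initial hI hp.nonzero_left
  obtain ⟨o₀, h₀, h₀'⟩ := exists_rightRemainder hi h.nonzero_left
  obtain ⟨o₁, h₁, h₁'⟩ := exists_rightRemainder (isInitial_nil m₁) h.nonzero_right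
  obtain ⟨p₀, p₁, hs, -⟩ := exists_rightStep hI o₀ h₀'
  obtain ⟨q₀, q₁, hs', -⟩ := exists_rightStep hI o₁ h₁'
  refine ⟨⟨toQ u, toQ m₀, toQ m₁, ![o₀.map RSegment.toPair, o₁.map RSegment.toPair],
    ![![p₀.map RSegment.toPair, p₁.map RSegment.toPair],
      ![q₀.map RSegment.toPair, q₁.map RSegment.toPair]], hp.nonzero_left, fun q hq ht => ?_,
    h.maxPair, h₀.rem, h₁.rem, Fin.forall_fin_two.2 ⟨hs.step, hs'.step⟩⟩, rfl⟩
  rcases hp.maxPair.cover q hq ht with h | h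
  · exact h
  -- A terminal subpath of the stationary path `u'` is stationary, so it is terminal in `u` as well.
  · have hl : q.2.2.length = 0 := Nat.le_zero.1 (h.len_le.trans hu'.le)
    rw [(quiverSys I).eq_e' (p := q) hl, ht]
    exact PathSys.e_init (S := (quiverSys I).op) (toQ u)

theorem exists_resData₁_op {z a b : Q} {u : Path z a} {u' : Path z b} (hI : IsStringPresentation I)
    (hp : MaximalPairFrom I u u') (hu' : u'.length = 0) :
    ∃ R : ResData₁ (quiverSys I).op, R.u = toQ u := by
  obtain ⟨y₀, y₁, m₀, m₁, h, hi⟩ := exists_maximalPairTo_terminal hI hp.nonzero_left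
  obtain ⟨o₀, h₀, h₀'⟩ := exists_leftRemainder hi h.nonzero_left
  obtain ⟨o₁, h₁, h₁'⟩ := exists_leftRemainder (isTerminal_nil m₁) h.nonzero_right
  obtain ⟨p₀, p₁, hs, -⟩ := exists_leftStep hI o₀ h₀'
  obtain ⟨q₀, q₁, hs', -⟩ := exists_leftStep hI o₁ h₁'
  refine ⟨⟨toQ u, toQ m₀, toQ m₁, ![o₀.map LSegment.toPair, o₁.map LSegment.toPair],
    ![![p₀.map LSegment.toPair, p₁.map LSegment.toPair],
      ![q₀.map LSegment.toPair, q₁.map LSegment.toPair]], hp.nonzero_left, fun q hq ht => ?_,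
    h.maxPair, h₀.rem, h₁.rem, Fin.forall_fin_two.2 ⟨hs.step, hs'.step⟩⟩, rfl⟩
  rcases hp.maxPair.cover q hq ht with h | h
  · exact h
  · have hl : q.2.2.length = 0 := Nat.le_zero.1 (PathSys.Init.len_le h |>.trans hu'.le)
    rw [(quiverSys I).eq_e (p := q) hl]
    change (quiverSys I).op.op.Init ((quiverSys I).e q.1) (toQ u)
    rw [show q.1 = z from ht]
    exact PathSys.e_init (S := (quiverSys I).op.op) (toQ u)

end Existence

/-! ### Indecomposable projectives and injectives, and simple modules -/

section Summands

variable {R : Type u} [Ring R] {M M' : Type u} [AddCommGroup M] [Module R M]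
  [AddCommGroup M'] [Module R M']

/-- A split monomorphism from a non-zero module to an indecomposable module is bijective. -/
theorem IsIndecomposable.bijective_of_comp_eq_id (h : IsIndecomposable R M) [Nontrivial M']
    {s : M' →ₗ[R] M} {r : M →ₗ[R] M'} (hrs : r ∘ₗ s = LinearMap.id) : Function.Bijective r := by
  have hrs' : ∀ x, r (s x) = x := LinearMap.congr_fun hrs
  have hc : IsCompl (LinearMap.range s) (LinearMap.ker r) := by
    refine ⟨Submodule.disjoint_def.2 ?_, codisjoint_iff.2 (eq_top_iff.2 fun m _ => ?_)⟩
    · rintro _ ⟨x, rfl⟩ hx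
      rw [← hrs' x, LinearMap.mem_ker.1 hx, map_zero]
    · refine Submodule.mem_sup.2 ⟨s (r m), ⟨_, rfl⟩, m - s (r m), ?_, add_sub_cancel _ _⟩
      rw [LinearMap.mem_ker, map_sub, hrs', sub_self]
  refine ⟨LinearMap.ker_eq_bot.1 ((h.2 _ _ hc).resolve_left fun h0 => ?_), fun x => ⟨s x, hrs' x⟩⟩
  obtain ⟨x, hx⟩ := exists_ne (0 : M')
  refine hx ?_
  rw [← hrs' x, (Submodule.eq_bot_iff _).1 h0 (s x) ⟨x, rfl⟩, map_zero]

end Summands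

section Points

variable {k Q : Type u} [Field k] [Fintype Q] [Quiver.{u} Q]
  {I : TwoSidedIdeal (PathAlgebra k Q)} (hI : IsStringPresentation I)

open PathAlgebra MulOpposite

variable {M : Type u} [AddCommGroup M] [Module (BoundAlgebra I)ᵐᵒᵖ M]

theorem algebraMap_smul_comm (r : k) (a : (BoundAlgebra I)ᵐᵒᵖ) (m : M) :
    a • algebraMap k (BoundAlgebra I)ᵐᵒᵖ r • m = algebraMap k (BoundAlgebra I)ᵐᵒᵖ r • a • m := by
  rw [smul_smul, smul_smul, Algebra.commutes]

theorem coeffs_idem (x y : Q) (q : QPath Q) (hq : q = toQ (Path.nil : Path y y)) (h : x ≠ y) :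
    coeffs hI (idem I x) q = 0 := by
  rw [idem_eq, coeffs_qcls, if_neg]
  rintro ⟨-, rfl⟩
  exact h (congrArg Sigma.fst hq)

theorem coeffs_idem_self (x : Q) : coeffs hI (idem I x) (toQ (Path.nil : Path x x)) = 1 := by
  rw [idem_eq, coeffs_qcls, if_pos ⟨isNonzero_nil hI x, rfl⟩]

-- After subtracting the multiple of `e_x`, only non-stationary paths and stationary paths at other
-- points remain in `a`, and all of these annihilate `n`.
include hI in
theorem Killed.op_smul {x : Q} {n : M} (hn : Killed I n) (hx : op (idem I x) • n = n)
    (a : BoundAlgebra I) :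
    op a • n = algebraMap k (BoundAlgebra I)ᵐᵒᵖ (coeffs hI a (toQ (Path.nil : Path x x))) • n := by
  set r := coeffs hI a (toQ (Path.nil : Path x x)) with hr
  have h0 : op (a - r • idem I x) • n = 0 := by
    refine op_smul_eq_zero hI _ _ fun q _ hc => ?_
    by_cases hq : q.2.2.length = 0
    · rw [eq_nil_of_length hq] at hc ⊢
      by_cases hqx : q.1 = x
      · refine absurd ?_ hc
        rw [hqx, map_sub, map_smul, Pi.sub_apply, Pi.smul_apply, coeffs_idem_self, smul_eq_mul,
          mul_one, ← hr, sub_self]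
      · rw [← hx, idem_eq]
        exact op_qcls_smul_of_ne (by exact hqx) n
    · exact hn q hq
  rw [op_sub, sub_smul, sub_eq_zero] at h0
  rw [h0, MulOpposite.op_smul, Algebra.smul_def, mul_smul, hx]

/-- The map from a simple module given by an element which is killed by the radical. -/
def pointMap {x : Q} {n : M} (hn : Killed I n) (hx : op (idem I x) • n = n) :
    PointModule hI x →ₗ[(BoundAlgebra I)ᵐᵒᵖ] M where
  toFun r := algebraMap k (BoundAlgebra I)ᵐᵒᵖ r.val • n
  map_add' r s := by rw [map_add, map_add, add_smul]
  map_smul' a r := by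
    rw [PointModule.val_smul, mul_comm, map_mul, mul_smul, RingHom.id_apply,
      algebraMap_smul_comm r.val a n, ← hn.op_smul hI hx, op_unop]

theorem eq_zero_of_algebraMap_smul {r : k} {n : M} (hn : n ≠ 0)
    (h : algebraMap k (BoundAlgebra I)ᵐᵒᵖ r • n = 0) : r = 0 := by
  by_contra hr
  refine hn ?_
  rw [← one_smul (BoundAlgebra I)ᵐᵒᵖ n, ← map_one (algebraMap k _), ← inv_mul_cancel₀ hr, map_mul,
    mul_smul, h, smul_zero]

theorem pointMap_injective {x : Q} {n : M} (hn : Killed I n) (hx : op (idem I x) • n = n)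
    (h0 : n ≠ 0) : Function.Injective (pointMap hI hn hx) :=
  (injective_iff_map_eq_zero _).2 fun _ hr =>
    PointModule.val.map_eq_zero_iff.1 (eq_zero_of_algebraMap_smul h0 hr)

theorem Killed.idem_smul {n : M} (hn : Killed I n) (x : Q) : Killed I (op (idem I x) • n) := by
  intro q hq
  rw [idem_eq]
  by_cases h : q.1 = x
  · subst h
    rw [op_qcls_smul (nil_qcomp q)]
    exact hn q hq
  · exact op_qcls_smul_of_ne (by exact h) n

include hI in
theorem exists_killed_idem [Nontrivial M] :
    ∃ (x : Q) (n : M), n ≠ 0 ∧ Killed I n ∧ op (idem I x) • n = n := by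
  obtain ⟨m, hm⟩ := exists_ne (0 : M)
  obtain ⟨q, hq, hk⟩ := exists_killed hI hm
  obtain ⟨x, hx⟩ : ∃ x : Q, op (idem I x) • op (qcls I q) • m ≠ 0 := by
    by_contra! h
    exact hq (by rw [← sum_idem_smul (I := I) (op (qcls I q) • m), Finset.sum_eq_zero fun x _ => h x])
  refine ⟨x, _, hx, hk.idem_smul x, ?_⟩
  rw [smul_smul, ← op_mul, idem_mul_idem]

/-- The projection of `P(x)` onto its simple top. -/
def projPoint (x : Q) : Proj I x →ₗ[(BoundAlgebra I)ᵐᵒᵖ] PointModule hI x where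
  toFun a := PointModule.val.symm (coeffs hI a (toQ (Path.nil : Path x x)))
  map_add' a b := by
    rw [Submodule.coe_add, map_add, Pi.add_apply, map_add]
  map_smul' a b := by
    refine PointModule.val.injective ?_
    rw [RingHom.id_apply, PointModule.val_smul, AddEquiv.apply_symm_apply,
      AddEquiv.apply_symm_apply, mul_comm, ← coeffs_nil_mul]
    rfl

theorem val_projPoint {x : Q} (a : Proj I x) :
    (projPoint hI x a).val = coeffs hI a (toQ (Path.nil : Path x x)) := rfl

theorem val_projPoint_projGen (x : Q) : (projPoint hI x (projGen x)).val = 1 :=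
  coeffs_idem_self hI x

theorem PointModule.op_algebraMap_smul {hI : IsStringPresentation I} {x : Q} (r : k)
    (m : PointModule hI x) :
    (algebraMap k (BoundAlgebra I)ᵐᵒᵖ r • m).val = r * m.val := by
  have h : coeffs hI (1 : BoundAlgebra I) (toQ (Path.nil : Path x x)) = 1 := by
    rw [one_eq_sum, map_sum, Finset.sum_apply, Finset.sum_eq_single x]
    · exact coeffs_idem_self hI x
    · exact fun y _ hy => coeffs_idem hI y x _ rfl hy
    · simp
  rw [PointModule.val_smul, MulOpposite.algebraMap_apply, unop_op, Algebra.algebraMap_eq_smul_one,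
    map_smul, Pi.smul_apply, h, smul_eq_mul, mul_one]

theorem PointModule.surjective {hI : IsStringPresentation I} {x : Q}
    {f : M →ₗ[(BoundAlgebra I)ᵐᵒᵖ] PointModule hI x} (hf : f ≠ 0) : Function.Surjective f := by
  obtain ⟨m, hm⟩ : ∃ m, f m ≠ 0 := by
    by_contra! h
    exact hf (LinearMap.ext h)
  intro r
  have hm' : (f m).val ≠ 0 := fun h => hm (PointModule.val.map_eq_zero_iff.1 h)
  refine ⟨algebraMap k (BoundAlgebra I)ᵐᵒᵖ (r.val / (f m).val) • m, PointModule.val.injective ?_⟩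
  rw [map_smul, PointModule.op_algebraMap_smul, div_mul_cancel₀ _ hm']

theorem projPoint_surjective (x : Q) : Function.Surjective (projPoint hI x) := by
  refine PointModule.surjective fun h => ?_
  have := val_projPoint_projGen hI x
  rw [h, LinearMap.zero_apply, map_zero] at this
  exact zero_ne_one this

theorem val_map_proj {x y : Q} (f : Proj I x →ₗ[(BoundAlgebra I)ᵐᵒᵖ] PointModule hI y)
    (a : Proj I x) :
    (f a).val = coeffs hI a (toQ (Path.nil : Path y y)) * (f (projGen x)).val := by
  rw [← op_smul_projGen a, map_smul, PointModule.val_smul, op_smul_projGen, unop_op]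

theorem val_eq_zero_of_ne {x y : Q} (f : M →ₗ[(BoundAlgebra I)ᵐᵒᵖ] PointModule hI y) {m : M}
    (hm : op (idem I x) • m = m) (h : x ≠ y) : (f m).val = 0 := by
  rw [← hm, map_smul, PointModule.val_smul, unop_op, coeffs_idem hI x y _ rfl h, zero_mul]

theorem ker_projPoint_le {x y : Q} (f : Proj I x →ₗ[(BoundAlgebra I)ᵐᵒᵖ] PointModule hI y) :
    LinearMap.ker (projPoint hI x) ≤ LinearMap.ker f := by
  intro a ha
  refine PointModule.val.map_eq_zero_iff.1 ?_
  rw [val_map_proj]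
  by_cases h : x = y
  · subst h
    rw [← val_projPoint, LinearMap.mem_ker.1 ha, map_zero, zero_mul]
  · rw [val_eq_zero_of_ne hI f (x := x) _ h, mul_zero]
    exact Subtype.ext (idem_mul_idem x)

/-- A proper submodule lies in the kernel of a non-zero map to a simple module; as `e_x` generates
`P(x)`, such a map is a multiple of `projPoint`. So its kernel is the only maximal submodule. -/
theorem jacobson_proj (x : Q) :
    Module.jacobson (BoundAlgebra I)ᵐᵒᵖ (Proj I x) = LinearMap.ker (projPoint hI x) := by
  have hle : ∀ L : Submodule (BoundAlgebra I)ᵐᵒᵖ (Proj I x), L ≠ ⊤ →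
      L ≤ LinearMap.ker (projPoint hI x) := by
    intro L hL a ha
    obtain ⟨y, f, hf, hLf⟩ := exists_functional hI hL
    have hg : (f (projGen x)).val ≠ 0 := fun h => hf <| LinearMap.ext fun a =>
      PointModule.val.map_eq_zero_iff.1 (by rw [val_map_proj, h, mul_zero])
    have hxy : x = y := by
      by_contra h
      exact hg (val_eq_zero_of_ne hI f (x := x) (Subtype.ext (idem_mul_idem x)) h)
    subst hxy
    have h0 : (f a).val = 0 := PointModule.val.map_eq_zero_iff.2 (hLf ha)
    rw [val_map_proj] at h0
    exact PointModule.val.map_eq_zero_iff.1 ((mul_eq_zero.1 h0).resolve_right hg)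
  have hne : LinearMap.ker (projPoint hI x) ≠ ⊤ := fun h => by
    have := val_projPoint_projGen hI x
    rw [LinearMap.ker_eq_top.1 h, LinearMap.zero_apply, map_zero] at this
    exact zero_ne_one this
  refine le_antisymm (sInf_le ⟨hne, fun L hL => ?_⟩) (le_sInf fun L hL => ?_)
  · by_contra h
    exact hL.not_ge (hle L h)
  · by_contra h
    exact h ((hL.le_iff.1 (hle L hL.1)).resolve_left hne).le

/-- `S(x)` is one-dimensional. -/
def simpEquiv (x : Q) : Simp I x ≃ₗ[(BoundAlgebra I)ᵐᵒᵖ] PointModule hI x :=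
  Submodule.quotEquivOfEq _ _ (jacobson_proj hI x) ≪≫ₗ
    (projPoint hI x).quotKerEquivOfSurjective (projPoint_surjective hI x)

-- A map onto some simple module lifts to a map to `P(x)`, which is onto because the kernel of
-- `projPoint` is superfluous. It splits, and indecomposability makes it bijective.
include hI in
theorem exists_equiv_proj (hP : Module.Projective (BoundAlgebra I)ᵐᵒᵖ M)
    (hM : IsIndecomposable (BoundAlgebra I)ᵐᵒᵖ M) :
    ∃ x, Nonempty (M ≃ₗ[(BoundAlgebra I)ᵐᵒᵖ] Proj I x) := by
  have := hM.1
  obtain ⟨x, f, hf, -⟩ := exists_functional (M := M) (L := ⊥) hI bot_ne_top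
  obtain ⟨g, hg⟩ := Module.projective_lifting_property (projPoint hI x) f
    (projPoint_surjective hI x)
  have hg' : ∀ m, projPoint hI x (g m) = f m := LinearMap.congr_fun hg
  have hsurj : Function.Surjective g := by
    rw [← LinearMap.range_eq_top]
    refine isSuperfluous_of_functional hI (fun y => ker_projPoint_le hI) _
      (eq_top_iff.2 fun a _ => ?_)
    obtain ⟨m, hm⟩ := PointModule.surjective hf (projPoint hI x a)
    refine Submodule.mem_sup.2 ⟨a - g m, ?_, g m, ⟨m, rfl⟩, sub_add_cancel _ _⟩
    rw [LinearMap.mem_ker, map_sub, hg', hm, sub_self]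
  obtain ⟨s, hs⟩ := Module.projective_lifting_property g LinearMap.id hsurj
  have : Nontrivial (Proj I x) := ⟨projGen x, 0, fun h => by
    have := val_projPoint_projGen hI x
    rw [h, map_zero, map_zero] at this
    exact zero_ne_one this⟩
  exact ⟨x, ⟨LinearEquiv.ofBijective g (hM.bijective_of_comp_eq_id hs)⟩⟩

/-- The generator of the socle of `I(c)`. -/
def injGen (c : Q) : Inj I c :=
  Inj.mk (LinearMap.proj (toQ (Path.nil : Path c c)) ∘ₗ coeffs hI)

theorem eval_injGen (c : Q) (a : BoundAlgebra I) :
    (injGen hI c).eval a = coeffs hI a (toQ (Path.nil : Path c c)) :=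
  (Inj.eval_mk _ _).trans (coeffs_mul_idem hI a (toQ (Path.nil : Path c c)))

theorem killed_injGen (c : Q) : Killed I (injGen hI c) := by
  intro q hq
  refine Inj.ext fun a _ => ?_
  rw [Inj.eval_smul, eval_injGen, coeffs_nil_mul, coeffs_qcls, if_neg, zero_mul, Inj.eval_zero]
  rintro ⟨-, rfl⟩
  exact hq rfl

theorem idem_smul_injGen (c : Q) : op (idem I c) • injGen hI c = injGen hI c := by
  refine Inj.ext fun a _ => ?_
  rw [Inj.eval_smul, eval_injGen, eval_injGen, coeffs_nil_mul, coeffs_idem_self, one_mul]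

theorem injGen_ne_zero (c : Q) : injGen hI c ≠ 0 := fun h => by
  have := eval_injGen hI c (idem I c)
  rw [h, Inj.eval_zero, coeffs_idem_self] at this
  exact zero_ne_one this

/-- A form killed by the radical vanishes on all non-stationary paths, so its value at `e_c`
determines it: the socle of `I(c)` is one-dimensional. -/
theorem Killed.eq_smul_injGen {c : Q} {f : Inj I c} (hf : Killed I f) :
    f = algebraMap k (BoundAlgebra I)ᵐᵒᵖ (f.eval (idem I c)) • injGen hI c := by
  set r := f.eval (idem I c) with hr
  have h : f.toLin = r • (LinearMap.proj (toQ (Path.nil : Path c c)) ∘ₗ coeffs hI) := by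
    refine qcls_ext fun q => ?_
    rw [Inj.toLin_apply, LinearMap.smul_apply, LinearMap.comp_apply, LinearMap.proj_apply,
      smul_eq_mul]
    by_cases hq : q.2.2.length = 0
    · rw [eq_nil_of_length hq]
      by_cases hc : q.1 = c
      · rw [hc, ← idem_eq, coeffs_idem_self, mul_one, hr]
      · rw [← idem_eq, coeffs_idem hI _ _ _ rfl hc, mul_zero, ← Inj.eval_mul_idem, idem_eq, idem_eq,
          qcls_mul_of_ne I (by exact fun h => hc h.symm), ← Inj.toLin_apply, map_zero]
    · rw [coeffs_qcls, if_neg, mul_zero, ← one_mul (qcls I q), Inj.eval_mul_eq_zero f hf hq]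
      rintro ⟨-, rfl⟩
      exact hq rfl
  refine Inj.ext fun a _ => ?_
  rw [MulOpposite.algebraMap_apply, Inj.eval_smul, ← Inj.toLin_apply, h, ← Algebra.smul_def,
    eval_injGen, map_smul]
  rfl

-- A simple submodule of `M` is isomorphic to the socle of some `I(x)`. Extending this isomorphism
-- embeds `I(x)` into `M`, since the socle is essential; injectivity splits the embedding.
include hI in
theorem exists_equiv_inj (hE : Module.Injective (BoundAlgebra I)ᵐᵒᵖ M)
    (hM : IsIndecomposable (BoundAlgebra I)ᵐᵒᵖ M) :
    ∃ x, Nonempty (M ≃ₗ[(BoundAlgebra I)ᵐᵒᵖ] Inj I x) := by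
  have := hM.1
  obtain ⟨x, n, hn, hk, hx⟩ := exists_killed_idem (M := M) hI
  have hi := pointMap_injective hI (killed_injGen hI x) (idem_smul_injGen hI x) (injGen_ne_zero hI x)
  obtain ⟨g, hg⟩ := hE.out (pointMap hI (killed_injGen hI x) (idem_smul_injGen hI x)) hi
    (pointMap hI hk hx)
  have hess : IsEssential (LinearMap.range (pointMap hI (killed_injGen hI x)
      (idem_smul_injGen hI x))) :=
    isEssential_of_killed hI fun f hf =>
      ⟨PointModule.val.symm (f.eval (idem I x)), (hf.eq_smul_injGen hI).symm⟩
  have hinj : Function.Injective g := by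
    refine LinearMap.ker_eq_bot.1 (hess _ (eq_bot_iff.2 ?_))
    rintro _ ⟨⟨r, rfl⟩, hr⟩
    have h0 : pointMap hI hk hx r = 0 := (hg r).symm.trans hr
    rw [(injective_iff_map_eq_zero _).1 (pointMap_injective hI hk hx hn) r h0, map_zero]
    exact Submodule.zero_mem _
  obtain ⟨h, hh⟩ := (Inj.injective_module x).out g hinj LinearMap.id
  have : Nontrivial (Inj I x) := ⟨injGen hI x, 0, injGen_ne_zero hI x⟩
  exact ⟨x, ⟨LinearEquiv.ofBijective h (hM.bijective_of_comp_eq_id (LinearMap.ext hh))⟩⟩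

end Points

/-! ### The top of `I(c)`, the socle of `P(z)`, and the maximal paths -/

section TopSocle

variable {k Q : Type u} [Field k] [Fintype Q] [Quiver.{u} Q]
  {I : TwoSidedIdeal (PathAlgebra k Q)} (hI : IsStringPresentation I)

open PathAlgebra MulOpposite

/-- One of the two products in the determinant is non-zero, and its factors force the corresponding
equalities of points. -/
theorem points_eq_of_det_ne_zero {a b : Fin 2 → Q} {m : Matrix (Fin 2) (Fin 2) k}
    (hm : ∀ i j, b i ≠ a j → m i j = 0) (hd : m.det ≠ 0) :
    (b 0 = a 0 ∧ b 1 = a 1) ∨ (b 0 = a 1 ∧ b 1 = a 0) := by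
  rw [Matrix.det_fin_two] at hd
  by_cases h : m 0 0 * m 1 1 = 0
  · rw [h, zero_sub, neg_ne_zero] at hd
    exact Or.inr ⟨not_not.1 fun h => left_ne_zero_of_mul hd (hm _ _ h),
      not_not.1 fun h => right_ne_zero_of_mul hd (hm _ _ h)⟩
  · exact Or.inl ⟨not_not.1 fun h' => left_ne_zero_of_mul h (hm _ _ h'),
      not_not.1 fun h' => right_ne_zero_of_mul h (hm _ _ h')⟩

theorem det_eq_zero_of_smul_row {m : Matrix (Fin 2) (Fin 2) k} {i i' : Fin 2} (hi : i ≠ i') {r : k}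
    (h : ∀ j, m i j = r * m i' j) : m.det = 0 := by
  rw [Matrix.det_fin_two]
  fin_cases i <;> fin_cases i'
  · exact absurd rfl hi
  · have h0 := h 0
    have h1 := h 1
    simp only [Fin.zero_eta, Fin.mk_one] at h0 h1
    rw [h0, h1]
    ring
  · have h0 := h 0
    have h1 := h 1
    simp only [Fin.zero_eta, Fin.mk_one] at h0 h1
    rw [h0, h1]
    ring
  · exact absurd rfl hi

/-- The linear form dual to a path ending at `c`. -/
def dualForm {b c : Q} (u : Path b c) : Inj I c := Inj.mk (LinearMap.proj (toQ u) ∘ₗ coeffs hI)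

theorem eval_dualForm {b c : Q} (u : Path b c) (a : BoundAlgebra I) :
    (dualForm hI u).eval a = coeffs hI a (toQ u) :=
  (Inj.eval_mk _ _).trans (coeffs_mul_idem hI a (toQ u))

theorem idem_smul_dualForm {b c : Q} {u : Path b c} (hu : IsNonzero I u) :
    op (idem I b) • dualForm hI u = dualForm hI u := by
  refine Inj.ext fun a _ => ?_
  rw [Inj.eval_smul, eval_dualForm, eval_dualForm, idem_eq,
    coeffs_qcls_mul hI a (nil_qcomp (toQ u)) hu]

theorem toQ_of_length {b c : Q} {u : Path b c} (hu : u.length = 0) :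
    toQ u = toQ (Path.nil : Path c c) := by
  cases u with
  | nil => rfl
  | cons u e => simp at hu

/-- Acting by `u` on its dual form leaves the form that reads off the coefficient of the stationary
path at `c`. -/
theorem dualForm_of_stationary {b b' c : Q} {u : Path b c} {u' : Path b' c} (hu : IsNonzero I u)
    (hu' : u'.length = 0) : dualForm hI u' = op (qcls I (toQ u)) • dualForm hI u := by
  refine Inj.ext fun a _ => ?_
  rw [Inj.eval_smul, eval_dualForm, eval_dualForm, toQ_of_length hu',
    coeffs_qcls_mul hI a (qcomp_nil (toQ u)) hu]

theorem exists_eq_dualForm {c : Q} {b : Fin 2 → Q} {u : ∀ i, Path (b i) c}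
    (hp : MaximalPairTo I (u 0) (u 1)) (f : Inj I c) :
    ∃ x : Fin 2 → BoundAlgebra I, f = ∑ i, op (x i) • dualForm hI (u i) := by
  have hφ : ∀ i, (toQ (u i)).2.1 = c := fun _ => rfl
  have hnz : ∀ i, IsNonzero I (u i) := Fin.forall_fin_two.2 ⟨hp.nonzero_left, hp.nonzero_right⟩
  have hs : Function.Surjective (formMap (pt := fun i => some (b i)) hI (fun i => toQ (u i)) c) := by
    refine formMap_surjective hI hφ fun y hy h => coeffs_inj hI fun q hq => ?_
    rw [map_zero, Pi.zero_apply]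
    rw [← mem_leftProj_iff_mem_E, mem_leftProj_iff] at hy
    by_cases hqc : q.2.1 = c
    · obtain ⟨a, c', q⟩ := q
      obtain rfl : c' = c := hqc
      obtain ⟨i, r, hr⟩ : ∃ i, IsTerminal q (u i) :=
        (hp.cover q hq).elim (fun h => ⟨0, h⟩) fun h => ⟨1, h⟩
      have h' := h (Pi.single i (qcls I (toQ r))) fun l => by
        rw [← mem_proj_iff_mem_E, mem_proj_iff]
        by_cases hl : l = i
        · subst hl
          rw [Pi.single_eq_same, idem_eq]
          exact qcls_mul I (nil_qcomp (toQ r))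
        · rw [Pi.single_eq_of_ne hl, mul_zero]
      rw [Finset.sum_eq_single i] at h'
      · rw [Pi.single_eq_same, coeffs_qcls_mul hI y (q := toQ q) (by rw [hr]; exact QComp.mk r q)
          (hnz i)] at h'
        exact h'
      · intro l _ hl
        rw [Pi.single_eq_of_ne hl, zero_mul, map_zero, Pi.zero_apply]
      · simp
    · rw [← hy, idem_eq]
      exact coeffs_mul_qcls_of_not hI y fun h =>
        hqc (PathSys.Init.s_eq (S := (quiverSys I).op) (p := toQ (Path.nil : Path c c)) h)
  obtain ⟨x, rfl⟩ := hs f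
  refine ⟨x.coord, Inj.ext fun a _ => ?_⟩
  rw [eval_formMap hI hφ, ← Inj.toLin_apply, Fin.sum_univ_two, Fin.sum_univ_two, Inj.toLin_apply,
    Inj.eval_add, Inj.eval_smul, Inj.eval_smul, eval_dualForm, eval_dualForm]

theorem exists_top_functionals {M : Type u} [AddCommGroup M] [Module (BoundAlgebra I)ᵐᵒᵖ M]
    {a : Fin 2 → Q} (h : Nonempty (ModTop (BoundAlgebra I)ᵐᵒᵖ M ≃ₗ[(BoundAlgebra I)ᵐᵒᵖ]
      (Simp I (a 0) × Simp I (a 1)))) :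
    ∃ F : ∀ j, M →ₗ[(BoundAlgebra I)ᵐᵒᵖ] PointModule hI (a j),
      ∀ v : Fin 2 → k, ∃ m, ∀ j, (F j m).val = v j := by
  obtain ⟨e⟩ := h
  let G : M →ₗ[(BoundAlgebra I)ᵐᵒᵖ] Simp I (a 0) × Simp I (a 1) :=
    e.toLinearMap ∘ₗ (Module.jacobson (BoundAlgebra I)ᵐᵒᵖ M).mkQ
  refine ⟨fun j => match j with
    | 0 => (simpEquiv hI (a 0)).toLinearMap ∘ₗ LinearMap.fst _ (Simp I (a 0)) (Simp I (a 1)) ∘ₗ G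
    | 1 => (simpEquiv hI (a 1)).toLinearMap ∘ₗ LinearMap.snd _ (Simp I (a 0)) (Simp I (a 1)) ∘ₗ G, fun v => ?_⟩
  obtain ⟨m, hm⟩ : ∃ m, G m = ((simpEquiv hI (a 0)).symm (PointModule.val.symm (v 0)),
      (simpEquiv hI (a 1)).symm (PointModule.val.symm (v 1))) :=
    (e.surjective.comp (Submodule.mkQ_surjective _)) _
  refine ⟨m, Fin.forall_fin_two.2 ⟨?_, ?_⟩⟩
  · change (simpEquiv hI (a 0) (G m).1).val = _
    rw [hm, LinearEquiv.apply_symm_apply, AddEquiv.apply_symm_apply]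
  · change (simpEquiv hI (a 1) (G m).2).val = _
    rw [hm, LinearEquiv.apply_symm_apply, AddEquiv.apply_symm_apply]

-- The dual forms of the two maximal paths generate `I(c)`, so their images under the two
-- functionals on the top form an invertible matrix, whose entries vanish where the points differ.
include hI in
theorem MaximalPairTo.of_top {c : Q} {a b : Fin 2 → Q} {u : ∀ i, Path (b i) c}
    (hp : MaximalPairTo I (u 0) (u 1))
    (h : Nonempty (ModTop (BoundAlgebra I)ᵐᵒᵖ (Inj I c) ≃ₗ[(BoundAlgebra I)ᵐᵒᵖ]
      (Simp I (a 0) × Simp I (a 1)))) :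
    (∀ i, (u i).length ≠ 0) ∧ ((b 0 = a 0 ∧ b 1 = a 1) ∨ (b 0 = a 1 ∧ b 1 = a 0)) := by
  obtain ⟨F, hF⟩ := exists_top_functionals hI h
  have hnz : ∀ i, IsNonzero I (u i) := Fin.forall_fin_two.2 ⟨hp.nonzero_left, hp.nonzero_right⟩
  let m : Matrix (Fin 2) (Fin 2) k := fun i j => (F j (dualForm hI (u i))).val
  have hm : ∀ i j, b i ≠ a j → m i j = 0 := fun i j hij =>
    val_eq_zero_of_ne hI (F j) (idem_smul_dualForm hI (hnz i)) hij
  -- Where `b i` and `a j` differ both sides vanish, so the scalar may be taken at `b i`,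
  -- independently of `j`; this gives the values as a vector times the matrix.
  have hF' : ∀ (x : BoundAlgebra I) (i j : Fin 2), (F j (op x • dualForm hI (u i))).val =
      coeffs hI x (toQ (Path.nil : Path (b i) (b i))) * m i j := by
    intro x i j
    rw [map_smul, PointModule.val_smul, unop_op]
    change _ * m i j = _
    by_cases hij : b i = a j
    · rw [hij]
    · rw [hm i j hij, mul_zero, mul_zero]
  have hd : m.det ≠ 0 := by
    rw [← isUnit_iff_ne_zero, ← Matrix.isUnit_iff_isUnit_det, ← Matrix.vecMul_surjective_iff_isUnit]
    intro v
    obtain ⟨f, hf⟩ := hF v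
    obtain ⟨x, rfl⟩ := exists_eq_dualForm hI hp f
    refine ⟨fun i => coeffs hI (x i) (toQ (Path.nil : Path (b i) (b i))), funext fun j => ?_⟩
    rw [← hf j, Fin.sum_univ_two, map_add, map_add, hF', hF']
    exact Fin.sum_univ_two fun i =>
      coeffs hI (x i) (toQ (Path.nil : Path (b i) (b i))) * m i j
  -- If `u i` is stationary, its dual form is that of `u i'` acted on by `u i'`, so the rows are
  -- proportional.
  have hstat : ∀ i i', i ≠ i' → (u i).length ≠ 0 := fun i i' hi hl =>
    hd (det_eq_zero_of_smul_row hi (r := coeffs hI (qcls I (toQ (u i')))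
      (toQ (Path.nil : Path (b i') (b i')))) fun j => by
        rw [← hF', ← dualForm_of_stationary hI (hnz i') hl])
  exact ⟨Fin.forall_fin_two.2 ⟨hstat 0 1 (by decide), hstat 1 0 (by decide)⟩,
    points_eq_of_det_ne_zero hm hd⟩

theorem killed_pointModule {x : Q} (m : PointModule hI x) : Killed I m := by
  intro q hq
  refine PointModule.val.map_eq_zero_iff.1 ?_
  rw [PointModule.val_smul, unop_op, coeffs_qcls, if_neg, zero_mul]
  rintro ⟨-, rfl⟩
  exact hq rfl

theorem idem_smul_pointModule {x : Q} (m : PointModule hI x) : op (idem I x) • m = m := by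
  refine PointModule.val.injective ?_
  rw [PointModule.val_smul, unop_op, coeffs_idem_self, one_mul]

theorem Killed.map {M N : Type u} [AddCommGroup M] [Module (BoundAlgebra I)ᵐᵒᵖ M] [AddCommGroup N]
    [Module (BoundAlgebra I)ᵐᵒᵖ N] {m : M} (hm : Killed I m) (f : M →ₗ[(BoundAlgebra I)ᵐᵒᵖ] N) :
    Killed I (f m) := fun q hq => by rw [← map_smul, hm q hq, map_zero]

include hI in
theorem exists_socle_elements {M : Type u} [AddCommGroup M] [Module (BoundAlgebra I)ᵐᵒᵖ M]
    {e : Fin 2 → Q} (h : Nonempty (Soc (BoundAlgebra I)ᵐᵒᵖ M ≃ₗ[(BoundAlgebra I)ᵐᵒᵖ]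
      (Simp I (e 0) × Simp I (e 1)))) :
    ∃ x : Fin 2 → M, (∀ j, Killed I (x j)) ∧ (∀ j, op (idem I (e j)) • x j = x j) ∧
      ∀ v : Fin 2 → k, ∑ j, algebraMap k (BoundAlgebra I)ᵐᵒᵖ (v j) • x j = 0 → v = 0 := by
  obtain ⟨i⟩ := h
  obtain ⟨G, hG⟩ : ∃ G : (PointModule hI (e 0) × PointModule hI (e 1)) →ₗ[(BoundAlgebra I)ᵐᵒᵖ] M,
      Function.Injective G :=
    ⟨(Soc (BoundAlgebra I)ᵐᵒᵖ M).subtype ∘ₗ i.symm.toLinearMap ∘ₗ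
        ((simpEquiv hI (e 0)).prodCongr (simpEquiv hI (e 1))).symm.toLinearMap,
      (Submodule.injective_subtype _).comp (i.symm.injective.comp (LinearEquiv.injective _))⟩
  let x₀ := (G ∘ₗ LinearMap.inl _ _ _) (PointModule.val.symm 1)
  let x₁ := (G ∘ₗ LinearMap.inr _ _ _) (PointModule.val.symm 1)
  refine ⟨![x₀, x₁], Fin.forall_fin_two.2 ⟨(killed_pointModule hI _).map _,
    (killed_pointModule hI _).map _⟩, Fin.forall_fin_two.2 ⟨?_, ?_⟩, fun v hv => ?_⟩
  · change op (idem I (e 0)) • x₀ = x₀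
    rw [← map_smul, idem_smul_pointModule]
  · change op (idem I (e 1)) • x₁ = x₁
    rw [← map_smul, idem_smul_pointModule]
  · have hs : G (algebraMap k (BoundAlgebra I)ᵐᵒᵖ (v 0) • PointModule.val.symm 1,
        algebraMap k (BoundAlgebra I)ᵐᵒᵖ (v 1) • PointModule.val.symm 1) = 0 := by
      rw [← hv, Fin.sum_univ_two]
      change _ = _ • (G ∘ₗ LinearMap.inl _ _ _) _ + _ • (G ∘ₗ LinearMap.inr _ _ _) _
      rw [LinearMap.comp_apply, LinearMap.comp_apply, ← G.map_smul, ← G.map_smul, ← map_add,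
        LinearMap.inl_apply, LinearMap.inr_apply, Prod.smul_mk, Prod.smul_mk, Prod.mk_add_mk,
        smul_zero, smul_zero, add_zero, zero_add]
    have hv' := (injective_iff_map_eq_zero _).1 hG _ hs
    obtain ⟨h0, h1⟩ := Prod.mk_eq_zero.1 hv'
    have key : ∀ {y : Q} (r : k), algebraMap k (BoundAlgebra I)ᵐᵒᵖ r •
        (PointModule.val.symm 1 : PointModule hI y) = 0 → r = 0 := by
      intro y r hr
      rw [← mul_one r, ← PointModule.val.map_eq_zero_iff.2 hr, PointModule.op_algebraMap_smul]
      rfl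
    exact funext (Fin.forall_fin_two.2 ⟨key _ h0, key _ h1⟩)

theorem coeffs_algebraMap_smul {z : Q} (r : k) (y : Proj I z) (q : QPath Q) :
    coeffs hI ((algebraMap k (BoundAlgebra I)ᵐᵒᵖ r • y : Proj I z) : BoundAlgebra I) q =
      r * coeffs hI (y : BoundAlgebra I) q := by
  have : ((algebraMap k (BoundAlgebra I)ᵐᵒᵖ r • y : Proj I z) : BoundAlgebra I) =
      r • (y : BoundAlgebra I) := by
    rw [Algebra.smul_def, Algebra.commutes]
    rfl
  rw [this, map_smul, Pi.smul_apply, smul_eq_mul]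

theorem coeffs_op_smul {z : Q} {y : Proj I z} {p q r : QPath Q} (h : QComp p q r)
    (hr : IsNonzero I r.2.2) :
    coeffs hI ((op (qcls I q) • y : Proj I z) : BoundAlgebra I) r =
      coeffs hI (y : BoundAlgebra I) p := coeffs_mul_qcls hI _ h hr

/-- The coefficient at a proper initial subpath of `u i` reappears at `u i` after acting by the
remaining non-stationary path, and that action is zero. -/
theorem Killed.eq_zero_of_coeffs {z : Q} {w : Fin 2 → Q} {u : ∀ i, Path z (w i)}
    (hp : MaximalPairFrom I (u 0) (u 1)) {y : Proj I z} (hy : Killed I y)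
    (h : ∀ i, coeffs hI (y : BoundAlgebra I) (toQ (u i)) = 0) : y = 0 := by
  have hnz : ∀ i, IsNonzero I (u i) := Fin.forall_fin_two.2 ⟨hp.nonzero_left, hp.nonzero_right⟩
  refine Subtype.ext (coeffs_inj hI fun q hq => ?_)
  rw [Submodule.coe_zero, map_zero, Pi.zero_apply]
  by_cases hqz : q.1 = z
  · obtain ⟨z', b, q⟩ := q
    obtain rfl : z' = z := hqz
    obtain ⟨i, r, hr⟩ : ∃ i, IsInitial q (u i) :=
      (hp.cover q hq).elim (fun h => ⟨0, h⟩) fun h => ⟨1, h⟩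
    have hc : QComp (toQ q) (toQ r) (toQ (u i)) := by
      rw [hr]
      exact QComp.mk q r
    by_cases hl : r.length = 0
    · have : toQ q = toQ (u i) := by
        rw [hr]
        cases r with
        | nil => rfl
        | cons r e => simp at hl
      exact (congrArg (coeffs hI (y : BoundAlgebra I)) this).trans (h i)
    · rw [← coeffs_op_smul hI hc (hnz i), hy (toQ r) hl, Submodule.coe_zero, map_zero,
        Pi.zero_apply]
  · rw [← mem_proj_iff.1 y.2, idem_eq]
    exact coeffs_qcls_mul_of_not hI _ fun h =>
      hqz (PathSys.Init.s_eq (p := toQ (Path.nil : Path z z)) h)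

-- The matrix now consists of the coefficients at `u 0`, `u 1` of two independent socle elements. It
-- is invertible because an element killed by the radical is determined by these coefficients.
include hI in
theorem MaximalPairFrom.of_soc {z : Q} {e w : Fin 2 → Q} {u : ∀ i, Path z (w i)}
    (hp : MaximalPairFrom I (u 0) (u 1))
    (h : Nonempty (Soc (BoundAlgebra I)ᵐᵒᵖ (Proj I z) ≃ₗ[(BoundAlgebra I)ᵐᵒᵖ]
      (Simp I (e 0) × Simp I (e 1)))) :
    (∀ i, (u i).length ≠ 0) ∧ ((w 0 = e 0 ∧ w 1 = e 1) ∨ (w 0 = e 1 ∧ w 1 = e 0)) := by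
  obtain ⟨x, hx, hxe, hind⟩ := exists_socle_elements hI h
  have hnz : ∀ i, IsNonzero I (u i) := Fin.forall_fin_two.2 ⟨hp.nonzero_left, hp.nonzero_right⟩
  let m : Matrix (Fin 2) (Fin 2) k := fun i j => coeffs hI (x j : BoundAlgebra I) (toQ (u i))
  have hm : ∀ i j, w i ≠ e j → m i j = 0 := fun i j hij => by
    change coeffs hI (x j : BoundAlgebra I) (toQ (u i)) = 0
    rw [← hxe j]
    exact coeffs_mul_qcls_of_not hI _ fun h => hij
      (PathSys.Init.s_eq (S := (quiverSys I).op) (p := toQ (Path.nil : Path (e j) (e j)))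
        (q := toQ (u i)) h)
  have hd : m.det ≠ 0 := by
    rw [← isUnit_iff_ne_zero, ← Matrix.isUnit_iff_isUnit_det, ← Matrix.mulVec_injective_iff_isUnit]
    refine (injective_iff_map_eq_zero m.mulVecLin).2 fun v hv => hind v ?_
    have hk : Killed I (∑ j, algebraMap k (BoundAlgebra I)ᵐᵒᵖ (v j) • x j) := fun q hq => by
      rw [Finset.smul_sum]
      refine Finset.sum_eq_zero fun j _ => ?_
      refine (algebraMap_smul_comm (v j) (op (qcls I q)) (x j)).trans ?_
      rw [hx j q hq, smul_zero]
    refine hk.eq_zero_of_coeffs hI hp fun i => ?_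
    rw [Fin.sum_univ_two, Submodule.coe_add, map_add, Pi.add_apply, coeffs_algebraMap_smul,
      coeffs_algebraMap_smul, mul_comm, mul_comm (v 1)]
    have hvi := congrFun hv i
    rwa [Matrix.mulVecLin_apply, Matrix.mulVec, dotProduct, Fin.sum_univ_two] at hvi
  -- If `u i` is stationary, the coefficient of `x j` at `u i` is that of `x j` acted on by `u i'`,
  -- read at `u i'`. As `x j` is killed by the radical, the action is by a scalar and the rows are
  -- proportional.
  have hstat : ∀ i i', i ≠ i' → (u i).length ≠ 0 := fun i i' hi hl =>
    hd (det_eq_zero_of_smul_row hi (r := coeffs hI (qcls I (toQ (u i')))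
      (toQ (Path.nil : Path (w i') (w i')))) fun j => by
        have hc : QComp (toQ (u i)) (toQ (u i')) (toQ (u i')) := by
          rw [eq_nil_of_length (q := toQ (u i)) hl]
          exact nil_qcomp (toQ (u i'))
        change coeffs hI (x j : BoundAlgebra I) (toQ (u i)) = _
        rw [← coeffs_op_smul hI hc (hnz i'), (hx j).op_smul hI (hxe j), coeffs_algebraMap_smul]
        change _ * m i' j = _
        have hcf : ∀ y, w i' = y → coeffs hI (qcls I (toQ (u i'))) (toQ (Path.nil : Path y y)) =
            coeffs hI (qcls I (toQ (u i'))) (toQ (Path.nil : Path (w i') (w i'))) := by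
          rintro _ rfl
          rfl
        by_cases hij : w i' = e j
        · rw [hcf _ hij]
        · rw [hm i' j hij, mul_zero, mul_zero])
  exact ⟨Fin.forall_fin_two.2 ⟨hstat 0 1 (by decide), hstat 1 0 (by decide)⟩,
    points_eq_of_det_ne_zero hm hd⟩

end TopSocle

/-! ### The lemma and the existence part of the corollary -/

section Main

variable {k Q : Type u} [Field k] [Fintype Q] [Quiver.{u} Q]
  {I : TwoSidedIdeal (PathAlgebra k Q)} (hI : IsStringPresentation I)
  {N : Type u} [AddCommGroup N] [Module (BoundAlgebra I)ᵐᵒᵖ N]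

/-- A family of two elements. -/
def pairFamily {α : Fin 2 → Type*} (x : α 0) (y : α 1) : ∀ i, α i
  | 0 => x
  | 1 => y

include hI in
theorem isSumOfUniserials_of_isSecondSyzygy {c : Q}
    (h : IsSecondSyzygy (BoundAlgebra I)ᵐᵒᵖ (Inj I c) N) :
    IsSumOfUniserials (BoundAlgebra I)ᵐᵒᵖ 6 N := by
  have hdeg : ∀ {y₀ y₁ : Q} {m₀ : Path y₀ c} {m₁ : Path y₁ c}, MaximalPairTo I m₀ m₁ →
      m₁.length = 0 → IsSumOfUniserials (BoundAlgebra I)ᵐᵒᵖ 6 N := by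
    intro y₀ y₁ m₀ m₁ hp hl
    obtain ⟨R, hR⟩ := exists_resData₁ hI hp hl
    exact R.isSumOfUniserials hI (by rw [hR]; exact h)
  obtain ⟨y₀, y₁, m₀, m₁, hp⟩ := exists_maximalPairTo hI c
  -- A stationary maximal path means that `I(c)` has only one generating path, the case of
  -- `ResData₁`; otherwise the full resolution applies.
  by_cases h₁ : m₁.length = 0
  · exact hdeg hp h₁
  by_cases h₀ : m₀.length = 0
  · exact hdeg hp.symm h₀
  obtain ⟨R, hR⟩ := exists_projResData hI (a := ![y₀, y₁])
    (pairFamily (α := fun i => Path (![y₀, y₁] i) c) m₀ m₁) (Fin.forall_fin_two.2 ⟨h₀, h₁⟩) hp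
  exact R.isSumOfUniserials hI (by rw [hR]; exact Fin.forall_fin_two.2 ⟨h₀, h₁⟩) h

include hI in
theorem isSumOfUniserials_of_isSecondCosyzygy {z : Q}
    (h : IsSecondCosyzygy (BoundAlgebra I)ᵐᵒᵖ (Proj I z) N) :
    IsSumOfUniserials (BoundAlgebra I)ᵐᵒᵖ 6 N := by
  have hdeg : ∀ {y₀ y₁ : Q} {m₀ : Path z y₀} {m₁ : Path z y₁}, MaximalPairFrom I m₀ m₁ →
      m₁.length = 0 → IsSumOfUniserials (BoundAlgebra I)ᵐᵒᵖ 6 N := by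
    intro y₀ y₁ m₀ m₁ hp hl
    obtain ⟨R, hR⟩ := exists_resData₁_op hI hp hl
    exact R.isSumOfUniserials_op hI (by rw [hR]; exact h)
  obtain ⟨y₀, y₁, m₀, m₁, hp⟩ := exists_maximalPairFrom hI z
  by_cases h₁ : m₁.length = 0
  · exact hdeg hp h₁
  by_cases h₀ : m₀.length = 0
  · exact hdeg hp.symm h₀
  obtain ⟨R, hR⟩ := exists_injResData hI (e := ![y₀, y₁])
    (pairFamily (α := fun i => Path z (![y₀, y₁] i)) m₀ m₁) (Fin.forall_fin_two.2 ⟨h₀, h₁⟩) hp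
  exact R.isSumOfUniserials hI (by rw [hR]; exact Fin.forall_fin_two.2 ⟨h₀, h₁⟩) h

-- The top determines the starting points of the two maximal paths only up to order; the symmetry of
-- maximal pairs settles the swapped case.
include hI in
theorem nonempty_projResData {c : Q} {a : Fin 2 → Q}
    (h : Nonempty (ModTop (BoundAlgebra I)ᵐᵒᵖ (Inj I c) ≃ₗ[(BoundAlgebra I)ᵐᵒᵖ]
      (Simp I (a 0) × Simp I (a 1)))) : Nonempty (ProjResData I c a) := by
  have key : ∀ {y₀ y₁ : Q} {m₀ : Path y₀ c} {m₁ : Path y₁ c}, MaximalPairTo I m₀ m₁ →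
      m₀.length ≠ 0 → m₁.length ≠ 0 → y₀ = a 0 → y₁ = a 1 → Nonempty (ProjResData I c a) := by
    rintro y₀ y₁ m₀ m₁ hp h₀ h₁ rfl rfl
    obtain ⟨R, -⟩ := exists_projResData hI (pairFamily (α := fun i => Path (a i) c) m₀ m₁)
      (Fin.forall_fin_two.2 ⟨h₀, h₁⟩) hp
    exact ⟨R⟩
  obtain ⟨y₀, y₁, m₀, m₁, hp⟩ := exists_maximalPairTo hI c
  obtain ⟨hl, h'⟩ := MaximalPairTo.of_top hI (b := ![y₀, y₁])
    (u := pairFamily (α := fun i => Path (![y₀, y₁] i) c) m₀ m₁) hp h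
  rcases h' with ⟨h₀, h₁⟩ | ⟨h₀, h₁⟩
  · exact key hp (hl 0) (hl 1) h₀ h₁
  · exact key hp.symm (hl 1) (hl 0) h₁ h₀

include hI in
theorem nonempty_injResData {z : Q} {e : Fin 2 → Q}
    (h : Nonempty (Soc (BoundAlgebra I)ᵐᵒᵖ (Proj I z) ≃ₗ[(BoundAlgebra I)ᵐᵒᵖ]
      (Simp I (e 0) × Simp I (e 1)))) : Nonempty (InjResData I z e) := by
  have key : ∀ {y₀ y₁ : Q} {m₀ : Path z y₀} {m₁ : Path z y₁}, MaximalPairFrom I m₀ m₁ →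
      m₀.length ≠ 0 → m₁.length ≠ 0 → y₀ = e 0 → y₁ = e 1 → Nonempty (InjResData I z e) := by
    rintro y₀ y₁ m₀ m₁ hp h₀ h₁ rfl rfl
    obtain ⟨R, -⟩ := exists_injResData hI (pairFamily (α := fun i => Path z (e i)) m₀ m₁)
      (Fin.forall_fin_two.2 ⟨h₀, h₁⟩) hp
    exact ⟨R⟩
  obtain ⟨y₀, y₁, m₀, m₁, hp⟩ := exists_maximalPairFrom hI z
  obtain ⟨hl, h'⟩ := MaximalPairFrom.of_soc hI (w := ![y₀, y₁])
    (u := pairFamily (α := fun i => Path z (![y₀, y₁] i)) m₀ m₁) hp h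
  rcases h' with ⟨h₀, h₁⟩ | ⟨h₀, h₁⟩
  · exact key hp (hl 0) (hl 1) h₀ h₁
  · exact key hp.symm (hl 1) (hl 0) h₁ h₀

end Main

end StringAlgebra

end

open StringAlgebra

theorem lemma3p5 {k Q : Type u} [Field k] [Fintype Q] [Quiver.{u} Q]
    (I : TwoSidedIdeal (PathAlgebra k Q)) (hI : IsStringPresentation I) :
    -- the second syzygy of an indecomposable injective
    (∀ (M : Type u) [AddCommGroup M] [Module (BoundAlgebra I)ᵐᵒᵖ M],
      Module.Finite (BoundAlgebra I)ᵐᵒᵖ M → Module.Injective (BoundAlgebra I)ᵐᵒᵖ M →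
      IsIndecomposable (BoundAlgebra I)ᵐᵒᵖ M →
      ∀ (N : Type u) [AddCommGroup N] [Module (BoundAlgebra I)ᵐᵒᵖ N],
        IsSecondSyzygy (BoundAlgebra I)ᵐᵒᵖ M N → IsSumOfUniserials (BoundAlgebra I)ᵐᵒᵖ 6 N) ∧
    -- the second cosyzygy of an indecomposable projective
    (∀ (M : Type u) [AddCommGroup M] [Module (BoundAlgebra I)ᵐᵒᵖ M],
      Module.Finite (BoundAlgebra I)ᵐᵒᵖ M → Module.Projective (BoundAlgebra I)ᵐᵒᵖ M →
      IsIndecomposable (BoundAlgebra I)ᵐᵒᵖ M →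
      ∀ (N : Type u) [AddCommGroup N] [Module (BoundAlgebra I)ᵐᵒᵖ N],
        IsSecondCosyzygy (BoundAlgebra I)ᵐᵒᵖ M N → IsSumOfUniserials (BoundAlgebra I)ᵐᵒᵖ 6 N) ∧
    -- the minimal projective resolution of `I(c)`
    (∀ (c : Q) (a : Fin 2 → Q),
      Nonempty (ModTop (BoundAlgebra I)ᵐᵒᵖ (Inj I c) ≃ₗ[(BoundAlgebra I)ᵐᵒᵖ]
        (Simp I (a 0) × Simp I (a 1))) →
      Nonempty (ProjResData I c a) ∧ ∀ R : ProjResData I c a, R.GivesResolution) ∧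
    -- the minimal injective coresolution of `P(z)`
    (∀ (z : Q) (e : Fin 2 → Q),
      Nonempty (Soc (BoundAlgebra I)ᵐᵒᵖ (Proj I z) ≃ₗ[(BoundAlgebra I)ᵐᵒᵖ]
        (Simp I (e 0) × Simp I (e 1))) →
      Nonempty (InjResData I z e) ∧ ∀ R : InjResData I z e, R.GivesCoresolution) := by

  refine ⟨fun M _ _ _ hE hM N _ _ h => ?_, fun M _ _ _ hP hM N _ _ h => ?_, fun c a h => ?_,
    fun z e h => ?_⟩
  · obtain ⟨x, ⟨i⟩⟩ := exists_equiv_inj hI hE hM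
    exact isSumOfUniserials_of_isSecondSyzygy hI (h.of_equiv i)
  · obtain ⟨x, ⟨i⟩⟩ := exists_equiv_proj hI hP hM
    exact isSumOfUniserials_of_isSecondCosyzygy hI (h.of_equiv i)
  · refine ⟨nonempty_projResData hI h, fun R => ?_⟩
    -- Whatever paths were chosen, the two-point top ensures that `[a_0, c]` and `[a_1, c]` are
    -- non-stationary, as the resolution requires.
    obtain ⟨ε, d, hp, hr, -⟩ := R.exists_resolution hI (R.pair_c.of_top hI h).1
    exact ⟨ε, d, hp, hr⟩
  · refine ⟨nonempty_injResData hI h, fun R => ?_⟩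
    obtain ⟨η, d, hp, hr, -⟩ := R.exists_coresolution hI (R.pair_z.of_soc hI h).1
    exact ⟨η, d, hp, hr⟩
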